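/- Let $\rho$ be a bipartite state (density matrix) on $\mathcal{H}^A\otimes\mathcal{H}^B$ with $\mathcal{H}^A,\mathcal{H}^B$ finite-dimensional. Say that a rate $R$ of entanglement distillation is achievable for $\rho$ if for every $\epsilon>0$ there are integers $n,d\ge 1$, a (finite-round) LOCC protocol $\mathcal{L}$ and a $d\otimes d$ maximally entangled pure state $\Lambda_d$ (both reduced states are $\mathbb{I}/d$) such that $\tfrac12\|\mathcal{L}(\rho^{\otimes n})-\Lambda_d\|_1\le\epsilon$ and $\tfrac1n\log_2 d>R-\epsilon$; and say that $\rho$ has distillable entanglement if some rate $R>0$ is achievable. A positive semidefinite operator on a bipartite space is called entangled if it is not a finite sum of tensor products of positive semidefinite operators. Then $\rho$ has distillable entanglement if and only if for every orthonormal basis $\mathcal{B}_A=\{|x\rangle^A\}$ of $\mathcal{H}^A$ and every orthonormal basis $\mathcal{B}_B=\{|y\rangle^B\}$ of $\mathcal{H}^B$ there exist an integer $k$ and rank-two projectors $P_A=|\alpha_0\rangle\langle\alpha_0|+|\alpha_1\rangle\langle\alpha_1|$ on $(\mathcal{H}^A)^{\otimes k}$ and $P_B=|\beta_0\rangle\langle\beta_0|+|\beta_1\rangle\langle\beta_1|$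 on $(\mathcal{H}^B)^{\otimes k}$, with $\{|\alpha_0\rangle,|\alpha_1\rangle\}$ and $\{|\beta_0\rangle,|\beta_1\rangle\}$ orthonormal, such that 1. $(P_A\otimes P_B)\,\rho^{\otimes k}\,(P_A\otimes P_B)$ is entangled (with respect to the cut between $(\mathcal{H}^A)^{\otimes k}$ and $(\mathcal{H}^B)^{\otimes k}$), and 2. $\mathrm{tr}[\Delta_A(|\alpha_0\rangle\langle\alpha_0|)\,\Delta_A(|\alpha_1\rangle\langle\alpha_1|)]=\mathrm{tr}[\Delta_B(|\beta_0\rangle\langle\beta_0|)\,\Delta_B(|\beta_1\rangle\langle\beta_1|)]=0$, where $\Delta_Z(\sigma)=\sum_{b\in\mathcal{B}_Z^{\otimes k}}|b\rangle\langle b|\,\sigma\,|b\rangle\langle b|$ is the completely dephasing map in the product basis $\mathcal{B}_Z^{\otimes k}$. -/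

import Mathlib

open scoped Kronecker ComplexOrder

/-! Operators on a finite-dimensional bipartite system `ℂ^A ⊗ ℂ^B` are matrices indexed by `A × B`,
where `A` and `B` are finite types. -/

/-- A density matrix: positive semidefinite with unit trace. -/
def IsDensityMatrix {X : Type} [Fintype X] (ρ : Matrix X X ℂ) : Prop :=
  ρ.PosSemidef ∧ ρ.trace = 1

/-- The rank-one operator `|v⟩⟨v|`. -/
def ketBra {X : Type} (v : X → ℂ) : Matrix X X ℂ :=
  Matrix.vecMulVec v (star v)

/-- The `k`-fold tensor power `ρ^{⊗k}` of a bipartite operator, seen as a bipartite operator between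
the `k` systems of Alice and the `k` systems of Bob. -/
def tensorPower {A B : Type} (ρ : Matrix (A × B) (A × B) ℂ) (k : ℕ) :
    Matrix ((Fin k → A) × (Fin k → B)) ((Fin k → A) × (Fin k → B)) ℂ :=
  Matrix.of fun x y => ∏ i : Fin k, ρ (x.1 i, x.2 i) (y.1 i, y.2 i)

/-- A (not necessarily normalized) bipartite operator is separable if it is a finite sum of tensor
products of positive semidefinite operators. -/
def IsSeparableOperator {A B : Type} [Fintype A] [Fintype B] (M : Matrix (A × B) (A × B) ℂ) : Prop :=
  ∃ (s : ℕ) (a : Fin s → Matrix A A ℂ) (b : Fin s → Matrix B B ℂ),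
    (∀ i, (a i).PosSemidef) ∧ (∀ i, (b i).PosSemidef) ∧ M = ∑ i, a i ⊗ₖ b i

/-- A (not necessarily normalized) bipartite state is entangled if it is not separable. -/
def IsEntangled {A B : Type} [Fintype A] [Fintype B] (M : Matrix (A × B) (A × B) ℂ) : Prop :=
  M.PosSemidef ∧ ¬ IsSeparableOperator M

/-- Finite-round LOCC protocols from the system `A × B` to the system `A' × B'`. In each round one
party applies a local measurement, given by a complete finite set of Kraus operators (the dimension
of the output may depend on the outcome), and announces the outcome, on which the rest of the
protocol may depend. Local ancillas, local channels and discarding of local systems are instances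
of such measurements. -/
inductive LOCCProtocol (A' B' : Type) [Fintype A'] [DecidableEq A'] [Fintype B'] [DecidableEq B'] :
    (A B : Type) → [Fintype A] → [DecidableEq A] → [Fintype B] → [DecidableEq B] → Type 1
  /-- Stop. -/
  | done : LOCCProtocol A' B' A' B'
  /-- Alice measures and announces the outcome. -/
  | alice {A B : Type} [Fintype A] [DecidableEq A] [Fintype B] [DecidableEq B]
      {s : ℕ} (C : Fin s → Type) [∀ i, Fintype (C i)] [∀ i, DecidableEq (C i)]
      (K : ∀ i, Matrix (C i) A ℂ) (complete : ∑ i, (K i).conjTranspose * K i = 1)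
      (next : ∀ i, LOCCProtocol A' B' (C i) B) : LOCCProtocol A' B' A B
  /-- Bob measures and announces the outcome. -/
  | bob {A B : Type} [Fintype A] [DecidableEq A] [Fintype B] [DecidableEq B]
      {s : ℕ} (C : Fin s → Type) [∀ i, Fintype (C i)] [∀ i, DecidableEq (C i)]
      (K : ∀ i, Matrix (C i) B ℂ) (complete : ∑ i, (K i).conjTranspose * K i = 1)
      (next : ∀ i, LOCCProtocol A' B' A (C i)) : LOCCProtocol A' B' A B

/-- The action of an LOCC protocol on operators: the sum over all sequences of outcomes of the
unnormalized output states. -/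
noncomputable def LOCCProtocol.run {A' B' : Type}
    [Fintype A'] [DecidableEq A'] [Fintype B'] [DecidableEq B'] :
    {A B : Type} → [_fA : Fintype A] → [_dA : DecidableEq A] →
    [_fB : Fintype B] → [_dB : DecidableEq B] →
    LOCCProtocol A' B' A B → Matrix (A × B) (A × B) ℂ → Matrix (A' × B') (A' × B') ℂ
  | _, _, _, _, _, _, .done, ρ => ρ
  | _, _, _, _, _, _, @LOCCProtocol.alice _ _ _ _ _ _ _ B _ _ _fB _dB _ _ _fC _dC K _ next, ρ =>
      ∑ i, (next i).run
        ((K i ⊗ₖ (1 : Matrix B B ℂ)) * ρ * (K i ⊗ₖ (1 : Matrix B B ℂ)).conjTranspose)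
  | _, _, _, _, _, _, @LOCCProtocol.bob _ _ _ _ _ _ A _ _fA _dA _ _ _ _ _fC _dC K _ next, ρ =>
      ∑ i, (next i).run
        (((1 : Matrix A A ℂ) ⊗ₖ K i) * ρ * ((1 : Matrix A A ℂ) ⊗ₖ K i).conjTranspose)

/-- The trace norm `tr √(M† M)`. -/
noncomputable def traceNorm {X : Type} [Fintype X] [DecidableEq X] (M : Matrix X X ℂ) : ℝ :=
  ∑ i, Real.sqrt ((Matrix.isHermitian_conjTranspose_mul_self M).eigenvalues i)

/-- The trace distance. -/
noncomputable def traceDistance {X : Type} [Fintype X] [DecidableEq X] (ρ σ : Matrix X X ℂ) : ℝ :=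
  traceNorm (ρ - σ) / 2

/-- Alice's reduced operator. -/
def reducedA {A B : Type} [Fintype B] (M : Matrix (A × B) (A × B) ℂ) : Matrix A A ℂ :=
  Matrix.of fun x x' => ∑ y, M (x, y) (x', y)

/-- Bob's reduced operator. -/
def reducedB {A B : Type} [Fintype A] (M : Matrix (A × B) (A × B) ℂ) : Matrix B B ℂ :=
  Matrix.of fun y y' => ∑ x, M (x, y) (x, y')

/-- `ψ` is a `d ⊗ d` maximally entangled vector: both reduced states of `|ψ⟩⟨ψ|` are `𝟙 / d`. -/
def IsMaximallyEntangled {d : ℕ} (ψ : Fin d × Fin d → ℂ) : Prop :=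
  reducedA (ketBra ψ) = (d : ℂ)⁻¹ • (1 : Matrix (Fin d) (Fin d) ℂ) ∧
  reducedB (ketBra ψ) = (d : ℂ)⁻¹ • (1 : Matrix (Fin d) (Fin d) ℂ)

/-- `R` is an achievable rate of entanglement distillation by LOCC: for every `ε > 0` some LOCC
protocol maps `n` copies of `ρ` to within `ε` of a `d ⊗ d` maximally entangled state
with `(log₂ d) / n > R - ε`. -/
def IsAchievableDistillationRate {A B : Type}
    [Fintype A] [DecidableEq A] [Fintype B] [DecidableEq B]
    (ρ : Matrix (A × B) (A × B) ℂ) (R : ℝ) : Prop :=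
  ∀ ε : ℝ, 0 < ε → ∃ n d : ℕ, 0 < n ∧ 0 < d ∧
    ∃ (L : LOCCProtocol (Fin d) (Fin d) (Fin n → A) (Fin n → B)) (ψ : Fin d × Fin d → ℂ),
      IsMaximallyEntangled ψ ∧
      traceDistance (L.run (tensorPower ρ n)) (ketBra ψ) ≤ ε ∧
      R - ε < Real.logb 2 d / n

/-- `ρ` has distillable entanglement: some positive rate is achievable. -/
def HasDistillableEntanglement {A B : Type}
    [Fintype A] [DecidableEq A] [Fintype B] [DecidableEq B]
    (ρ : Matrix (A × B) (A × B) ℂ) : Prop :=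
  ∃ R : ℝ, 0 < R ∧ IsAchievableDistillationRate ρ R

/-- The product vectors `|x₁⟩ ⊗ ⋯ ⊗ |x_k⟩` of the basis `𝓑^{⊗k}`. -/
noncomputable def productBasis {X : Type} [Fintype X]
    (b : OrthonormalBasis X ℂ (EuclideanSpace ℂ X)) (k : ℕ) (x : Fin k → X) : (Fin k → X) → ℂ :=
  fun t => ∏ i, b (x i) (t i)

/-- The completely dephasing map `σ ↦ ∑ₓ |x⟩⟨x| σ |x⟩⟨x|` in the basis `𝓑^{⊗k}`. -/
noncomputable def dephase {X : Type} [Fintype X] [DecidableEq X]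
    (b : OrthonormalBasis X ℂ (EuclideanSpace ℂ X)) (k : ℕ)
    (σ : Matrix (Fin k → X) (Fin k → X) ℂ) : Matrix (Fin k → X) (Fin k → X) ℂ :=
  ∑ x, ketBra (productBasis b k x) * σ * ketBra (productBasis b k x)

set_option linter.unusedSectionVars false

/-! Write Φ = ∑ᵢ |ii⟩ for the unnormalized maximally entangled vector, so that `maxOverlap M` is the
real part of ⟨Φ|M|Φ⟩. Both directions pass through one criterion: some pair of filters from finitely
many copies of ρ to two qubits yields an operator Z with ⟨Φ|Z|Φ⟩ > tr Z, that is, with fidelity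
above one half (`IsEntanglingFilter`). Separable operators never satisfy this, by Cauchy–Schwarz
(`IsSeparableOperator.maxOverlap_le`).

Sufficiency uses only condition 1, for one choice of bases. The projected operator is a two-qubit
operator, and an entangled two-qubit operator meets the criterion after a further filter
(`isSeparableOperator_of_forall_maxOverlap_le`). Indeed, Takagi factorization writes it as a sum of
four vectors that are orthogonal for the form polarizing the determinant. If no weight exceeds the
sum of the others, the vectors can be mixed into product vectors; otherwise the vectors generate a
quaternion algebra, and making it unitary gives the filter. From fidelity above one half, the filter
is repeated until it succeeds (`exists_converts_of_lt_maxOverlap_localFilter`), one round against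
bit errors and one against phase errors bring the fidelity close to one
(`exists_converts_overlap_near_two`), and a CSS code found by Gilbert–Varshamov counting removes the
remaining errors at a positive rate (`hasDistillableEntanglement_of_converts`).

For necessity, a distilled state has d ≥ 2 and fidelity at least 3/4, so one Kraus branch of the
protocol, and then one two-qubit block of it, meets the criterion
(`HasDistillableEntanglement.exists_isEntanglingFilter`). The rows of the filters must then acquire
disjoint supports in the given product bases. Since ρ is entangled, some ⟨v|ρ|v⟩ is not diagonal in
Alice's basis; m copies of it carry two rows with disjoint supports whose rescaled output tends to
the all-ones matrix (`exists_disjoint_rows`). Tensoring these rows onto the old ones multiplies the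
outputs entrywise, so for large m the strict inequality survives
(`IsEntanglingFilter.exists_rowProduct`). Bob is treated by symmetry, and the normalized conjugate
rows are the required vectors. -/

/-! ### Local filters -/

section LocalFilter

variable {A B A' B' A'' B'' E F E' F' : Type} [Fintype A] [Fintype B] [Fintype A'] [Fintype B']
  [Fintype E] [Fintype F]

/-- The operator `(K ⊗ L) M (K ⊗ L)†`. -/
def localFilter (K : Matrix A' A ℂ) (L : Matrix B' B ℂ) (M : Matrix (A × B) (A × B) ℂ) :
    Matrix (A' × B') (A' × B') ℂ :=
  (K ⊗ₖ L) * M * (K ⊗ₖ L).conjTranspose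

theorem localFilter_localFilter (K : Matrix A'' A' ℂ) (L : Matrix B'' B' ℂ) (K' : Matrix A' A ℂ)
    (L' : Matrix B' B ℂ) (M : Matrix (A × B) (A × B) ℂ) :
    localFilter K L (localFilter K' L' M) = localFilter (K * K') (L * L') M := by
  simp only [localFilter, Matrix.mul_kronecker_mul, Matrix.conjTranspose_mul, Matrix.mul_assoc]

theorem localFilter_add (K : Matrix A' A ℂ) (L : Matrix B' B ℂ) (M N : Matrix (A × B) (A × B) ℂ) :
    localFilter K L (M + N) = localFilter K L M + localFilter K L N := by
  simp only [localFilter, Matrix.mul_add, Matrix.add_mul]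

theorem localFilter_smul (K : Matrix A' A ℂ) (L : Matrix B' B ℂ) (c : ℂ)
    (M : Matrix (A × B) (A × B) ℂ) : localFilter K L (c • M) = c • localFilter K L M := by
  simp only [localFilter, Matrix.mul_smul, Matrix.smul_mul]

theorem localFilter_sum {ι : Type*} (s : Finset ι) (K : Matrix A' A ℂ) (L : Matrix B' B ℂ)
    (M : ι → Matrix (A × B) (A × B) ℂ) :
    localFilter K L (∑ i ∈ s, M i) = ∑ i ∈ s, localFilter K L (M i) := by
  simp only [localFilter, Matrix.mul_sum, Matrix.sum_mul]

theorem localFilter_one [DecidableEq A] [DecidableEq B] (M : Matrix (A × B) (A × B) ℂ) :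
    localFilter (1 : Matrix A A ℂ) (1 : Matrix B B ℂ) M = M := by
  simp [localFilter]

theorem localFilter_smul_smul (c d : ℂ) (K : Matrix A' A ℂ) (L : Matrix B' B ℂ)
    (M : Matrix (A × B) (A × B) ℂ) :
    localFilter (c • K) (d • L) M = (c * star c * (d * star d)) • localFilter K L M := by
  simp only [localFilter, Matrix.smul_kronecker, Matrix.kronecker_smul, Matrix.conjTranspose_smul,
    Matrix.smul_mul, Matrix.mul_smul, smul_smul]
  congr 1
  simp only [star_mul']
  ring

theorem localFilter_apply (K : Matrix A' A ℂ) (L : Matrix B' B ℂ) (M : Matrix (A × B) (A × B) ℂ)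
    (x y : A' × B') : localFilter K L M x y =
      ∑ q, (∑ p : A × B, K x.1 p.1 * L x.2 p.2 * M p q) * star (K y.1 q.1 * L y.2 q.2) := by
  simp only [localFilter, Matrix.mul_apply, Matrix.conjTranspose_apply, Matrix.kroneckerMap_apply]

theorem Matrix.PosSemidef.localFilter {M : Matrix (A × B) (A × B) ℂ} (hM : M.PosSemidef)
    (K : Matrix A' A ℂ) (L : Matrix B' B ℂ) : (localFilter K L M).PosSemidef :=
  hM.mul_mul_conjTranspose_same _

theorem localFilter_kronecker (K : Matrix A' A ℂ) (L : Matrix B' B ℂ) (a : Matrix A A ℂ)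
    (b : Matrix B B ℂ) : localFilter K L (a ⊗ₖ b) =
      (K * a * K.conjTranspose) ⊗ₖ (L * b * L.conjTranspose) := by
  simp only [localFilter, Matrix.mul_kronecker_mul, Matrix.conjTranspose_kronecker]

theorem trace_sum_localFilter_left {ι : Type*} [DecidableEq A] [DecidableEq B] (s : Finset ι)
    (C : ι → Type)
    [∀ i, Fintype (C i)] (K : ∀ i, Matrix (C i) A ℂ)
    (complete : ∑ i ∈ s, (K i).conjTranspose * K i = 1) (M : Matrix (A × B) (A × B) ℂ) :
    ∑ i ∈ s, (localFilter (K i) (1 : Matrix B B ℂ) M).trace = M.trace := by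
  have h : ∀ i, (localFilter (K i) (1 : Matrix B B ℂ) M).trace =
      ((((K i).conjTranspose * K i) ⊗ₖ (1 : Matrix B B ℂ)) * M).trace := by
    intro i
    rw [localFilter, Matrix.trace_mul_comm, ← Matrix.mul_assoc, Matrix.conjTranspose_kronecker,
      ← Matrix.mul_kronecker_mul]
    simp
  simp only [h, ← Matrix.trace_sum, ← Matrix.sum_mul]
  have : ∑ i ∈ s, ((K i).conjTranspose * K i) ⊗ₖ (1 : Matrix B B ℂ) =
      (∑ i ∈ s, (K i).conjTranspose * K i) ⊗ₖ (1 : Matrix B B ℂ) := by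
    ext x y
    simp [Matrix.sum_apply, Finset.sum_mul]
  rw [this, complete]
  simp

theorem trace_sum_localFilter_right {ι : Type*} [DecidableEq A] [DecidableEq B] (s : Finset ι)
    (C : ι → Type)
    [∀ i, Fintype (C i)] (K : ∀ i, Matrix (C i) B ℂ)
    (complete : ∑ i ∈ s, (K i).conjTranspose * K i = 1) (M : Matrix (A × B) (A × B) ℂ) :
    ∑ i ∈ s, (localFilter (1 : Matrix A A ℂ) (K i) M).trace = M.trace := by
  have h : ∀ i, (localFilter (1 : Matrix A A ℂ) (K i) M).trace =
      (((1 : Matrix A A ℂ) ⊗ₖ ((K i).conjTranspose * K i)) * M).trace := by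
    intro i
    rw [localFilter, Matrix.trace_mul_comm, ← Matrix.mul_assoc, Matrix.conjTranspose_kronecker,
      ← Matrix.mul_kronecker_mul]
    simp
  simp only [h, ← Matrix.trace_sum, ← Matrix.sum_mul]
  have : ∑ i ∈ s, (1 : Matrix A A ℂ) ⊗ₖ ((K i).conjTranspose * K i) =
      (1 : Matrix A A ℂ) ⊗ₖ (∑ i ∈ s, (K i).conjTranspose * K i) := by
    ext x y
    simp [Matrix.sum_apply, Finset.mul_sum]
  rw [this, complete]
  simp

/-- The tensor product of two bipartite operators, as a bipartite operator. -/
def bipartiteProd (M : Matrix (A × B) (A × B) ℂ) (N : Matrix (E × F) (E × F) ℂ) :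
    Matrix ((A × E) × (B × F)) ((A × E) × (B × F)) ℂ :=
  (M ⊗ₖ N).submatrix (Equiv.prodProdProdComm A E B F) (Equiv.prodProdProdComm A E B F)

theorem bipartiteProd_apply (M : Matrix (A × B) (A × B) ℂ) (N : Matrix (E × F) (E × F) ℂ) (x y) :
    bipartiteProd M N x y = M (x.1.1, x.2.1) (y.1.1, y.2.1) * N (x.1.2, x.2.2) (y.1.2, y.2.2) := rfl

theorem localFilter_bipartiteProd [Fintype E'] [Fintype F'] (K : Matrix A' A ℂ) (L : Matrix B' B ℂ)
    (K' : Matrix E' E ℂ) (L' : Matrix F' F ℂ)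
    (M : Matrix (A × B) (A × B) ℂ) (N : Matrix (E × F) (E × F) ℂ) :
    localFilter (K ⊗ₖ K') (L ⊗ₖ L') (bipartiteProd M N) =
      bipartiteProd (localFilter K L M) (localFilter K' L' N) := by
  have h : (K ⊗ₖ K') ⊗ₖ (L ⊗ₖ L') = ((K ⊗ₖ L) ⊗ₖ (K' ⊗ₖ L')).submatrix
      (Equiv.prodProdProdComm A' E' B' F') (Equiv.prodProdProdComm A E B F) := by
    ext x y
    simp only [Matrix.kroneckerMap_apply, Matrix.submatrix_apply, Equiv.prodProdProdComm_apply]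
    ring
  rw [localFilter, h, bipartiteProd, bipartiteProd, Matrix.conjTranspose_submatrix,
    Matrix.submatrix_mul_equiv, Matrix.submatrix_mul_equiv, ← localFilter, localFilter_kronecker]
  rfl

theorem bipartiteProd_sum_left {ι : Type*} (s : Finset ι) (M : ι → Matrix (A × B) (A × B) ℂ)
    (N : Matrix (E × F) (E × F) ℂ) :
    bipartiteProd (∑ i ∈ s, M i) N = ∑ i ∈ s, bipartiteProd (M i) N := by
  ext x y
  simp [bipartiteProd_apply, Matrix.sum_apply, Finset.sum_mul]

end LocalFilter

/-! ### Convertibility by LOCC -/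

section Run

variable {A B A' B' : Type} [Fintype A] [DecidableEq A] [Fintype B] [DecidableEq B]
  [Fintype A'] [DecidableEq A'] [Fintype B'] [DecidableEq B']

theorem LOCCProtocol.run_done (M : Matrix (A × B) (A × B) ℂ) :
    (LOCCProtocol.done : LOCCProtocol A B A B).run M = M := rfl

theorem LOCCProtocol.run_alice {s : ℕ} (C : Fin s → Type) [∀ i, Fintype (C i)]
    [∀ i, DecidableEq (C i)] (K : ∀ i, Matrix (C i) A ℂ)
    (complete : ∑ i, (K i).conjTranspose * K i = 1) (next : ∀ i, LOCCProtocol A' B' (C i) B)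
    (M : Matrix (A × B) (A × B) ℂ) :
    (LOCCProtocol.alice C K complete next).run M =
      ∑ i, (next i).run (localFilter (K i) (1 : Matrix B B ℂ) M) := rfl

theorem LOCCProtocol.run_bob {s : ℕ} (C : Fin s → Type) [∀ i, Fintype (C i)]
    [∀ i, DecidableEq (C i)] (K : ∀ i, Matrix (C i) B ℂ)
    (complete : ∑ i, (K i).conjTranspose * K i = 1) (next : ∀ i, LOCCProtocol A' B' A (C i))
    (M : Matrix (A × B) (A × B) ℂ) :
    (LOCCProtocol.bob C K complete next).run M =
      ∑ i, (next i).run (localFilter (1 : Matrix A A ℂ) (K i) M) := rfl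

/-- An LOCC protocol acts by a finite family of product Kraus operators. -/
theorem LOCCProtocol.exists_kraus (L : LOCCProtocol A' B' A B) :
    ∃ (ι : Type) (_ : Fintype ι) (K : ι → Matrix A' A ℂ) (J : ι → Matrix B' B ℂ),
      ∀ M, L.run M = ∑ i, localFilter (K i) (J i) M := by
  induction L with
  | done => exact ⟨Unit, inferInstance, fun _ => 1, fun _ => 1, fun M => by
      simp [LOCCProtocol.run_done, localFilter_one]⟩
  | alice C K complete next ih =>
    choose ι hι K' J' h using ih
    refine ⟨Σ i, ι i, inferInstance, fun x => K' x.1 x.2 * K x.1, fun x => J' x.1 x.2, fun M => ?_⟩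
    rw [LOCCProtocol.run_alice, Fintype.sum_sigma]
    simp [h, localFilter_localFilter]
  | bob C K complete next ih =>
    choose ι hι K' J' h using ih
    refine ⟨Σ i, ι i, inferInstance, fun x => K' x.1 x.2, fun x => J' x.1 x.2 * K x.1, fun M => ?_⟩
    rw [LOCCProtocol.run_bob, Fintype.sum_sigma]
    simp [h, localFilter_localFilter]

theorem LOCCProtocol.trace_run (L : LOCCProtocol A' B' A B) (M : Matrix (A × B) (A × B) ℂ) :
    (L.run M).trace = M.trace := by
  induction L with
  | done => rfl
  | alice C K complete next ih =>
    simp only [LOCCProtocol.run_alice, Matrix.trace_sum, ih]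
    exact trace_sum_localFilter_left _ C K complete M
  | bob C K complete next ih =>
    simp only [LOCCProtocol.run_bob, Matrix.trace_sum, ih]
    exact trace_sum_localFilter_right _ C K complete M

theorem LOCCProtocol.run_sum {ι : Type*} (s : Finset ι) (L : LOCCProtocol A' B' A B)
    (M : ι → Matrix (A × B) (A × B) ℂ) : L.run (∑ i ∈ s, M i) = ∑ i ∈ s, L.run (M i) := by
  obtain ⟨κ, _, K, J, h⟩ := L.exists_kraus
  simp only [h, localFilter_sum]
  exact Finset.sum_comm

theorem LOCCProtocol.run_smul (c : ℂ) (L : LOCCProtocol A' B' A B)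
    (M : Matrix (A × B) (A × B) ℂ) : L.run (c • M) = c • L.run M := by
  obtain ⟨κ, _, K, J, h⟩ := L.exists_kraus
  simp only [h, localFilter_smul, Finset.smul_sum]

theorem Matrix.PosSemidef.run {M : Matrix (A × B) (A × B) ℂ} (hM : M.PosSemidef)
    (L : LOCCProtocol A' B' A B) : (L.run M).PosSemidef := by
  obtain ⟨κ, _, K, J, h⟩ := L.exists_kraus
  rw [h]
  exact Matrix.posSemidef_sum _ fun i _ => hM.localFilter _ _

theorem LOCCProtocol.exists_comp {A'' B'' : Type} [Fintype A''] [DecidableEq A''] [Fintype B'']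
    [DecidableEq B''] (L : LOCCProtocol A' B' A B) (N : LOCCProtocol A'' B'' A' B') :
    ∃ L' : LOCCProtocol A'' B'' A B, ∀ M, L'.run M = N.run (L.run M) := by
  induction L with
  | done => exact ⟨N, fun M => rfl⟩
  | alice C K complete next ih =>
    choose L' h using ih
    refine ⟨.alice C K complete L', fun M => ?_⟩
    simp only [LOCCProtocol.run_alice, h, LOCCProtocol.run_sum]
  | bob C K complete next ih =>
    choose L' h using ih
    refine ⟨.bob C K complete L', fun M => ?_⟩
    simp only [LOCCProtocol.run_bob, h, LOCCProtocol.run_sum]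

theorem sum_conjTranspose_mul_self_kronecker_one {ι : Type*} (s : Finset ι) {E : Type} [Fintype E]
    [DecidableEq E] (C : ι → Type) [∀ i, Fintype (C i)] (K : ∀ i, Matrix (C i) A ℂ)
    (complete : ∑ i ∈ s, (K i).conjTranspose * K i = 1) :
    ∑ i ∈ s, (K i ⊗ₖ (1 : Matrix E E ℂ)).conjTranspose * (K i ⊗ₖ (1 : Matrix E E ℂ)) = 1 := by
  have h : ∀ i, (K i ⊗ₖ (1 : Matrix E E ℂ)).conjTranspose * (K i ⊗ₖ (1 : Matrix E E ℂ)) =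
      ((K i).conjTranspose * K i) ⊗ₖ (1 : Matrix E E ℂ) := by
    intro i
    rw [Matrix.conjTranspose_kronecker, ← Matrix.mul_kronecker_mul]
    simp
  simp only [h]
  rw [← Matrix.one_kronecker_one, ← complete]
  ext x y
  simp [Matrix.sum_apply, Finset.sum_mul]

/-- A protocol can be run in the presence of a further, untouched system. -/
theorem LOCCProtocol.exists_spectator (E F : Type) [Fintype E] [DecidableEq E] [Fintype F]
    [DecidableEq F] (L : LOCCProtocol A' B' A B) :
    ∃ L' : LOCCProtocol (A' × E) (B' × F) (A × E) (B × F),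
      ∀ M N, L'.run (bipartiteProd M N) = bipartiteProd (L.run M) N := by
  induction L with
  | done => exact ⟨.done, fun M N => rfl⟩
  | alice C K complete next ih =>
    choose L' h using ih
    refine ⟨.alice (fun i => C i × E) (fun i => K i ⊗ₖ (1 : Matrix E E ℂ))
      (sum_conjTranspose_mul_self_kronecker_one _ C K complete) L', fun M N => ?_⟩
    simp only [LOCCProtocol.run_alice, bipartiteProd_sum_left, ← h]
    refine Finset.sum_congr rfl fun i _ => ?_
    rw [← Matrix.one_kronecker_one, localFilter_bipartiteProd, localFilter_one]
  | bob C K complete next ih =>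
    choose L' h using ih
    refine ⟨.bob (fun i => C i × F) (fun i => K i ⊗ₖ (1 : Matrix F F ℂ))
      (sum_conjTranspose_mul_self_kronecker_one _ C K complete) L', fun M N => ?_⟩
    simp only [LOCCProtocol.run_bob, bipartiteProd_sum_left, ← h]
    refine Finset.sum_congr rfl fun i _ => ?_
    rw [← Matrix.one_kronecker_one, localFilter_bipartiteProd, localFilter_one]

end Run

/-- Some LOCC protocol maps `ρ` to `σ`. -/
def Converts {A B A' B' : Type} [Fintype A] [DecidableEq A] [Fintype B] [DecidableEq B]
    [Fintype A'] [DecidableEq A'] [Fintype B'] [DecidableEq B'] (ρ : Matrix (A × B) (A × B) ℂ)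
    (σ : Matrix (A' × B') (A' × B') ℂ) : Prop :=
  ∃ L : LOCCProtocol A' B' A B, L.run ρ = σ

namespace Converts

variable {A B A' B' A'' B'' E F : Type} [Fintype A] [DecidableEq A] [Fintype B] [DecidableEq B]
  [Fintype A'] [DecidableEq A'] [Fintype B'] [DecidableEq B']
  [Fintype A''] [DecidableEq A''] [Fintype B''] [DecidableEq B'']
  [Fintype E] [DecidableEq E] [Fintype F] [DecidableEq F]

theorem refl (ρ : Matrix (A × B) (A × B) ℂ) : Converts ρ ρ := ⟨.done, rfl⟩

theorem trans {ρ : Matrix (A × B) (A × B) ℂ} {σ : Matrix (A' × B') (A' × B') ℂ}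
    {τ : Matrix (A'' × B'') (A'' × B'') ℂ} (h : Converts ρ σ) (h' : Converts σ τ) :
    Converts ρ τ := by
  obtain ⟨L, rfl⟩ := h
  obtain ⟨N, rfl⟩ := h'
  obtain ⟨L', h⟩ := L.exists_comp N
  exact ⟨L', h ρ⟩

/-- Outcomes indexed by an arbitrary finite type allow measurements labelled by basis elements or
Booleans. -/
theorem alice {ι : Type*} [Fintype ι] (C : ι → Type) [∀ i, Fintype (C i)]
    [∀ i, DecidableEq (C i)] (K : ∀ i, Matrix (C i) A ℂ)
    (complete : ∑ i, (K i).conjTranspose * K i = 1) {ρ : Matrix (A × B) (A × B) ℂ}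
    {σ : ι → Matrix (A' × B') (A' × B') ℂ}
    (h : ∀ i, Converts (localFilter (K i) (1 : Matrix B B ℂ) ρ) (σ i)) :
    Converts ρ (∑ i, σ i) := by
  choose L hL using h
  let e := (Fintype.equivFin ι).symm
  refine ⟨.alice (fun i => C (e i)) (fun i => K (e i)) ?_ (fun i => L (e i)), ?_⟩
  · rw [← complete]
    exact e.sum_comp fun i => (K i).conjTranspose * K i
  · simp only [LOCCProtocol.run_alice, hL]
    exact e.sum_comp σ

theorem bob {ι : Type*} [Fintype ι] (C : ι → Type) [∀ i, Fintype (C i)]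
    [∀ i, DecidableEq (C i)] (K : ∀ i, Matrix (C i) B ℂ)
    (complete : ∑ i, (K i).conjTranspose * K i = 1) {ρ : Matrix (A × B) (A × B) ℂ}
    {σ : ι → Matrix (A' × B') (A' × B') ℂ}
    (h : ∀ i, Converts (localFilter (1 : Matrix A A ℂ) (K i) ρ) (σ i)) :
    Converts ρ (∑ i, σ i) := by
  choose L hL using h
  let e := (Fintype.equivFin ι).symm
  refine ⟨.bob (fun i => C (e i)) (fun i => K (e i)) ?_ (fun i => L (e i)), ?_⟩
  · rw [← complete]
    exact e.sum_comp fun i => (K i).conjTranspose * K i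
  · simp only [LOCCProtocol.run_bob, hL]
    exact e.sum_comp σ

/-- Both parties apply local isometries. -/
theorem isometry (U : Matrix A' A ℂ) (V : Matrix B' B ℂ) (hU : U.conjTranspose * U = 1)
    (hV : V.conjTranspose * V = 1) (ρ : Matrix (A × B) (A × B) ℂ) :
    Converts ρ (localFilter U V ρ) := by
  have h : Converts ρ (∑ _i : Unit, localFilter U V ρ) := by
    refine alice (fun _ => A') (fun _ => U) (by simpa using hU) fun _ => ?_
    have h' : Converts (localFilter U (1 : Matrix B B ℂ) ρ) (∑ _i : Unit, localFilter U V ρ) := by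
      refine bob (fun _ => B') (fun _ => V) (by simpa using hV) fun _ => ?_
      rw [localFilter_localFilter, Matrix.one_mul, Matrix.mul_one]
      exact refl _
    simpa using h'
  simpa using h

/-- A relabelling of local basis vectors is a local permutation matrix, hence an isometry. -/
theorem reindex (e : A' ≃ A) (f : B' ≃ B) (ρ : Matrix (A × B) (A × B) ℂ) :
    Converts ρ (ρ.submatrix (Prod.map e f) (Prod.map e f)) := by
  have hp : ∀ {X X' : Type} [Fintype X] [DecidableEq X] [Fintype X'] [DecidableEq X'] (e : X' ≃ X),
      ((1 : Matrix X X ℂ).submatrix e id).conjTranspose * (1 : Matrix X X ℂ).submatrix e id = 1 := by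
    intro X X' _ _ _ _ e
    rw [Matrix.conjTranspose_submatrix, Matrix.submatrix_mul_equiv]
    simp
  convert isometry ((1 : Matrix A A ℂ).submatrix e id) ((1 : Matrix B B ℂ).submatrix f id)
    (hp e) (hp f) ρ using 1
  have h : (1 : Matrix A A ℂ).submatrix e id ⊗ₖ (1 : Matrix B B ℂ).submatrix f id =
      (1 : Matrix (A × B) (A × B) ℂ).submatrix (Prod.map e f) id := by
    rw [← Matrix.one_kronecker_one]
    rfl
  rw [localFilter, h, Matrix.conjTranspose_submatrix, Matrix.conjTranspose_one]
  ext x y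
  simp [Matrix.mul_apply, Matrix.one_apply]

theorem spectator {ρ : Matrix (A × B) (A × B) ℂ} {σ : Matrix (A' × B') (A' × B') ℂ}
    (h : Converts ρ σ) (τ : Matrix (E × F) (E × F) ℂ) :
    Converts (bipartiteProd ρ τ) (bipartiteProd σ τ) := by
  obtain ⟨L, rfl⟩ := h
  obtain ⟨L', h⟩ := L.exists_spectator E F
  exact ⟨L', h ρ τ⟩

theorem smul {ρ : Matrix (A × B) (A × B) ℂ} {σ : Matrix (A' × B') (A' × B') ℂ}
    (h : Converts ρ σ) (c : ℂ) : Converts (c • ρ) (c • σ) := by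
  obtain ⟨L, rfl⟩ := h
  exact ⟨L, L.run_smul c ρ⟩

theorem trace_eq {ρ : Matrix (A × B) (A × B) ℂ} {σ : Matrix (A' × B') (A' × B') ℂ}
    (h : Converts ρ σ) : σ.trace = ρ.trace := by
  obtain ⟨L, rfl⟩ := h
  exact L.trace_run ρ

theorem posSemidef {ρ : Matrix (A × B) (A × B) ℂ} {σ : Matrix (A' × B') (A' × B') ℂ}
    (h : Converts ρ σ) (hρ : ρ.PosSemidef) : σ.PosSemidef := by
  obtain ⟨L, rfl⟩ := h
  exact hρ.run L

end Converts

/-! ### Tensor powers -/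

section TensorPower

variable {X Y Z A B A' B' : Type} [Fintype Y] [Fintype A] [Fintype B] [Fintype A'] [Fintype B']

/-- The `n`-fold tensor power of a matrix. -/
def matPow (M : Matrix X Y ℂ) (n : ℕ) : Matrix (Fin n → X) (Fin n → Y) ℂ :=
  Matrix.of fun x y => ∏ i, M (x i) (y i)

theorem matPow_apply (M : Matrix X Y ℂ) (n : ℕ) (x y) : matPow M n x y = ∏ i, M (x i) (y i) := rfl

theorem matPow_mul (M : Matrix X Y ℂ) (N : Matrix Y Z ℂ) (n : ℕ) :
    matPow (M * N) n = matPow M n * matPow N n := by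
  ext x z
  simp only [matPow_apply, Matrix.mul_apply, Finset.prod_univ_sum, Fintype.piFinset_univ,
    Finset.prod_mul_distrib]

theorem matPow_conjTranspose (M : Matrix X Y ℂ) (n : ℕ) :
    matPow M.conjTranspose n = (matPow M n).conjTranspose := by
  ext x z
  simp only [matPow_apply, Matrix.conjTranspose_apply, star_prod]

theorem Matrix.PosSemidef.exists_eq_conjTranspose_mul_self {H : Matrix Y Y ℂ} (h : H.PosSemidef) :
    ∃ L : Matrix Y Y ℂ, H = L.conjTranspose * L := by
  classical
  open scoped MatrixOrder in
  exact CStarAlgebra.nonneg_iff_eq_star_mul_self.mp h.nonneg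

theorem Matrix.PosSemidef.matPow {M : Matrix Y Y ℂ} (hM : M.PosSemidef) (n : ℕ) :
    (matPow M n).PosSemidef := by
  obtain ⟨L, rfl⟩ := hM.exists_eq_conjTranspose_mul_self
  rw [matPow_mul, matPow_conjTranspose]
  exact Matrix.posSemidef_conjTranspose_mul_self _

theorem tensorPower_eq_submatrix (ρ : Matrix (A × B) (A × B) ℂ) (n : ℕ) :
    tensorPower ρ n = (matPow ρ n).submatrix (Equiv.arrowProdEquivProdArrow (Fin n) (fun _ => A)
      (fun _ => B)).symm (Equiv.arrowProdEquivProdArrow (Fin n) (fun _ => A) (fun _ => B)).symm :=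
  rfl

theorem Matrix.PosSemidef.tensorPower {ρ : Matrix (A × B) (A × B) ℂ} (h : ρ.PosSemidef) (n : ℕ) :
    (tensorPower ρ n).PosSemidef := by
  rw [tensorPower_eq_submatrix]
  exact (h.matPow n).submatrix _

theorem trace_matPow (M : Matrix Y Y ℂ) (n : ℕ) : (matPow M n).trace = M.trace ^ n := by
  have h := Finset.prod_univ_sum (fun _ : Fin n => (Finset.univ : Finset Y)) fun _ y => M y y
  rw [Fintype.piFinset_univ, Finset.prod_const, Finset.card_univ, Fintype.card_fin] at h
  exact h.symm

theorem trace_tensorPower (ρ : Matrix (A × B) (A × B) ℂ) (n : ℕ) :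
    (tensorPower ρ n).trace = ρ.trace ^ n := by
  rw [tensorPower_eq_submatrix, ← trace_matPow]
  exact Equiv.sum_comp _ fun x => matPow ρ n x x

theorem localFilter_tensorPower (K : Matrix A' A ℂ) (L : Matrix B' B ℂ)
    (ρ : Matrix (A × B) (A × B) ℂ) (n : ℕ) :
    localFilter (matPow K n) (matPow L n) (tensorPower ρ n) = tensorPower (localFilter K L ρ) n := by
  have h : matPow K n ⊗ₖ matPow L n = (matPow (K ⊗ₖ L) n).submatrix
      (Equiv.arrowProdEquivProdArrow (Fin n) (fun _ => A') (fun _ => B')).symm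
      (Equiv.arrowProdEquivProdArrow (Fin n) (fun _ => A) (fun _ => B)).symm := by
    ext x y
    simp [matPow_apply, Finset.prod_mul_distrib]
  rw [localFilter, h, tensorPower_eq_submatrix, tensorPower_eq_submatrix,
    Matrix.conjTranspose_submatrix, Matrix.submatrix_mul_equiv, Matrix.submatrix_mul_equiv,
    ← matPow_conjTranspose, ← matPow_mul, ← matPow_mul]
  rfl

theorem tensorPower_succ (ρ : Matrix (A × B) (A × B) ℂ) (n : ℕ) :
    tensorPower ρ (n + 1) = (bipartiteProd ρ (tensorPower ρ n)).submatrix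
      (Prod.map (Fin.consEquiv fun _ => A).symm (Fin.consEquiv fun _ => B).symm)
      (Prod.map (Fin.consEquiv fun _ => A).symm (Fin.consEquiv fun _ => B).symm) := by
  ext x y
  simp only [tensorPower, Matrix.of_apply, Fin.prod_univ_succ, Matrix.submatrix_apply,
    bipartiteProd_apply, Prod.map]
  rfl

/-- Grouping `m * n` systems into `m` blocks of `n` systems. -/
def blockEquiv (X : Type) (m n : ℕ) : (Fin m → Fin n → X) ≃ (Fin (m * n) → X) :=
  (Equiv.curry _ _ _).symm.trans (finProdFinEquiv.arrowCongr (Equiv.refl X))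

theorem tensorPower_tensorPower (ρ : Matrix (A × B) (A × B) ℂ) (m n : ℕ) :
    tensorPower (tensorPower ρ n) m = (tensorPower ρ (m * n)).submatrix
      (Prod.map (blockEquiv A m n) (blockEquiv B m n))
      (Prod.map (blockEquiv A m n) (blockEquiv B m n)) := by
  ext x y
  simp only [tensorPower, Matrix.of_apply, Matrix.submatrix_apply]
  rw [← Fintype.prod_prod_type']
  refine Fintype.prod_equiv finProdFinEquiv _ _ fun i => ?_
  simp [blockEquiv, Equiv.arrowCongr, Function.uncurry]

end TensorPower

/-! ### Conversions of tensor products: many copies, discarding, resetting, two-outcome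
measurements. -/

namespace Converts

variable {A B A' B' C D E F : Type} [Fintype A] [DecidableEq A] [Fintype B] [DecidableEq B]
  [Fintype A'] [DecidableEq A'] [Fintype B'] [DecidableEq B']
  [Fintype C] [DecidableEq C] [Fintype D] [DecidableEq D]
  [Fintype E] [DecidableEq E] [Fintype F] [DecidableEq F]

theorem reindex_symm (e : A' ≃ A) (f : B' ≃ B) (ρ : Matrix (A × B) (A × B) ℂ) :
    Converts (ρ.submatrix (Prod.map e f) (Prod.map e f)) ρ := by
  convert reindex e.symm f.symm (ρ.submatrix (Prod.map e f) (Prod.map e f)) using 1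
  ext ⟨x₁, x₂⟩ ⟨y₁, y₂⟩
  simp

theorem swap (ρ : Matrix (A × B) (A × B) ℂ) (τ : Matrix (E × F) (E × F) ℂ) :
    Converts (bipartiteProd ρ τ) (bipartiteProd τ ρ) := by
  convert reindex (Equiv.prodComm E A) (Equiv.prodComm F B) (bipartiteProd ρ τ) using 1
  ext x y
  simp [bipartiteProd_apply, mul_comm]

theorem bipartiteProd_right (ρ : Matrix (A × B) (A × B) ℂ) {τ : Matrix (E × F) (E × F) ℂ}
    {σ : Matrix (A' × B') (A' × B') ℂ} (h : Converts τ σ) :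
    Converts (bipartiteProd ρ τ) (bipartiteProd ρ σ) :=
  (swap ρ τ).trans ((h.spectator ρ).trans (swap σ ρ))

/-- The protocol is run on one copy after another, the other copies being spectators. -/
theorem tensorPower {ρ : Matrix (A × B) (A × B) ℂ} {σ : Matrix (A' × B') (A' × B') ℂ}
    (h : Converts ρ σ) (m : ℕ) : Converts (tensorPower ρ m) (tensorPower σ m) := by
  induction m with
  | zero =>
    convert reindex (Equiv.ofUnique (Fin 0 → A') (Fin 0 → A))
      (Equiv.ofUnique (Fin 0 → B') (Fin 0 → B)) (_root_.tensorPower ρ 0) using 1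
    ext x y
    simp [_root_.tensorPower]
  | succ m ih =>
    have h₁ : Converts (_root_.tensorPower ρ (m + 1)) (bipartiteProd ρ (_root_.tensorPower ρ m)) := by
      rw [tensorPower_succ]
      exact reindex_symm _ _ _
    refine h₁.trans ((h.spectator _).trans ((bipartiteProd_right σ ih).trans ?_))
    rw [tensorPower_succ]
    exact reindex _ _ _

theorem tensorPower_mul {ρ : Matrix (A × B) (A × B) ℂ} {n : ℕ} {σ : Matrix (A' × B') (A' × B') ℂ}
    (h : Converts (_root_.tensorPower ρ n) σ) (m : ℕ) :
    Converts (_root_.tensorPower ρ (m * n)) (_root_.tensorPower σ m) := by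
  refine Converts.trans ?_ (h.tensorPower m)
  rw [tensorPower_tensorPower]
  exact reindex _ _ _

/-- Both parties discard all their systems. -/
theorem discard (τ : Matrix (E × F) (E × F) ℂ) :
    Converts τ (τ.trace • (1 : Matrix (Unit × Unit) (Unit × Unit) ℂ)) := by
  -- Discarding is a complete basis measurement whose outcome is ignored; the Kraus operators are
  -- the functionals ⟨e|.
  have hc : ∀ {X : Type} [Fintype X] [DecidableEq X],
      ∑ e : X, (Matrix.of fun (_ : Unit) e' => if e = e' then (1 : ℂ) else 0).conjTranspose *
        (Matrix.of fun (_ : Unit) e' => if e = e' then (1 : ℂ) else 0) = 1 := by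
    intro X _ _
    ext x y
    simp [Matrix.sum_apply, Matrix.mul_apply, Matrix.one_apply, eq_comm]
  have h := alice (fun _ : E => Unit) (fun e => Matrix.of fun _ e' => if e = e' then (1 : ℂ) else 0)
    hc (ρ := τ) fun e => bob (fun _ : F => Unit)
      (fun f => Matrix.of fun _ f' => if f = f' then (1 : ℂ) else 0) hc fun f => refl _
  convert h using 1
  ext x y
  simp only [localFilter_localFilter, Matrix.sum_apply, localFilter_apply, Matrix.one_mul,
    Matrix.mul_one]
  have hx : x = y := Subsingleton.elim _ _
  simp [hx, Matrix.trace, Fintype.sum_prod_type, apply_ite (starRingEnd ℂ)]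

theorem discard_right (ρ : Matrix (A × B) (A × B) ℂ) (τ : Matrix (E × F) (E × F) ℂ) :
    Converts (bipartiteProd ρ τ) (τ.trace • ρ) := by
  refine (bipartiteProd_right ρ (discard τ)).trans ?_
  convert reindex (Equiv.prodPUnit A).symm (Equiv.prodPUnit B).symm
    (bipartiteProd ρ (τ.trace • (1 : Matrix (Unit × Unit) (Unit × Unit) ℂ))) using 1
  ext x y
  simp [bipartiteProd_apply, mul_comm]

theorem discard_left (ρ : Matrix (A × B) (A × B) ℂ) (τ : Matrix (E × F) (E × F) ℂ) :
    Converts (bipartiteProd τ ρ) (τ.trace • ρ) :=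
  (swap τ ρ).trans (discard_right ρ τ)

/-- Both parties discard their systems and prepare a product state. -/
theorem reset (ρ : Matrix (A × B) (A × B) ℂ) (c : C) (d : D) :
    Converts ρ (ρ.trace • Matrix.single (c, d) (c, d) 1) := by
  refine (discard ρ).trans (Converts.smul ?_ _)
  have h : ∀ {X : Type} [Fintype X] [DecidableEq X] (x : X),
      (Matrix.of fun x' (_ : Unit) => if x' = x then (1 : ℂ) else 0).conjTranspose *
        (Matrix.of fun x' (_ : Unit) => if x' = x then (1 : ℂ) else 0) = 1 := by
    intro X _ _ x
    ext i j
    simp [Matrix.mul_apply]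
  convert isometry _ _ (h c) (h d) (1 : Matrix (Unit × Unit) (Unit × Unit) ℂ) using 1
  ext x y
  rw [localFilter_apply]
  rcases x with ⟨x₁, x₂⟩
  rcases y with ⟨y₁, y₂⟩
  simp only [Fintype.sum_prod_type, Matrix.single_apply, Matrix.of_apply, Prod.mk.injEq,
    @eq_comm _ c, @eq_comm _ d]
  by_cases h1 : x₁ = c <;> by_cases h2 : x₂ = d <;> by_cases h3 : y₁ = c <;>
    by_cases h4 : y₂ = d <;> simp [h1, h2, h3, h4]

theorem alice_two {K : Matrix C A ℂ} {K' : Matrix D A ℂ}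
    (complete : K.conjTranspose * K + K'.conjTranspose * K' = 1) {ρ : Matrix (A × B) (A × B) ℂ}
    {σ σ' : Matrix (A' × B') (A' × B') ℂ} (h : Converts (localFilter K (1 : Matrix B B ℂ) ρ) σ)
    (h' : Converts (localFilter K' (1 : Matrix B B ℂ) ρ) σ') : Converts ρ (σ + σ') := by
  -- The two outcomes may leave systems of different dimensions, so the output type is a Boolean
  -- family.
  let : ∀ b : Bool, Fintype (cond b C D) := fun b => by cases b <;> (dsimp; infer_instance)
  let : ∀ b : Bool, DecidableEq (cond b C D) := fun b => by cases b <;> (dsimp; infer_instance)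
  have := alice (fun b : Bool => cond b C D)
    (fun b => Bool.rec (motive := fun b => Matrix (cond b C D) A ℂ) K' K b)
    (by simpa using complete) (ρ := ρ) (σ := fun b => cond b σ σ')
    (fun b => by cases b; exacts [h', h])
  simpa using this

theorem bob_two {K : Matrix C B ℂ} {K' : Matrix D B ℂ}
    (complete : K.conjTranspose * K + K'.conjTranspose * K' = 1) {ρ : Matrix (A × B) (A × B) ℂ}
    {σ σ' : Matrix (A' × B') (A' × B') ℂ} (h : Converts (localFilter (1 : Matrix A A ℂ) K ρ) σ)
    (h' : Converts (localFilter (1 : Matrix A A ℂ) K' ρ) σ') : Converts ρ (σ + σ') := by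
  let : ∀ b : Bool, Fintype (cond b C D) := fun b => by cases b <;> (dsimp; infer_instance)
  let : ∀ b : Bool, DecidableEq (cond b C D) := fun b => by cases b <;> (dsimp; infer_instance)
  have := bob (fun b : Bool => cond b C D)
    (fun b => Bool.rec (motive := fun b => Matrix (cond b C D) B ℂ) K' K b)
    (by simpa using complete) (ρ := ρ) (σ := fun b => cond b σ σ')
    (fun b => by cases b; exacts [h', h])
  simpa using this

end Converts

theorem conjTranspose_kronecker_one_add {X X₁ X₂ E : Type} [Fintype X] [DecidableEq X]
    [Fintype X₁] [Fintype X₂] [Fintype E] [DecidableEq E] {K : Matrix X₁ X ℂ} {K' : Matrix X₂ X ℂ}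
    (h : K.conjTranspose * K + K'.conjTranspose * K' = 1) :
    (K ⊗ₖ (1 : Matrix E E ℂ)).conjTranspose * (K ⊗ₖ (1 : Matrix E E ℂ)) +
      (K' ⊗ₖ (1 : Matrix E E ℂ)).conjTranspose * (K' ⊗ₖ (1 : Matrix E E ℂ)) = 1 := by
  simp only [Matrix.conjTranspose_kronecker, ← Matrix.mul_kronecker_mul, ← Matrix.add_kronecker, h]
  simp

theorem trace_localFilter_add_left {A A₁ A₂ B : Type} [Fintype A] [DecidableEq A]
    [Fintype A₁] [Fintype A₂] [Fintype B] [DecidableEq B] {K : Matrix A₁ A ℂ} {K' : Matrix A₂ A ℂ}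
    (h : K.conjTranspose * K + K'.conjTranspose * K' = 1) (M : Matrix (A × B) (A × B) ℂ) :
    (localFilter K (1 : Matrix B B ℂ) M).trace + (localFilter K' (1 : Matrix B B ℂ) M).trace =
      M.trace := by
  rw [localFilter, Matrix.trace_mul_comm, ← Matrix.mul_assoc, localFilter,
    Matrix.trace_mul_comm (K' ⊗ₖ (1 : Matrix B B ℂ) * M),
    ← Matrix.mul_assoc, ← Matrix.trace_add, ← Matrix.add_mul, conjTranspose_kronecker_one_add h,
    Matrix.one_mul]

theorem trace_localFilter_add_right {A B B₁ B₂ : Type} [Fintype A] [DecidableEq A]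
    [Fintype B₁] [Fintype B₂] [Fintype B] [DecidableEq B] {K : Matrix B₁ B ℂ} {K' : Matrix B₂ B ℂ}
    (h : K.conjTranspose * K + K'.conjTranspose * K' = 1) (M : Matrix (A × B) (A × B) ℂ) :
    (localFilter (1 : Matrix A A ℂ) K M).trace + (localFilter (1 : Matrix A A ℂ) K' M).trace =
      M.trace := by
  rw [localFilter, Matrix.trace_mul_comm, ← Matrix.mul_assoc, localFilter,
    Matrix.trace_mul_comm ((1 : Matrix A A ℂ) ⊗ₖ K' * M), ← Matrix.mul_assoc, ← Matrix.trace_add,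
    ← Matrix.add_mul]
  simp only [Matrix.conjTranspose_kronecker, ← Matrix.mul_kronecker_mul, ← Matrix.kronecker_add, h]
  simp

/-! ### Overlap with the maximally entangled vector. -/

section Overlap

variable {C : Type} [Fintype C]

/-- The overlap with the unnormalized maximally entangled vector `∑ᵢ |i i⟩`. -/
noncomputable def maxOverlap (M : Matrix (C × C) (C × C) ℂ) : ℝ :=
  (∑ i, ∑ j, M (i, i) (j, j)).re

theorem maxOverlap_add (M N : Matrix (C × C) (C × C) ℂ) :
    maxOverlap (M + N) = maxOverlap M + maxOverlap N := by
  simp [maxOverlap, Finset.sum_add_distrib]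

theorem maxOverlap_smul (c : ℝ) (M : Matrix (C × C) (C × C) ℂ) :
    maxOverlap ((c : ℂ) • M) = c * maxOverlap M := by
  simp [maxOverlap, ← Finset.mul_sum]

theorem maxOverlap_sum {ι : Type*} (s : Finset ι) (M : ι → Matrix (C × C) (C × C) ℂ) :
    maxOverlap (∑ k ∈ s, M k) = ∑ k ∈ s, maxOverlap (M k) := by
  classical
  induction s using Finset.induction_on with
  | empty => simp [maxOverlap]
  | insert a s ha ih => rw [Finset.sum_insert ha, Finset.sum_insert ha, maxOverlap_add, ih]

theorem Matrix.PosSemidef.maxOverlap_nonneg {M : Matrix (C × C) (C × C) ℂ} (hM : M.PosSemidef) :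
    0 ≤ maxOverlap M := by
  classical
  have h := hM.dotProduct_mulVec_nonneg fun p => if p.1 = p.2 then (1 : ℂ) else 0
  have h' : (∑ i, ∑ j, M (i, i) (j, j)) =
      star (fun p : C × C => if p.1 = p.2 then (1 : ℂ) else 0) ⬝ᵥ
        M.mulVec (fun p => if p.1 = p.2 then (1 : ℂ) else 0) := by
    simp [dotProduct, Matrix.mulVec, Fintype.sum_prod_type, apply_ite]
  rw [maxOverlap, h']
  exact (Complex.nonneg_iff.mp h).1

end Overlap

/-! ### Repeating a probabilistic filter until it succeeds -/

section Repeat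

variable {A B C D A₁ B₁ : Type} [Fintype A] [DecidableEq A] [Fintype B] [DecidableEq B]
  [Fintype C] [DecidableEq C] [Fintype D] [DecidableEq D]
  [Fintype A₁] [DecidableEq A₁] [Fintype B₁] [DecidableEq B₁]

/-- The outcome of up to `m` attempts to obtain `s`, with `τ` in case of failure. -/
noncomputable def repeatOutcome (s τ : Matrix (C × D) (C × D) ℂ) : ℕ → Matrix (C × D) (C × D) ℂ
  | 0 => τ
  | m + 1 => s + (1 - s.trace) • repeatOutcome s τ m

/-- The filter is tried on the first copy. On success the other copies are discarded; if either
party fails, the used copy is discarded and the procedure continues with the rest. -/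
theorem converts_repeatOutcome {X : Matrix (A × B) (A × B) ℂ} (hX : X.trace = 1)
    {K : Matrix C A ℂ} {L : Matrix D B ℂ} {K' : Matrix A₁ A ℂ} {L' : Matrix B₁ B ℂ}
    (hK : K.conjTranspose * K + K'.conjTranspose * K' = 1)
    (hL : L.conjTranspose * L + L'.conjTranspose * L' = 1) (c : C) (d : D) (m : ℕ) :
    Converts (tensorPower X m)
      (repeatOutcome (localFilter K L X) (Matrix.single (c, d) (c, d) 1) m) := by
  induction m with
  | zero =>
    have := Converts.reset (tensorPower X 0) c d
    rwa [trace_tensorPower, pow_zero, one_smul] at this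
  | succ m ih =>
    set out := repeatOutcome (localFilter K L X) (Matrix.single (c, d) (c, d) 1) m with hout
    have h₁ : Converts (tensorPower X (m + 1)) (bipartiteProd X (tensorPower X m)) := by
      rw [tensorPower_succ]
      exact Converts.reindex_symm _ _ _
    have hKL : ∀ {A₂ B₂ : Type} [Fintype A₂] [DecidableEq A₂] [Fintype B₂] [DecidableEq B₂]
        (Y : Matrix (A₂ × B₂) (A₂ × B₂) ℂ),
        Converts (bipartiteProd Y (tensorPower X m)) (Y.trace • out) := fun Y =>
      (Converts.discard_left (tensorPower X m) Y).trans (ih.smul _)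
    have hs : Converts (bipartiteProd (localFilter K L X) (tensorPower X m)) (localFilter K L X) := by
      have := Converts.discard_right (localFilter K L X) (tensorPower X m)
      rwa [trace_tensorPower, hX, one_pow, one_smul] at this
    have h₂ : Converts (bipartiteProd X (tensorPower X m))
        ((localFilter K L X + (localFilter K L' X).trace • out) +
          (localFilter K' (1 : Matrix B B ℂ) X).trace • out) := by
      refine Converts.alice_two (conjTranspose_kronecker_one_add hK)
        (Converts.bob_two (conjTranspose_kronecker_one_add hL) ?_ ?_) ?_
      · rw [← Matrix.one_kronecker_one, ← Matrix.one_kronecker_one, localFilter_bipartiteProd,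
          localFilter_bipartiteProd, localFilter_one, localFilter_one, localFilter_localFilter,
          Matrix.one_mul, Matrix.mul_one]
        exact hs
      · rw [← Matrix.one_kronecker_one, ← Matrix.one_kronecker_one, localFilter_bipartiteProd,
          localFilter_bipartiteProd, localFilter_one, localFilter_one, localFilter_localFilter,
          Matrix.one_mul, Matrix.mul_one]
        exact hKL _
      · rw [← Matrix.one_kronecker_one, localFilter_bipartiteProd, localFilter_one]
        exact hKL _
    refine h₁.trans ?_
    convert h₂ using 1
    -- The two failure branches, at Alice and at Bob, have total weight tr X minus the success
    -- weight.
    have t₁ := trace_localFilter_add_left hK X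
    have t₂ := trace_localFilter_add_right hL (localFilter K (1 : Matrix B B ℂ) X)
    simp only [localFilter_localFilter, Matrix.one_mul, Matrix.mul_one] at t₂
    rw [repeatOutcome, ← hout, add_assoc, ← add_smul]
    congr 2
    rw [← hX, ← t₁, ← t₂]
    ring

/-- A filter, scaled down until K†K ≤ 1, is one outcome of a two-outcome measurement; the other
Kraus operator is a root of the remainder. -/
theorem exists_contraction {X Y : Type} [Fintype X] [DecidableEq X] [Fintype Y] (K : Matrix Y X ℂ) :
    ∃ c : ℝ, 0 < c ∧ ∃ K' : Matrix X X ℂ, ((c : ℂ) • K).conjTranspose * ((c : ℂ) • K) +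
      K'.conjTranspose * K' = 1 := by
  obtain ⟨t, ht, h⟩ : ∃ t : ℝ, 0 < t ∧
      ((t : ℂ) • (1 : Matrix X X ℂ) - K.conjTranspose * K).PosSemidef := by
    open scoped Matrix.Norms.L2Operator MatrixOrder in
    have h := IsSelfAdjoint.le_algebraMap_norm_self (a := K.conjTranspose * K)
      (Matrix.isHermitian_conjTranspose_mul_self K)
    rw [Matrix.le_iff] at h
    -- The summand 1 keeps t positive even for K = 0.
    refine ⟨‖K.conjTranspose * K‖ + 1, by positivity, ?_⟩
    have h1 : (1 : Matrix X X ℂ).PosSemidef := Matrix.PosSemidef.one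
    have e : ((‖K.conjTranspose * K‖ + 1 : ℝ) : ℂ) • (1 : Matrix X X ℂ) - K.conjTranspose * K =
        algebraMap ℝ (Matrix X X ℂ) ‖K.conjTranspose * K‖ - K.conjTranspose * K + 1 := by
      have : ((‖K.conjTranspose * K‖ : ℂ)) • (1 : Matrix X X ℂ) = ‖K.conjTranspose * K‖ • 1 := by
        ext i j
        simp
      rw [Algebra.algebraMap_eq_smul_one, Complex.ofReal_add, Complex.ofReal_one, add_smul,
        one_smul, this]
      abel
    rw [e]
    exact h.add h1
  have h' : ((((t⁻¹ : ℝ) : ℂ)) • ((t : ℂ) • (1 : Matrix X X ℂ) - K.conjTranspose * K)).PosSemidef :=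
    h.smul (by simpa using ht.le)
  obtain ⟨K', hK'⟩ := h'.exists_eq_conjTranspose_mul_self
  refine ⟨Real.sqrt t⁻¹, Real.sqrt_pos.mpr (inv_pos.mpr ht), K', ?_⟩
  rw [← hK', Matrix.conjTranspose_smul, Matrix.smul_mul, Matrix.mul_smul, smul_smul]
  have e : star ((Real.sqrt t⁻¹ : ℝ) : ℂ) * ((Real.sqrt t⁻¹ : ℝ) : ℂ) = ((t⁻¹ : ℝ) : ℂ) := by
    rw [Complex.star_def, Complex.conj_ofReal, ← Complex.ofReal_mul,
      Real.mul_self_sqrt (inv_nonneg.mpr ht.le)]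
  have e' : ((t⁻¹ : ℝ) : ℂ) * (t : ℂ) = 1 := by
    rw [← Complex.ofReal_mul, inv_mul_cancel₀ ht.ne', Complex.ofReal_one]
  rw [e, smul_sub, smul_smul, e', one_smul]
  abel

/-- The recursion converges geometrically to its fixed point a / p, which lies above f. The index n
+ 1 guarantees at least one attempt. -/
theorem exists_lt_of_affine_recursion {x : ℕ → ℝ} {a p f : ℝ} (hp : 0 < p) (hp' : p ≤ 1)
    (hx : ∀ n, x (n + 1) = a + (1 - p) * x n) (hf : f * p < a) : ∃ n, f < x (n + 1) := by
  have hx' : ∀ n, x n = a / p + (1 - p) ^ n * (x 0 - a / p) := by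
    intro n
    induction n with
    | zero => simp
    | succ n ih =>
      rw [hx, ih]
      field_simp
      ring
  have hlim : Filter.Tendsto (fun n => x (n + 1)) Filter.atTop (nhds (a / p)) := by
    have h := (tendsto_pow_atTop_nhds_zero_of_lt_one (sub_nonneg.mpr hp')
      (by linarith : 1 - p < 1)).mul_const (x 0 - a / p)
    have h' := (h.const_add (a / p)).comp (Filter.tendsto_add_atTop_nat 1)
    simp only [zero_mul, add_zero] at h'
    refine h'.congr fun n => ?_
    simp only [Function.comp_apply]
    rw [hx' (n + 1)]
  have : f < a / p := by rwa [lt_div_iff₀ hp]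
  exact ((hlim.eventually (lt_mem_nhds this))).exists

theorem trace_localFilter_le {X : Matrix (A × B) (A × B) ℂ} (hX : X.PosSemidef)
    {K : Matrix C A ℂ} {L : Matrix D B ℂ} {K' : Matrix A₁ A ℂ} {L' : Matrix B₁ B ℂ}
    (hK : K.conjTranspose * K + K'.conjTranspose * K' = 1)
    (hL : L.conjTranspose * L + L'.conjTranspose * L' = 1) :
    (localFilter K L X).trace ≤ X.trace := by
  have t₁ := trace_localFilter_add_left hK X
  have t₂ := trace_localFilter_add_right hL (localFilter K (1 : Matrix B B ℂ) X)
  simp only [localFilter_localFilter, Matrix.one_mul, Matrix.mul_one] at t₂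
  rw [← t₁, ← t₂, add_assoc]
  exact le_add_of_nonneg_right (add_nonneg (hX.localFilter _ _).trace_nonneg
    (hX.localFilter _ _).trace_nonneg)

/-- A probabilistic filter can be turned into a deterministic protocol on several copies, at an
arbitrarily small loss of overlap. -/
theorem exists_converts_of_lt_maxOverlap_localFilter {X : Matrix (A × B) (A × B) ℂ}
    (hX : IsDensityMatrix X) (K : Matrix C A ℂ) (L : Matrix C B ℂ) {f : ℝ}
    (h : f * (localFilter K L X).trace.re < maxOverlap (localFilter K L X)) :
    ∃ (m : ℕ) (ω : Matrix (C × C) (C × C) ℂ), 0 < m ∧ Converts (tensorPower X m) ω ∧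
      f < maxOverlap ω := by
  obtain ⟨c, hc, K', hK⟩ := exists_contraction K
  obtain ⟨d, hd, L', hL⟩ := exists_contraction L
  set s := localFilter ((c : ℂ) • K) ((d : ℂ) • L) X with hs
  have hs' : s = ((c * c * (d * d) : ℝ) : ℂ) • localFilter K L X := by
    rw [hs, localFilter_smul_smul]
    simp
  have hpsd : s.PosSemidef := hX.1.localFilter _ _
  have hst : f * s.trace.re < maxOverlap s := by
    rw [hs', maxOverlap_smul, Matrix.trace_smul, smul_eq_mul, Complex.re_ofReal_mul, mul_left_comm]
    exact mul_lt_mul_of_pos_left h (by positivity)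
  have htr := Complex.nonneg_iff.mp hpsd.trace_nonneg
  have htr' : s.trace = (s.trace.re : ℂ) := by
    apply Complex.ext <;> simp [← htr.2]
  have hle := trace_localFilter_le hX.1 hK hL
  rw [hX.2] at hle
  have hp1 : s.trace.re ≤ 1 := (Complex.le_def.mp hle).1
  -- A positive semidefinite operator of trace zero vanishes, which would contradict the strict
  -- inequality.
  have hp0 : 0 < s.trace.re := by
    refine lt_of_le_of_ne htr.1 fun h0 => ?_
    have : s = 0 := hpsd.trace_eq_zero_iff.mp (by rw [htr', ← h0]; simp)
    rw [this] at hst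
    simp [maxOverlap] at hst
  obtain ⟨c0⟩ : Nonempty C := by
    by_contra hne
    rw [not_nonempty_iff] at hne
    simp [Matrix.trace] at hp0
  obtain ⟨m, hm⟩ := exists_lt_of_affine_recursion
    (x := fun n => maxOverlap (repeatOutcome s (Matrix.single (c0, c0) (c0, c0) 1) n)) hp0 hp1
    (fun n => by
      rw [repeatOutcome, maxOverlap_add]
      congr 1
      rw [htr', ← maxOverlap_smul]
      push_cast
      simp) hst
  exact ⟨m + 1, _, m.succ_pos, converts_repeatOutcome hX.2 hK hL c0 c0 (m + 1), hm⟩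

end Repeat

/-! ### Separable operators -/

section Separable

variable {A B A' B' C : Type} [Fintype A] [Fintype B] [Fintype A'] [Fintype B'] [Fintype C]

theorem isSeparableOperator_sum {ι : Type*} [Fintype ι] {a : ι → Matrix A A ℂ}
    {b : ι → Matrix B B ℂ} (ha : ∀ i, (a i).PosSemidef) (hb : ∀ i, (b i).PosSemidef) :
    IsSeparableOperator (∑ i, a i ⊗ₖ b i) := by
  let e := (Fintype.equivFin ι).symm
  exact ⟨_, fun i => a (e i), fun i => b (e i), fun i => ha _, fun i => hb _,
    (e.sum_comp fun i => a i ⊗ₖ b i).symm⟩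

theorem IsSeparableOperator.localFilter {M : Matrix (A × B) (A × B) ℂ} (h : IsSeparableOperator M)
    (K : Matrix A' A ℂ) (L : Matrix B' B ℂ) : IsSeparableOperator (localFilter K L M) := by
  obtain ⟨s, a, b, ha, hb, rfl⟩ := h
  refine ⟨s, fun i => K * a i * K.conjTranspose, fun i => L * b i * L.conjTranspose,
    fun i => (ha i).mul_mul_conjTranspose_same K, fun i => (hb i).mul_mul_conjTranspose_same L, ?_⟩
  rw [localFilter_sum]
  simp only [localFilter_kronecker]

theorem IsSeparableOperator.tensorPower {M : Matrix (A × B) (A × B) ℂ} (h : IsSeparableOperator M)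
    (n : ℕ) : IsSeparableOperator (tensorPower M n) := by
  obtain ⟨s, a, b, ha, hb, rfl⟩ := h
  have key : _root_.tensorPower (∑ i, a i ⊗ₖ b i) n =
      ∑ f : Fin n → Fin s, (Matrix.of fun x y => ∏ i, a (f i) (x i) (y i)) ⊗ₖ
        (Matrix.of fun x y => ∏ i, b (f i) (x i) (y i)) := by
    ext x y
    simp only [_root_.tensorPower, Matrix.of_apply, Matrix.sum_apply, Matrix.kroneckerMap_apply,
      ← Finset.prod_mul_distrib]
    rw [Finset.prod_univ_sum, Fintype.piFinset_univ]
  -- A tensor product of different positive semidefinite factors: the roots L†L multiply.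
  have hp : ∀ {X : Type} [Fintype X] (a : Fin s → Matrix X X ℂ), (∀ i, (a i).PosSemidef) →
      ∀ f : Fin n → Fin s,
        (Matrix.of fun x y : Fin n → X => ∏ i, a (f i) (x i) (y i)).PosSemidef := by
    intro X _ a ha f
    choose L hL using fun i => (ha i).exists_eq_conjTranspose_mul_self
    have : (Matrix.of fun x y : Fin n → X => ∏ i, a (f i) (x i) (y i)) =
        (Matrix.of fun x y : Fin n → X => ∏ i, L (f i) (x i) (y i)).conjTranspose *
          (Matrix.of fun x y : Fin n → X => ∏ i, L (f i) (x i) (y i)) := by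
      ext x y
      simp only [Matrix.mul_apply, Matrix.of_apply, Matrix.conjTranspose_apply, star_prod,
        ← Finset.prod_mul_distrib]
      rw [← Fintype.piFinset_univ,
        ← Finset.prod_univ_sum (fun _ : Fin n => (Finset.univ : Finset X))
          fun i z => star (L (f i) z (x i)) * L (f i) z (y i)]
      refine Finset.prod_congr rfl fun i _ => ?_
      conv_lhs => rw [hL (f i)]
      simp [Matrix.mul_apply]
    rw [this]
    exact Matrix.posSemidef_conjTranspose_mul_self _
  rw [key]
  exact isSeparableOperator_sum (hp a ha) (hp b hb)

theorem normSq_sum_mul_le {ι : Type*} (s : Finset ι) (u v : ι → ℂ) :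
    Complex.normSq (∑ i ∈ s, u i * v i) ≤
      (∑ i ∈ s, Complex.normSq (u i)) * ∑ i ∈ s, Complex.normSq (v i) := by
  simp only [Complex.normSq_eq_norm_sq]
  calc ‖∑ i ∈ s, u i * v i‖ ^ 2 ≤ (∑ i ∈ s, ‖u i‖ * ‖v i‖) ^ 2 := by
        gcongr
        exact (norm_sum_le _ _).trans (by simp)
    _ ≤ _ := Finset.sum_mul_sq_le_sq_mul_sq _ _ _

/-- The overlap of a separable operator with `∑ᵢ |i i⟩` is at most its trace. -/
theorem IsSeparableOperator.maxOverlap_le {M : Matrix (C × C) (C × C) ℂ}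
    (h : IsSeparableOperator M) : maxOverlap M ≤ M.trace.re := by
  obtain ⟨s, a, b, ha, hb, rfl⟩ := h
  rw [maxOverlap_sum, Matrix.trace_sum, Complex.re_sum]
  refine Finset.sum_le_sum fun i _ => ?_
  obtain ⟨L, hL⟩ := (ha i).exists_eq_conjTranspose_mul_self
  obtain ⟨R, hR⟩ := (hb i).exists_eq_conjTranspose_mul_self
  -- With a = L†L and b = R†R the overlap is a sum of squared products of rows of L and R;
  -- Cauchy–Schwarz for each pair of rows bounds it by tr a · tr b.
  have h₁ : maxOverlap (a i ⊗ₖ b i) =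
      ∑ k, ∑ l, Complex.normSq (∑ x, L k x * R l x) := by
    have : (∑ x, ∑ y, (a i ⊗ₖ b i) (x, x) (y, y)) =
        ∑ k, ∑ l, star (∑ x, L k x * R l x) * ∑ y, L k y * R l y := by
      simp only [Matrix.kroneckerMap_apply, hL, hR, Matrix.mul_apply, Matrix.conjTranspose_apply,
        star_sum, Finset.sum_mul_sum, star_mul']
      rw [Finset.sum_congr rfl fun x _ => Finset.sum_comm, Finset.sum_comm]
      refine Finset.sum_congr rfl fun k _ => ?_
      rw [Finset.sum_congr rfl fun x _ => Finset.sum_comm, Finset.sum_comm]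
      refine Finset.sum_congr rfl fun l _ => Finset.sum_congr rfl fun x _ =>
        Finset.sum_congr rfl fun y _ => ?_
      ring
    rw [maxOverlap, this, Complex.re_sum]
    refine Finset.sum_congr rfl fun k _ => ?_
    rw [Complex.re_sum]
    refine Finset.sum_congr rfl fun l _ => ?_
    rw [Complex.star_def, ← Complex.normSq_eq_conj_mul_self, Complex.ofReal_re]
  have h₂ : ∀ T : Matrix C C ℂ, (T.conjTranspose * T).trace =
      ((∑ k, ∑ x, Complex.normSq (T k x) : ℝ) : ℂ) := by
    intro T
    simp only [Matrix.trace, Matrix.diag_apply, Matrix.mul_apply, Matrix.conjTranspose_apply,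
      Complex.ofReal_sum, Complex.normSq_eq_conj_mul_self]
    exact Finset.sum_comm
  rw [h₁, Matrix.trace_kronecker, hL, hR, h₂, h₂, ← Complex.ofReal_mul, Complex.ofReal_re,
    Finset.sum_mul_sum]
  exact Finset.sum_le_sum fun k _ => Finset.sum_le_sum fun l _ => normSq_sum_mul_le _ _ _

end Separable

/-! ### Rank-one operators under local filters. -/

section KetBra

variable {X A B A' B' C : Type} [Fintype X] [Fintype A] [Fintype B] [Fintype A'] [Fintype B']
  [Fintype C]

theorem ketBra_apply (v : X → ℂ) (x y : X) : ketBra v x y = v x * star (v y) := rfl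

theorem ketBra_posSemidef (v : X → ℂ) : (ketBra v).PosSemidef :=
  Matrix.posSemidef_vecMulVec_self_star v

theorem ketBra_smul (c : ℂ) (v : X → ℂ) : ketBra (c • v) = (c * star c) • ketBra v := by
  ext x y
  simp only [ketBra_apply, Pi.smul_apply, Matrix.smul_apply, smul_eq_mul, star_mul']
  ring

theorem trace_ketBra (v : X → ℂ) : (ketBra v).trace = ((∑ x, Complex.normSq (v x) : ℝ) : ℂ) := by
  simp [Matrix.trace, ketBra_apply, Complex.normSq_eq_conj_mul_self, mul_comm]

theorem maxOverlap_ketBra (v : C × C → ℂ) :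
    maxOverlap (ketBra v) = Complex.normSq (∑ i, v (i, i)) := by
  have : ∑ i, ∑ j, ketBra v (i, i) (j, j) = (Complex.normSq (∑ i, v (i, i)) : ℂ) := by
    simp only [ketBra_apply, ← Finset.mul_sum, ← Finset.sum_mul, ← star_sum]
    rw [Complex.star_def, Complex.mul_conj]
  rw [maxOverlap, this, Complex.ofReal_re]

theorem mul_ketBra_mul_conjTranspose {Y : Type} [Fintype Y] (K : Matrix Y X ℂ) (v : X → ℂ) :
    K * ketBra v * K.conjTranspose = ketBra (K.mulVec v) := by
  rw [ketBra, Matrix.mul_vecMulVec, Matrix.vecMulVec_mul, ketBra]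
  congr 1
  rw [Matrix.star_mulVec]

theorem localFilter_ketBra (K : Matrix A' A ℂ) (L : Matrix B' B ℂ) (v : A × B → ℂ) :
    localFilter K L (ketBra v) = ketBra ((K ⊗ₖ L).mulVec v) :=
  mul_ketBra_mul_conjTranspose _ _

theorem ketBra_prod (u : A → ℂ) (v : B → ℂ) :
    ketBra (fun p : A × B => u p.1 * v p.2) = ketBra u ⊗ₖ ketBra v := by
  ext x y
  simp only [ketBra_apply, Matrix.kroneckerMap_apply, star_mul']
  ring

/-- A bipartite vector, read as a matrix V of coefficients, is mapped by K ⊗ L to K V Lᵀ. -/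
theorem localFilter_ketBra_apply (K : Matrix A' A ℂ) (L : Matrix B' B ℂ) (v : A × B → ℂ) :
    (K ⊗ₖ L).mulVec v = fun p => (K * (Matrix.of fun a b => v (a, b)) * L.transpose) p.1 p.2 := by
  ext p
  simp only [Matrix.mulVec, dotProduct, Matrix.mul_apply, Matrix.kroneckerMap_apply,
    Fintype.sum_prod_type, Matrix.transpose_apply, Matrix.of_apply, Finset.sum_mul]
  rw [Finset.sum_comm]
  refine Finset.sum_congr rfl fun b _ => Finset.sum_congr rfl fun a _ => ?_
  ring

end KetBra

/-! ### Takagi factorization -/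

section Takagi

/-- An antilinear symmetric operator has a unit eigenvector with nonnegative eigenvalue. -/
theorem exists_unit_eigenvector_of_antilinear {F : Type*} [NormedAddCommGroup F]
    [InnerProductSpace ℂ F] [FiniteDimensional ℂ F] [Nontrivial F] (J : F →ₗ[ℝ] F)
    (hI : ∀ x, J (Complex.I • x) = -(Complex.I • J x))
    (hJ : ∀ x y, inner ℂ x (J y) = inner ℂ y (J x)) :
    ∃ (v : F) (μ : ℝ), ‖v‖ = 1 ∧ 0 ≤ μ ∧ J v = (μ : ℂ) • v := by
  have : FiniteDimensional ℝ F := FiniteDimensional.complexToReal F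
  let _ : InnerProductSpace ℝ F := InnerProductSpace.complexToReal
  -- For the real part of the inner product J is a symmetric real-linear operator, so the real
  -- spectral theorem applies.
  have hs : LinearMap.IsSymmetric (𝕜 := ℝ) (E := F) J := by
    intro x y
    rw [real_inner_comm, real_inner_eq_re_inner ℂ, real_inner_eq_re_inner ℂ, hJ]
  obtain ⟨v, hv⟩ := hs.hasEigenvalue_iSup_of_finiteDimensional.exists_hasEigenvector
  generalize (((⨆ x : { x : F // x ≠ 0 }, RCLike.re (inner ℝ (J x) (x : F)) / ‖(x : F)‖ ^ 2 : ℝ)) : ℝ)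
    = μ at hv
  have h0 : v ≠ 0 := hv.2
  have h1 : J v = μ • v := hv.apply_eq_smul
  have hn : ‖v‖ ≠ 0 := norm_ne_zero_iff.mpr h0
  have h2 : ∀ c : ℝ, J (c • v) = μ • (c • v) := by
    intro c
    rw [map_smul, h1, smul_comm]
  rcases le_total 0 μ with hμ | hμ
  · refine ⟨‖v‖⁻¹ • v, μ, ?_, hμ, ?_⟩
    · rw [norm_smul, norm_inv, norm_norm, inv_mul_cancel₀ hn]
    · rw [h2, Complex.coe_smul]
  -- J anticommutes with multiplication by i, so i v has the eigenvalue -μ.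
  · refine ⟨Complex.I • (‖v‖⁻¹ • v), -μ, ?_, by linarith, ?_⟩
    · rw [norm_smul, norm_smul, norm_inv, norm_norm, inv_mul_cancel₀ hn, Complex.norm_I, one_mul]
    · rw [hI, h2, Complex.ofReal_neg, neg_smul, Complex.coe_smul, smul_comm Complex.I μ]

/-- Induction on the dimension: the orthogonal complement of an eigenvector v is invariant, because
⟨v, J w⟩ = ⟨w, J v⟩ = μ ⟨w, v⟩. -/
theorem exists_orthonormalBasis_of_antilinear (n : ℕ) {F : Type*} [NormedAddCommGroup F]
    [InnerProductSpace ℂ F] [FiniteDimensional ℂ F] (hn : Module.finrank ℂ F = n) (J : F →ₗ[ℝ] F)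
    (hI : ∀ x, J (Complex.I • x) = -(Complex.I • J x))
    (hJ : ∀ x y, inner ℂ x (J y) = inner ℂ y (J x)) :
    ∃ (b : OrthonormalBasis (Fin n) ℂ F) (μ : Fin n → ℝ),
      (∀ i, 0 ≤ μ i) ∧ ∀ i, J (b i) = (μ i : ℂ) • b i := by
  induction n generalizing F with
  | zero => exact ⟨(stdOrthonormalBasis ℂ F).reindex (finCongr hn), Fin.elim0, fun i => i.elim0,
      fun i => i.elim0⟩
  | succ n ih =>
    have : Nontrivial F := Module.nontrivial_of_finrank_pos (R := ℂ) (by omega)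
    obtain ⟨v, μ₀, hv, hμ₀, hJv⟩ := exists_unit_eigenvector_of_antilinear J hI hJ
    have hv0 : v ≠ 0 := by
      rintro rfl
      simp at hv
    have : Fact (Module.finrank ℂ F = n + 1) := ⟨hn⟩
    have hW : ∀ w ∈ (Submodule.span ℂ {v})ᗮ, J w ∈ (Submodule.span ℂ {v})ᗮ := by
      intro w hw
      rw [Submodule.mem_orthogonal_singleton_iff_inner_right] at hw ⊢
      rw [hJ, hJv, inner_smul_right, ← inner_conj_symm, hw]
      simp
    let J' : (Submodule.span ℂ {v})ᗮ →ₗ[ℝ] (Submodule.span ℂ {v})ᗮ :=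
      { toFun := fun w => ⟨J w, hW w w.2⟩
        map_add' := fun x y => Subtype.ext (by simp)
        map_smul' := fun c x => Subtype.ext (by simp) }
    obtain ⟨b, μ, hμ, hb⟩ := ih (Submodule.finrank_orthogonal_span_singleton hv0) J'
      (fun x => Subtype.ext (by simpa [J'] using hI x)) (fun x y => hJ x y)
    have ho : Orthonormal ℂ (Fin.cons v fun i => (b i : F) : Fin (n + 1) → F) := by
      rw [orthonormal_iff_ite]
      have hb' := fun i j => (orthonormal_iff_ite.mp b.orthonormal) i j
      have hvb : ∀ i, inner ℂ v (b i : F) = 0 := fun i =>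
        (Submodule.mem_orthogonal_singleton_iff_inner_right.mp (b i).2)
      intro i j
      refine Fin.cases ?_ (fun i => ?_) i <;> refine Fin.cases ?_ (fun j => ?_) j
      · simp [inner_self_eq_norm_sq_to_K, hv]
      · simpa [Fin.succ_ne_zero, (Fin.succ_ne_zero _).symm] using hvb j
      · have h := congrArg (starRingEnd ℂ) (hvb i)
        rw [inner_conj_symm] at h
        simpa [Fin.succ_ne_zero] using h
      · simpa using hb' i j
    have hsp : ⊤ ≤ Submodule.span ℂ (Set.range (Fin.cons v fun i => (b i : F) : Fin (n + 1) → F)) :=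
      (ho.linearIndependent.span_eq_top_of_card_eq_finrank (by simp [hn])).ge
    refine ⟨OrthonormalBasis.mk ho hsp, Fin.cons μ₀ μ, fun i => ?_, fun i => ?_⟩
    · refine Fin.cases hμ₀ (fun i => ?_) i
      exact hμ i
    · rw [OrthonormalBasis.coe_mk]
      refine Fin.cases ?_ (fun i => ?_) i
      · exact hJv
      · simpa [J'] using congrArg Subtype.val (hb i)

/-- Takagi factorization of a complex symmetric matrix. -/
theorem exists_takagi {ι : Type*} [Fintype ι] [DecidableEq ι] (τ : Matrix ι ι ℂ)
    (hτ : τ.transpose = τ) :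
    ∃ (U : Matrix ι ι ℂ) (μ : ι → ℝ), U * U.conjTranspose = 1 ∧ (∀ i, 0 ≤ μ i) ∧
      U.transpose * τ * U = Matrix.diagonal fun i => (μ i : ℂ) := by
  -- J is v ↦ conj(τ v), symmetric because τ is. An eigenbasis satisfies τ bᵢ = μᵢ conj(bᵢ), which
  -- is the factorization with the bᵢ as columns of U.
  let J : EuclideanSpace ℂ ι →ₗ[ℝ] EuclideanSpace ℂ ι :=
    { toFun := fun v => WithLp.toLp 2 (star (τ.mulVec v.ofLp))
      map_add' := fun x y => by simp [Matrix.mulVec_add]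
      map_smul' := fun c x => by
        ext i
        simp [Matrix.mulVec, dotProduct, Finset.mul_sum, mul_left_comm] }
  have hJa : ∀ v i, J v i = star (∑ j, τ i j * v j) := fun v i => rfl
  have hI : ∀ x, J (Complex.I • x) = -(Complex.I • J x) := by
    intro x
    ext i
    simp only [hJa, PiLp.smul_apply, PiLp.neg_apply, smul_eq_mul, mul_left_comm _ Complex.I,
      ← Finset.mul_sum, star_mul', Complex.star_def, Complex.conj_I, neg_mul]
  have hJ : ∀ x y, inner ℂ x (J y) = inner ℂ y (J x) := by
    intro x y
    simp only [PiLp.inner_apply, hJa, RCLike.inner_apply, star_sum, star_mul', Finset.sum_mul]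
    rw [Finset.sum_comm]
    refine Finset.sum_congr rfl fun i _ => Finset.sum_congr rfl fun j _ => ?_
    rw [show τ j i = τ i j from congrFun (congrFun hτ i) j]
    simp only [Complex.star_def]
    ring
  obtain ⟨b₀, μ₀, hμ₀, hb₀⟩ := exists_orthonormalBasis_of_antilinear (Fintype.card ι)
    finrank_euclideanSpace J hI hJ
  let e := Fintype.equivFin ι
  let b := b₀.reindex e.symm
  let μ := fun i => μ₀ (e i)
  have hb : ∀ i, J (b i) = (μ i : ℂ) • b i := fun i => by simpa [b, μ] using hb₀ (e i)
  have hb' : ∀ i x, ∑ y, τ x y * b i y = μ i * star (b i x) := by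
    intro i x
    have h := congrArg star (congrArg (fun v : EuclideanSpace ℂ ι => v x) (hb i))
    simp only [hJa, star_star, PiLp.smul_apply, smul_eq_mul, star_mul'] at h
    rw [h, Complex.star_def, Complex.conj_ofReal]
  have ho : ∀ i j, ∑ x, star (b i x) * b j x = if i = j then 1 else 0 := by
    intro i j
    rw [← orthonormal_iff_ite.mp b.orthonormal i j]
    simp [PiLp.inner_apply, mul_comm]
  refine ⟨Matrix.of fun x i => b i x, μ, ?_, fun i => hμ₀ _, ?_⟩
  · rw [mul_eq_one_comm]
    ext i j
    simpa [Matrix.mul_apply, Matrix.one_apply] using ho i j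
  · ext i j
    rw [Matrix.mul_assoc, Matrix.mul_apply, Matrix.diagonal_apply]
    have h₁ : ∀ x, (τ * Matrix.of fun x i => b i x) x j = μ j * star (b j x) := fun x => hb' j x
    simp only [Matrix.transpose_apply, Matrix.of_apply, h₁, mul_left_comm _ (μ j : ℂ),
      ← Finset.mul_sum]
    rw [Finset.sum_congr rfl fun x _ => mul_comm _ _, ho j i]
    by_cases hij : i = j
    · simp [hij]
    · simp [hij, Ne.symm hij]

end Takagi

/-! ### Entanglement of two-qubit operators -/

section Polygon

/-- Existence of a triangle with sides a, b, r: |a + b e^{iθ}| decreases from a + b to |a - b|, and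
the intermediate value theorem applies. -/
theorem exists_norm_add_mul_eq {a b r : ℝ} (ha : 0 ≤ a) (hb : 0 ≤ b) (h₁ : |a - b| ≤ r)
    (h₂ : r ≤ a + b) : ∃ z : ℂ, ‖z‖ = 1 ∧ ‖(a : ℂ) + b * z‖ = r := by
  have hc : ContinuousOn (fun θ : ℝ => ‖(a : ℂ) + b * Complex.exp (θ * Complex.I)‖)
      (Set.Icc 0 Real.pi) := by fun_prop
  have h := intermediate_value_Icc' Real.pi_pos.le hc
  have hmem : r ∈ Set.Icc (‖(a : ℂ) + b * Complex.exp ((Real.pi : ℝ) * Complex.I)‖)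
      (‖(a : ℂ) + b * Complex.exp ((0 : ℝ) * Complex.I)‖) := by
    constructor
    · rw [Complex.exp_pi_mul_I, mul_neg_one, ← sub_eq_add_neg, ← Complex.ofReal_sub,
        Complex.norm_real]
      exact h₁
    · rw [Complex.ofReal_zero, zero_mul, Complex.exp_zero, mul_one, ← Complex.ofReal_add,
        Complex.norm_real, Real.norm_eq_abs, abs_of_nonneg (by positivity)]
      exact h₂
  obtain ⟨θ, -, hθ⟩ := h hmem
  exact ⟨Complex.exp (θ * Complex.I), Complex.norm_exp_ofReal_mul_I θ, hθ⟩

/-- Four lengths, none of which exceeds the sum of the others, are the sides of a closed polygon. -/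
theorem exists_phases_sum_eq_zero (μ : Fin 4 → ℝ) (h0 : ∀ i, 0 ≤ μ i)
    (h : ∀ i, 2 * μ i ≤ ∑ j, μ j) :
    ∃ z : Fin 4 → ℂ, (∀ i, ‖z i‖ = 1) ∧ ∑ i, (μ i : ℂ) * z i = 0 := by
  simp only [Fin.sum_univ_four] at h ⊢
  have h00 := h0 0; have h01 := h0 1; have h02 := h0 2; have h03 := h0 3
  have h10 := h 0; have h11 := h 1; have h12 := h 2; have h13 := h 3
  have k₁ : |μ 0 - μ 1| ≤ μ 2 + μ 3 := abs_le.mpr ⟨by linarith, by linarith⟩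
  have k₂ : |μ 2 - μ 3| ≤ μ 0 + μ 1 := abs_le.mpr ⟨by linarith, by linarith⟩
  have k₃ : |μ 0 - μ 1| ≤ μ 0 + μ 1 := abs_le.mpr ⟨by linarith, by linarith⟩
  have k₄ : |μ 2 - μ 3| ≤ μ 2 + μ 3 := abs_le.mpr ⟨by linarith, by linarith⟩
  -- A common diagonal of length max(|μ₀ - μ₁|, |μ₂ - μ₃|) cuts the quadrilateral into two
  -- triangles; u then rotates the second onto the first.
  obtain ⟨z, hz, hzr⟩ := exists_norm_add_mul_eq h00 h01 (le_max_left _ |μ 2 - μ 3|) (max_le k₃ k₂)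
  obtain ⟨w, hw, hwr⟩ := exists_norm_add_mul_eq h02 h03 (le_max_right |μ 0 - μ 1| _) (max_le k₁ k₄)
  obtain ⟨u, hu, huz⟩ : ∃ u : ℂ, ‖u‖ = 1 ∧
      (μ 0 : ℂ) + μ 1 * z + u * ((μ 2 : ℂ) + μ 3 * w) = 0 := by
    by_cases hq : (μ 2 : ℂ) + μ 3 * w = 0
    · refine ⟨1, norm_one, ?_⟩
      have : (μ 0 : ℂ) + μ 1 * z = 0 := by
        rw [← norm_eq_zero, hzr, ← hwr, hq, norm_zero]
      rw [this, hq]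
      simp
    · refine ⟨-((μ 0 : ℂ) + μ 1 * z) / ((μ 2 : ℂ) + μ 3 * w), ?_, ?_⟩
      · rw [norm_div, norm_neg, hzr, ← hwr, div_self (norm_ne_zero_iff.mpr hq)]
      · rw [div_mul_cancel₀ _ hq]
        ring
  refine ⟨![1, z, u, u * w], fun i => ?_, ?_⟩
  · fin_cases i <;> simp [hz, hu, hw]
  · simp only [Matrix.cons_val]
    linear_combination huz

end Polygon

section TwoQubit

/-- The polarization of twice the determinant of a two-qubit vector, seen as a `2 × 2` matrix. -/
def flipForm (x y : Fin 2 × Fin 2 → ℂ) : ℂ :=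
  x (0, 0) * y (1, 1) + x (1, 1) * y (0, 0) - x (0, 1) * y (1, 0) - x (1, 0) * y (0, 1)

/-- The form at (y, y) is twice the determinant of the coefficient matrix, and a singular 2 × 2
matrix has rank at most one. -/
theorem exists_prod_of_flipForm_self_eq_zero {y : Fin 2 × Fin 2 → ℂ} (h : flipForm y y = 0) :
    ∃ u v : Fin 2 → ℂ, y = fun p => u p.1 * v p.2 := by
  have hd : y (0, 0) * y (1, 1) = y (0, 1) * y (1, 0) := by
    rw [flipForm] at h
    linear_combination h / 2
  by_cases h00 : y (0, 0) = 0
  · by_cases h01 : y (0, 1) = 0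
    · refine ⟨![0, 1], ![y (1, 0), y (1, 1)], ?_⟩
      ext ⟨i, j⟩
      fin_cases i <;> fin_cases j <;> simp [h00, h01]
    · refine ⟨![1, y (1, 1) / y (0, 1)], ![y (0, 0), y (0, 1)], ?_⟩
      have h10 : y (1, 0) = 0 := by
        rw [h00, zero_mul, eq_comm, mul_eq_zero] at hd
        exact hd.resolve_left h01
      ext ⟨i, j⟩
      fin_cases i <;> fin_cases j <;> simp [h00, h01, h10]
  · refine ⟨![1, y (1, 0) / y (0, 0)], ![y (0, 0), y (0, 1)], ?_⟩
    ext ⟨i, j⟩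
    fin_cases i <;> fin_cases j <;> simp [h00]
    field_simp
    linear_combination hd

theorem isSeparableOperator_sum_ketBra {y : Fin 4 → Fin 2 × Fin 2 → ℂ}
    (h : ∀ k, flipForm (y k) (y k) = 0) : IsSeparableOperator (∑ k, ketBra (y k)) := by
  choose u v huv using fun k => exists_prod_of_flipForm_self_eq_zero (h k)
  have : ∀ k, ketBra (y k) = ketBra (u k) ⊗ₖ ketBra (v k) := fun k => by
    rw [huv k, ketBra_prod]
  simp only [this]
  exact isSeparableOperator_sum (fun k => ketBra_posSemidef _) fun k => ketBra_posSemidef _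

theorem mul_conjTranspose_eq_sum_ketBra {X ι : Type} [Fintype ι] (V : Matrix X ι ℂ) :
    V * V.conjTranspose = ∑ j, ketBra fun p => V p j := by
  ext p q
  simp [Matrix.mul_apply, Matrix.sum_apply, ketBra_apply]

/-- A positive semidefinite two-qubit operator is a sum of four vector projections that are
orthogonal for the flip form. -/
theorem exists_flipForm_orthogonal_decomposition {s : Matrix (Fin 2 × Fin 2) (Fin 2 × Fin 2) ℂ}
    (hs : s.PosSemidef) :
    ∃ (x : Fin 4 → Fin 2 × Fin 2 → ℂ) (μ : Fin 4 → ℝ), (∀ i, 0 ≤ μ i) ∧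
      s = ∑ j, ketBra (x j) ∧ (∀ i j, flipForm (x i) (x j) = if i = j then (μ i : ℂ) else 0) ∧
      (s.PosDef → ∀ i, μ i ≠ 0) := by
  obtain ⟨M, hM⟩ := hs.exists_eq_conjTranspose_mul_self
  -- σ ⊗ σ is the Gram matrix of `flipForm`. Replacing V by V U with U unitary keeps V V† = s and
  -- changes the symmetric matrix Vᵀ(σ ⊗ σ)V by the congruence that Takagi factorization
  -- diagonalizes.
  let σ : Matrix (Fin 2) (Fin 2) ℂ := !![0, 1; -1, 0]
  let V := M.conjTranspose
  have hsym : (V.transpose * (σ ⊗ₖ σ) * V).transpose = V.transpose * (σ ⊗ₖ σ) * V := by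
    have : (σ ⊗ₖ σ).transpose = σ ⊗ₖ σ := by
      ext ⟨a, b⟩ ⟨c, d⟩
      fin_cases a <;> fin_cases b <;> fin_cases c <;> fin_cases d <;> simp [σ]
    simp only [Matrix.transpose_mul, Matrix.transpose_transpose, this, Matrix.mul_assoc]
  obtain ⟨U, μ, hU, hμ, hd⟩ := exists_takagi _ hsym
  let W := V * U
  have hW : W * W.conjTranspose = s := by
    simp only [W, Matrix.conjTranspose_mul]
    rw [Matrix.mul_assoc, ← Matrix.mul_assoc U, hU, Matrix.one_mul, hM,
      Matrix.conjTranspose_conjTranspose]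
  have hd' : W.transpose * (σ ⊗ₖ σ) * W = Matrix.diagonal fun i => (μ i : ℂ) := by
    rw [← hd]
    simp only [W, Matrix.transpose_mul, Matrix.mul_assoc]
  let e : Fin 4 ≃ Fin 2 × Fin 2 := (finProdFinEquiv (m := 2) (n := 2)).symm
  refine ⟨fun j p => W p (e j), fun j => μ (e j), fun i => hμ _, ?_, fun i j => ?_, fun hp i h0 => ?_⟩
  · rw [← hW, mul_conjTranspose_eq_sum_ketBra]
    exact (e.sum_comp fun j => ketBra fun p => W p j).symm
  · have h := congrFun (congrFun hd' (e i)) (e j)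
    rw [Matrix.diagonal_apply] at h
    simp only [e.injective.eq_iff] at h
    rw [← h, flipForm]
    simp only [Matrix.mul_apply, Matrix.transpose_apply, Matrix.kroneckerMap_apply,
      Fintype.sum_prod_type, Fin.sum_univ_two, σ, Matrix.of_apply, Matrix.cons_val', Matrix.cons_val]
    simp
    ring
  -- For positive definite s the matrix W is invertible, hence so is the diagonal matrix of the
  -- weights.
  · have h1 : W.det ≠ 0 := by
      intro hW0
      have := hp.det_pos
      rw [← hW, Matrix.det_mul, hW0, zero_mul] at this
      exact lt_irrefl _ this
    have h2 := congrArg Matrix.det hd'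
    rw [Matrix.det_mul, Matrix.det_mul, Matrix.det_transpose, Matrix.det_kronecker,
      Matrix.det_diagonal, Finset.prod_eq_zero (Finset.mem_univ (e i)) (by simp [h0])] at h2
    simp [σ, Matrix.det_fin_two, h1] at h2

/-- If no weight exceeds the sum of the others, a flip-orthogonal family can be mixed to product
vectors. -/
theorem exists_flipForm_isotropic_decomposition {x : Fin 4 → Fin 2 × Fin 2 → ℂ} {μ : Fin 4 → ℝ}
    (h0 : ∀ i, 0 ≤ μ i) (hx : ∀ i j, flipForm (x i) (x j) = if i = j then (μ i : ℂ) else 0)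
    (h : ∀ i, 2 * μ i ≤ ∑ j, μ j) :
    ∃ y : Fin 4 → Fin 2 × Fin 2 → ℂ, (∀ k, flipForm (y k) (y k) = 0) ∧
      ∑ k, ketBra (y k) = ∑ j, ketBra (x j) := by
  obtain ⟨z, hz, hsum⟩ := exists_phases_sum_eq_zero μ h0 h
  -- The form is bilinear, so multiplying xᵢ by a square root of zᵢ turns its weight μᵢ into μᵢ zᵢ;
  -- these sum to zero.
  choose ζ hζ using fun i => IsAlgClosed.exists_pow_nat_eq (z i) (n := 2) (by norm_num)
  have hζ' : ∀ i, ζ i * star (ζ i) = 1 := by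
    intro i
    rw [Complex.star_def, Complex.mul_conj, Complex.normSq_eq_norm_sq, ← norm_pow, hζ, hz]
    simp
  -- A Hadamard matrix: half of it is unitary, so the mixture is unchanged, and its entries ±1
  -- square to 1, so every yₖ has form ¼ ∑ μⱼ zⱼ = 0.
  let η : Fin 4 → Fin 4 → ℂ := ![![1, 1, 1, 1], ![1, 1, -1, -1], ![1, -1, 1, -1], ![1, -1, -1, 1]]
  let y : Fin 4 → Fin 2 × Fin 2 → ℂ := fun k p => 1 / 2 * ∑ j, η k j * ζ j * x j p
  have hxx : ∀ i, flipForm (x i) (x i) = μ i := fun i => by simp [hx]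
  have hxy : ∀ i j, i ≠ j → flipForm (x i) (x j) = 0 := fun i j hij => by simp [hx, hij]
  refine ⟨y, fun k => ?_, ?_⟩
  · have hη : ∀ j, η k j * η k j = 1 := by
      intro j
      fin_cases k <;> fin_cases j <;> simp [η]
    have e : flipForm (y k) (y k) = 1 / 4 * ∑ i, ∑ j, η k i * ζ i * (η k j * ζ j) *
        flipForm (x i) (x j) := by
      simp only [flipForm, y, Fin.sum_univ_four]
      ring
    rw [e]
    simp only [hx, mul_ite, mul_zero, Finset.sum_ite_eq, Finset.mem_univ, if_true]
    have : ∀ i, η k i * ζ i * (η k i * ζ i) * (μ i : ℂ) = μ i * z i := fun i => by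
      rw [← hζ]
      linear_combination (ζ i ^ 2 * μ i) * hη i
    simp only [this, hsum, mul_zero]
  · ext p q
    have h1 := hζ' 0; have h2 := hζ' 1; have h3 := hζ' 2; have h4 := hζ' 3
    simp only [Matrix.sum_apply, ketBra_apply, y, η, Fin.sum_univ_four, Matrix.cons_val, star_mul',
      star_add, star_neg, star_one, star_div₀, star_ofNat]
    linear_combination x 0 p * star (x 0 q) * h1 + x 1 p * star (x 1 q) * h2 +
      x 2 p * star (x 2 q) * h3 + x 3 p * star (x 3 q) * h4

end TwoQubit

/-! ### Quaternion triples of 2 × 2 matrices. -/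

section Quaternion

variable {A B C : Matrix (Fin 2) (Fin 2) ℂ}

/-- Polarized Cayley–Hamilton: traceless matrices with tr(AB) = 0 anticommute. -/
theorem mul_add_mul_of_trace_eq_zero (hA : A.trace = 0) (hB : B.trace = 0) :
    A * B + B * A = (A * B).trace • (1 : Matrix (Fin 2) (Fin 2) ℂ) := by
  rw [Matrix.trace_fin_two] at hA hB
  have hA' : A 1 1 = -A 0 0 := by linear_combination hA
  have hB' : B 1 1 = -B 0 0 := by linear_combination hB
  ext i j
  fin_cases i <;> fin_cases j <;>
    simp [Matrix.mul_apply, Matrix.trace_fin_two, Fin.sum_univ_two, hA', hB'] <;> ring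

/-- Three pairwise anticommuting traceless square roots of `-1` generate a quaternion algebra. -/
theorem eq_mul_or_eq_neg_mul_of_anticommute (hC0 : C.trace = 0) (hAB0 : (A * B).trace = 0)
    (hA : A * A = -1) (hB : B * B = -1) (hC : C * C = -1) (hAB : A * B = -(B * A))
    (hAC : A * C = -(C * A)) (hBC : B * C = -(C * B)) : C = A * B ∨ C = -(A * B) := by
  have hN : A * B * (A * B) = -1 := by
    calc A * B * (A * B) = A * (B * A) * B := by simp only [Matrix.mul_assoc]
      _ = -(A * A * (B * B)) := by
        rw [← neg_eq_iff_eq_neg.mpr hAB]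
        simp only [Matrix.mul_neg, Matrix.neg_mul, Matrix.mul_assoc]
      _ = -1 := by simp [hA, hB]
  -- C commutes with AB, and both are traceless, so their product is scalar. Hence C is a multiple
  -- of AB, and C² = -1 leaves only the factors ±1.
  have hcomm : A * B * C = C * (A * B) := by
    rw [Matrix.mul_assoc, hBC, Matrix.mul_neg, ← Matrix.mul_assoc, hAC, Matrix.neg_mul, neg_neg,
      Matrix.mul_assoc]
  have h2 := mul_add_mul_of_trace_eq_zero hAB0 hC0
  rw [← hcomm] at h2
  set κ := (A * B * C).trace
  have h3 : C = (-(κ / 2)) • (A * B) := by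
    have h4 : A * B * C = (κ / 2) • (1 : Matrix (Fin 2) (Fin 2) ℂ) := by
      rw [div_eq_inv_mul, mul_smul, ← h2, ← two_smul ℂ, smul_smul]
      norm_num
    have h5 : A * B * (A * B * C) = -C := by
      rw [← Matrix.mul_assoc, hN, Matrix.neg_mul, Matrix.one_mul]
    rw [h4, Matrix.mul_smul, Matrix.mul_one] at h5
    rw [neg_smul, h5, neg_neg]
  have hκ : (κ / 2) ^ 2 = 1 := by
    have h6 := hC
    rw [h3, Matrix.smul_mul, Matrix.mul_smul, hN, smul_smul] at h6
    have h7 := congrFun (congrFun h6 0) 0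
    simp at h7
    linear_combination h7
  rcases sq_eq_one_iff.mp hκ with h | h
  · right
    rw [h] at h3
    simpa using h3
  · left
    rw [h] at h3
    simpa using h3

/-- A quaternion triple is unitary for a suitable inner product. -/
theorem exists_unitarizing (hA0 : A.trace = 0) (hB0 : B.trace = 0) (hC0 : C.trace = 0)
    (hA : A * A = -1) (hB : B * B = -1) (hC : C * C = -1) (hAB0 : (A * B).trace = 0)
    (hAC0 : (A * C).trace = 0) (hBC0 : (B * C).trace = 0) :
    ∃ S : Matrix (Fin 2) (Fin 2) ℂ, IsUnit S.det ∧ ∀ Z ∈ ({A, B, C} : Set _),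
      Z.conjTranspose * (S.conjTranspose * S) * Z = S.conjTranspose * S := by
  have anti : ∀ {P Q : Matrix (Fin 2) (Fin 2) ℂ}, P.trace = 0 → Q.trace = 0 → (P * Q).trace = 0 →
      P * Q = -(Q * P) := by
    intro P Q hP hQ h
    have := mul_add_mul_of_trace_eq_zero hP hQ
    rw [h, zero_smul] at this
    exact eq_neg_of_add_eq_zero_left this
  have hAB := anti hA0 hB0 hAB0
  have hAC := anti hA0 hC0 hAC0
  have hBC := anti hB0 hC0 hBC0
  -- The standard inner product summed over the quaternion group up to signs; right multiplication
  -- by a group element permutes the summands.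
  set h := 1 + A.conjTranspose * A + B.conjTranspose * B + C.conjTranspose * C with hh
  have hpd : h.PosDef := by
    refine Matrix.PosDef.add_posSemidef (Matrix.PosDef.add_posSemidef (Matrix.PosDef.add_posSemidef
      Matrix.PosDef.one ?_) ?_) ?_ <;> exact Matrix.posSemidef_conjTranspose_mul_self _
  obtain ⟨S, hS⟩ := hpd.posSemidef.exists_eq_conjTranspose_mul_self
  refine ⟨S, ?_, ?_⟩
  · rw [isUnit_iff_ne_zero]
    intro h0
    have := hpd.det_pos
    rw [hS, Matrix.det_mul, h0, mul_zero] at this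
    exact lt_irrefl _ this
  · rw [← hS]
    have key : ∀ P Q R : Matrix (Fin 2) (Fin 2) ℂ, P * P = -1 →
        (Q * P = R ∨ Q * P = -R) → (R * P = Q ∨ R * P = -Q) →
        P.conjTranspose * (1 + P.conjTranspose * P + Q.conjTranspose * Q + R.conjTranspose * R) * P
          = 1 + P.conjTranspose * P + Q.conjTranspose * Q + R.conjTranspose * R := by
      intro P Q R hP hQ hR
      have e : P.conjTranspose * (1 + P.conjTranspose * P + Q.conjTranspose * Q +
          R.conjTranspose * R) * P = P.conjTranspose * P + (P * P).conjTranspose * (P * P) +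
          (Q * P).conjTranspose * (Q * P) + (R * P).conjTranspose * (R * P) := by
        simp only [Matrix.conjTranspose_mul, Matrix.mul_add, Matrix.add_mul, Matrix.mul_assoc,
          Matrix.mul_one]
      have hQ' : (Q * P).conjTranspose * (Q * P) = R.conjTranspose * R := by
        rcases hQ with h | h <;> simp [h]
      have hR' : (R * P).conjTranspose * (R * P) = Q.conjTranspose * Q := by
        rcases hR with h | h <;> simp [h]
      rw [e, hQ', hR', hP]
      simp only [Matrix.conjTranspose_neg, Matrix.conjTranspose_one, neg_mul_neg, Matrix.one_mul]
      abel
    have hABA : A * B * A = B := by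
      rw [hAB, Matrix.neg_mul, Matrix.mul_assoc, hA]
      simp
    have hABB : A * B * B = -A := by
      rw [Matrix.mul_assoc, hB]
      simp
    have hABC := eq_mul_or_eq_neg_mul_of_anticommute hC0 hAB0 hA hB hC hAB hAC hBC
    have hBA : B * A = C ∨ B * A = -C := by
      rcases hABC with h | h
      · right; rw [h, hAB, neg_neg]
      · left; rw [h, hAB, neg_neg]
    have hAB' : A * B = C ∨ A * B = -C := by
      rcases hABC with h | h
      · left; exact h.symm
      · right; rw [h, neg_neg]
    have hCA : C * A = B ∨ C * A = -B := by
      rcases hABC with h | h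
      · left; rw [h, hABA]
      · right; rw [h, Matrix.neg_mul, hABA]
    have hCB : C * B = A ∨ C * B = -A := by
      rcases hABC with h | h
      · right; rw [h, hABB]
      · left; rw [h, Matrix.neg_mul, hABB, neg_neg]
    have hAC' : A * C = B ∨ A * C = -B := by
      rw [hAC, neg_inj, neg_eq_iff_eq_neg, or_comm]
      exact hCA
    have hBC' : B * C = A ∨ B * C = -A := by
      rw [hBC, neg_inj, neg_eq_iff_eq_neg, or_comm]
      exact hCB
    rintro Z (rfl | rfl | rfl)
    · exact key _ _ _ hA hBA hCA
    · rw [show h = 1 + Z.conjTranspose * Z + A.conjTranspose * A + C.conjTranspose * C from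
        hh.trans (by abel)]
      exact key _ _ _ hB hAB' hCB
    · rw [show h = 1 + Z.conjTranspose * Z + A.conjTranspose * A + B.conjTranspose * B from
        hh.trans (by abel)]
      exact key _ _ _ hC hAC' hBC'

end Quaternion

/-! ### The filter criterion for two-qubit entanglement. -/

section TwoQubit

/-- The `2 × 2` matrix of coefficients of a two-qubit vector. -/
def coeffMatrix (x : Fin 2 × Fin 2 → ℂ) : Matrix (Fin 2) (Fin 2) ℂ := Matrix.of fun a b => x (a, b)

theorem flipForm_eq_trace (x y : Fin 2 × Fin 2 → ℂ) :
    flipForm x y = (coeffMatrix x * (coeffMatrix y).adjugate).trace := by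
  simp only [flipForm, coeffMatrix, Matrix.adjugate_fin_two, Matrix.trace_fin_two, Matrix.mul_apply,
    Fin.sum_univ_two, Matrix.of_apply, Matrix.cons_val', Matrix.cons_val]
  simp
  ring

theorem maxOverlap_localFilter_ketBra (K L : Matrix (Fin 2) (Fin 2) ℂ) (x : Fin 2 × Fin 2 → ℂ) :
    maxOverlap (localFilter K L (ketBra x)) =
      Complex.normSq (K * coeffMatrix x * L.transpose).trace := by
  rw [localFilter_ketBra, localFilter_ketBra_apply, maxOverlap_ketBra]
  rfl

theorem trace_localFilter_ketBra (K L : Matrix (Fin 2) (Fin 2) ℂ) (x : Fin 2 × Fin 2 → ℂ) :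
    (localFilter K L (ketBra x)).trace = ((K * coeffMatrix x * L.transpose).conjTranspose *
      (K * coeffMatrix x * L.transpose)).trace := by
  rw [localFilter_ketBra, localFilter_ketBra_apply, trace_ketBra, Fintype.sum_prod_type]
  simp only [Matrix.trace, Matrix.diag_apply, Matrix.mul_apply (M := Matrix.conjTranspose _),
    Matrix.conjTranspose_apply, Complex.star_def, ← Complex.normSq_eq_conj_mul_self]
  rw [Finset.sum_comm]
  push_cast
  rfl

/-- If one weight of a flip-orthogonal family exceeds the sum of the others, then a local filter
brings the overlap with a maximally entangled vector above one half of the trace. -/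
theorem exists_localFilter_trace_lt_maxOverlap_of_decomposition
    {x : Fin 4 → Fin 2 × Fin 2 → ℂ} {μ : Fin 4 → ℝ}
    (hpos : ∀ i, 0 < μ i) (hx : ∀ i j, flipForm (x i) (x j) = if i = j then (μ i : ℂ) else 0)
    (h : ∑ j, μ j < 2 * μ 0) :
    ∃ K L : Matrix (Fin 2) (Fin 2) ℂ, (localFilter K L (∑ j, ketBra (x j))).trace.re <
      maxOverlap (localFilter K L (∑ j, ketBra (x j))) := by
  -- This scaling gives all coefficient matrices Yⱼ determinant one, so that the adjugate of Y₀ is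
  -- its inverse.
  let c : Fin 4 → ℝ := fun j => Real.sqrt (2 / μ j)
  have hc : ∀ j, 0 < c j := fun j => Real.sqrt_pos.mpr (div_pos two_pos (hpos j))
  have hc2 : ∀ j, (c j : ℂ) * c j * μ j = 2 := by
    intro j
    rw [← Complex.ofReal_mul, Real.mul_self_sqrt (div_pos two_pos (hpos j)).le,
      ← Complex.ofReal_mul, div_mul_cancel₀ _ (hpos j).ne']
    norm_num
  let Y : Fin 4 → Matrix (Fin 2) (Fin 2) ℂ := fun j => (c j : ℂ) • coeffMatrix (x j)
  have hY : ∀ i j, (Y i * (Y j).adjugate).trace = if i = j then 2 else 0 := by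
    intro i j
    simp only [Y, Matrix.adjugate_smul, Fintype.card_fin, Nat.add_one_sub_one, pow_one,
      Matrix.smul_mul, Matrix.mul_smul, Matrix.trace_smul, ← flipForm_eq_trace, hx, smul_eq_mul]
    split_ifs with hij
    · subst hij
      rw [← hc2 i]
      ring
    · simp
  have hdet : ∀ j, (Y j).det = 1 := by
    intro j
    have := hY j j
    rw [Matrix.mul_adjugate, Matrix.trace_smul, Matrix.trace_one] at this
    simpa using this
  -- Relative to Y₀, flip orthogonality makes Z₁, Z₂, Z₃ a quaternion triple, while Z₀ = 1.
  let Z : Fin 4 → Matrix (Fin 2) (Fin 2) ℂ := fun j => (Y 0).adjugate * Y j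
  have hZ0 : Z 0 = 1 := by
    simp only [Z, Matrix.adjugate_mul, hdet, one_smul]
  have hZtr : ∀ j, j ≠ 0 → (Z j).trace = 0 := by
    intro j hj
    simp only [Z]
    rw [Matrix.trace_mul_comm, hY, if_neg hj]
  have hneg : ∀ M : Matrix (Fin 2) (Fin 2) ℂ, M.trace = 0 → M.adjugate = -M := by
    intro M hM
    rw [Matrix.trace_fin_two] at hM
    rw [Matrix.adjugate_fin_two]
    ext i j
    fin_cases i <;> fin_cases j <;> simp <;> linear_combination hM
  have hZsq : ∀ j, j ≠ 0 → Z j * Z j = -1 := by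
    intro j hj
    have h1 := Matrix.mul_adjugate (Z j)
    rw [hneg _ (hZtr j hj), Matrix.mul_neg] at h1
    have h2 : (Z j).det = 1 := by
      simp only [Z, Matrix.det_mul, Matrix.det_adjugate, hdet]
      simp
    rw [h2, one_smul] at h1
    rw [← h1, neg_neg]
  have hZZ : ∀ i j, i ≠ 0 → j ≠ 0 → i ≠ j → (Z i * Z j).trace = 0 := by
    intro i j hi hj hij
    have h1 : (Z i * (Z j).adjugate).trace = 0 := by
      simp only [Z]
      rw [Matrix.adjugate_mul_distrib, Matrix.adjugate_adjugate']
      rw [Matrix.mul_assoc, ← Matrix.mul_assoc (Y i), Matrix.trace_mul_comm, Matrix.mul_assoc]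
      simp [Matrix.mul_adjugate, hdet, hY, hij]
    rw [hneg _ (hZtr j hj), Matrix.mul_neg, Matrix.trace_neg, neg_eq_zero] at h1
    exact h1
  obtain ⟨S, hS, hSZ⟩ := exists_unitarizing (hZtr 1 (by decide)) (hZtr 2 (by decide))
    (hZtr 3 (by decide)) (hZsq 1 (by decide)) (hZsq 2 (by decide)) (hZsq 3 (by decide))
    (hZZ 1 2 (by decide) (by decide) (by decide)) (hZZ 1 3 (by decide) (by decide) (by decide))
    (hZZ 2 3 (by decide) (by decide) (by decide))
  have hSZ' : ∀ j, (Z j).conjTranspose * (S.conjTranspose * S) * Z j = S.conjTranspose * S := by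
    intro j
    fin_cases j
    · simp [hZ0]
    · exact hSZ _ (by simp)
    · exact hSZ _ (by simp)
    · exact hSZ _ (by simp)
  -- The filter turns xⱼ into a multiple of the unitary S Zⱼ S⁻¹, of squared norm μⱼ. For j = 0 this
  -- is a multiple of the identity, with overlap 2 μ₀, which already exceeds the total trace ∑ μⱼ.
  have hQ : ∀ j, S * (Y 0).adjugate * coeffMatrix (x j) * ((S⁻¹).transpose).transpose =
      ((c j)⁻¹ : ℂ) • (S * Z j * S⁻¹) := by
    intro j
    have : coeffMatrix (x j) = ((c j)⁻¹ : ℂ) • Y j := by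
      rw [smul_smul, inv_mul_cancel₀ (Complex.ofReal_ne_zero.mpr (hc j).ne'), one_smul]
    rw [this, Matrix.transpose_transpose, Matrix.mul_smul, Matrix.smul_mul]
    simp only [Z, Matrix.mul_assoc]
  have hSS : S⁻¹ * S = 1 := Matrix.nonsing_inv_mul S hS
  have hSS' : S * S⁻¹ = 1 := Matrix.mul_nonsing_inv S hS
  have hcinv : ∀ j, (c j)⁻¹ * (c j)⁻¹ * 2 = μ j := by
    intro j
    have h1 : c j * c j * μ j = 2 := by exact_mod_cast hc2 j
    rw [← h1]
    have := (hc j).ne'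
    field_simp
  have htr : ∀ j, (localFilter (S * (Y 0).adjugate) (S⁻¹).transpose (ketBra (x j))).trace =
      (μ j : ℂ) := by
    intro j
    rw [trace_localFilter_ketBra, hQ, Matrix.conjTranspose_smul, Matrix.smul_mul, Matrix.mul_smul,
      smul_smul, Matrix.trace_smul]
    have : (S * Z j * S⁻¹).conjTranspose * (S * Z j * S⁻¹) = 1 := by
      calc (S * Z j * S⁻¹).conjTranspose * (S * Z j * S⁻¹) =
          S⁻¹.conjTranspose * ((Z j).conjTranspose * (S.conjTranspose * S) * Z j) * S⁻¹ := by
            simp only [Matrix.conjTranspose_mul, Matrix.mul_assoc]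
        _ = (S * S⁻¹).conjTranspose * (S * S⁻¹) := by
            rw [hSZ']
            simp only [Matrix.conjTranspose_mul, Matrix.mul_assoc]
        _ = 1 := by simp [hSS']
    rw [this, Matrix.trace_one, ← hcinv j]
    simp
  have hov : ∀ j, 0 ≤ maxOverlap
      (localFilter (S * (Y 0).adjugate) (S⁻¹).transpose (ketBra (x j))) := fun j =>
    ((ketBra_posSemidef _).localFilter _ _).maxOverlap_nonneg
  have hov0 : maxOverlap (localFilter (S * (Y 0).adjugate) (S⁻¹).transpose (ketBra (x 0))) =
      2 * μ 0 := by
    rw [maxOverlap_localFilter_ketBra, hQ, hZ0, Matrix.mul_one, hSS', Matrix.trace_smul,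
      Matrix.trace_one, smul_eq_mul, Complex.normSq_mul, ← hcinv 0, ← Complex.ofReal_inv,
      Complex.normSq_ofReal]
    simp
    ring
  refine ⟨S * (Y 0).adjugate, (S⁻¹).transpose, ?_⟩
  rw [localFilter_sum, Matrix.trace_sum, maxOverlap_sum, Complex.re_sum]
  simp only [htr, Complex.ofReal_re]
  refine h.trans_le ?_
  rw [← hov0]
  exact Finset.single_le_sum (fun j _ => hov j) (Finset.mem_univ 0)

/-- A two-qubit operator is separable unless some local filter yields overlap larger than the trace:
the positive definite case, with a bound on the length of the decomposition. -/
theorem exists_isotropic_decomposition_of_posDef {s : Matrix (Fin 2 × Fin 2) (Fin 2 × Fin 2) ℂ}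
    (hs : s.PosDef) (h : ∀ K L : Matrix (Fin 2) (Fin 2) ℂ,
      maxOverlap (localFilter K L s) ≤ (localFilter K L s).trace.re) :
    ∃ y : Fin 4 → Fin 2 × Fin 2 → ℂ, (∀ k, flipForm (y k) (y k) = 0) ∧ ∑ k, ketBra (y k) = s := by
  obtain ⟨x, μ, h0, hsx, hx, hne⟩ := exists_flipForm_orthogonal_decomposition hs.posSemidef
  rw [hsx]
  refine exists_flipForm_isotropic_decomposition h0 hx fun i => ?_
  by_contra! hi
  -- The dominating weight is moved to index 0.
  let e : Fin 4 ≃ Fin 4 := Equiv.swap 0 i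
  have he : e 0 = i := Equiv.swap_apply_left 0 i
  obtain ⟨K, L, hKL⟩ := exists_localFilter_trace_lt_maxOverlap_of_decomposition
    (x := fun j => x (e j)) (μ := fun j => μ (e j))
    (fun j => lt_of_le_of_ne (h0 _) (hne hs _).symm) (fun j k => by simp [hx])
    (by rw [he, e.sum_comp]; exact hi)
  rw [e.sum_comp fun j => ketBra (x j), ← hsx] at hKL
  exact absurd (h K L) (not_le.mpr hKL)

/-- A positive semidefinite two-qubit operator is separable unless some local filter yields an
operator whose overlap with `∑ᵢ |i i⟩` is larger than its trace. -/
theorem isSeparableOperator_of_forall_maxOverlap_le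
    {s : Matrix (Fin 2 × Fin 2) (Fin 2 × Fin 2) ℂ} (hs : s.PosSemidef)
    (h : ∀ K L : Matrix (Fin 2) (Fin 2) ℂ,
      maxOverlap (localFilter K L s) ≤ (localFilter K L s).trace.re) : IsSeparableOperator s := by
  have hone : IsSeparableOperator (1 : Matrix (Fin 2 × Fin 2) (Fin 2 × Fin 2) ℂ) :=
    ⟨1, fun _ => 1, fun _ => 1, fun _ => Matrix.PosSemidef.one, fun _ => Matrix.PosSemidef.one,
      by simp⟩
  -- Passage from the positive definite case to the limit: decompositions of length four with
  -- bounded product vectors form a compact set, so the operators they produce form a closed one.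
  -- The bound uses tr 1 = 4 and a perturbation by at most the identity.
  let S : Set (Fin 4 → Fin 2 × Fin 2 → ℂ) := {y | (∀ k, flipForm (y k) (y k) = 0) ∧
    ∀ k p, ‖y k p‖ ≤ Real.sqrt (s.trace.re + 4)}
  have hS : IsCompact S := by
    have hK : IsCompact (Set.pi Set.univ fun _ : Fin 4 => Set.pi Set.univ fun _ : Fin 2 × Fin 2 =>
        Metric.closedBall (0 : ℂ) (Real.sqrt (s.trace.re + 4))) :=
      isCompact_univ_pi fun _ => isCompact_univ_pi fun _ => isCompact_closedBall _ _
    have hc : IsClosed {y : Fin 4 → Fin 2 × Fin 2 → ℂ | ∀ k, flipForm (y k) (y k) = 0} := by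
      simp only [Set.ofPred_forall]
      refine isClosed_iInter fun k => isClosed_eq ?_ continuous_const
      simp only [flipForm]
      fun_prop
    have hc' : IsClosed {y : Fin 4 → Fin 2 × Fin 2 → ℂ |
        ∀ k p, ‖y k p‖ ≤ Real.sqrt (s.trace.re + 4)} := by
      simp only [Set.ofPred_forall]
      exact isClosed_iInter fun k => isClosed_iInter fun p => isClosed_le (by fun_prop)
        continuous_const
    refine (hK.inter_left hc).of_isClosed_subset ?_ ?_
    · exact hc.inter hc'
    · rintro y ⟨h1, h2⟩
      exact ⟨h1, fun k _ p _ => by simpa using h2 k p⟩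
  have hcont : Continuous fun y : Fin 4 → Fin 2 × Fin 2 → ℂ => ∑ k, ketBra (y k) := by
    refine continuous_finsetSum _ fun k _ => continuous_matrix fun p q => ?_
    simp only [ketBra_apply]
    fun_prop
  have hcl := (hS.image hcont).isClosed
  have hseq : ∀ n : ℕ, s + ((1 / ((n : ℝ) + 1) : ℝ) : ℂ) • 1 ∈
      (fun y : Fin 4 → Fin 2 × Fin 2 → ℂ => ∑ k, ketBra (y k)) '' S := by
    intro n
    have hn : 0 < 1 / ((n : ℝ) + 1) := by positivity
    have hn1 : 1 / ((n : ℝ) + 1) ≤ 1 := by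
      rw [div_le_one (by positivity)]
      linarith [(Nat.cast_nonneg n : (0 : ℝ) ≤ n)]
    have hpd : (s + ((1 / ((n : ℝ) + 1) : ℝ) : ℂ) • 1).PosDef :=
      Matrix.PosDef.posSemidef_add hs (Matrix.PosDef.one.smul (by exact_mod_cast hn))
    -- The identity is separable, so adding a positive multiple of it preserves the assumed
    -- inequality.
    obtain ⟨y, hy, hys⟩ := exists_isotropic_decomposition_of_posDef hpd fun K L => by
      rw [localFilter_add, localFilter_smul, maxOverlap_add, maxOverlap_smul, Matrix.trace_add,
        Matrix.trace_smul, smul_eq_mul, Complex.add_re, Complex.re_ofReal_mul]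
      exact add_le_add (h K L)
        (mul_le_mul_of_nonneg_left (hone.localFilter K L).maxOverlap_le hn.le)
    refine ⟨y, ⟨hy, fun k p => ?_⟩, hys⟩
    have ht := congrArg (fun M => (Matrix.trace M).re) hys
    simp only [Matrix.trace_sum, trace_ketBra, Complex.re_sum, Complex.ofReal_re, Matrix.trace_add,
      Matrix.trace_smul, Complex.add_re, smul_eq_mul, Complex.re_ofReal_mul, Matrix.trace_one] at ht
    refine Real.le_sqrt_of_sq_le ?_
    rw [← Complex.normSq_eq_norm_sq]
    calc Complex.normSq (y k p) ≤ ∑ p, Complex.normSq (y k p) :=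
          Finset.single_le_sum (f := fun p => Complex.normSq (y k p))
            (fun p _ => Complex.normSq_nonneg _) (Finset.mem_univ p)
      _ ≤ ∑ k, ∑ p, Complex.normSq (y k p) :=
          Finset.single_le_sum (f := fun k => ∑ p, Complex.normSq (y k p))
            (fun k _ => Finset.sum_nonneg fun p _ => Complex.normSq_nonneg _) (Finset.mem_univ k)
      _ ≤ s.trace.re + 4 := by
          rw [ht]
          simp only [Fintype.card_prod, Fintype.card_fin]
          norm_num at hn1 ⊢
          linarith
  have hlim : Filter.Tendsto (fun n : ℕ => s + ((1 / ((n : ℝ) + 1) : ℝ) : ℂ) • 1) Filter.atTop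
      (nhds s) := by
    have h1 := (Complex.continuous_ofReal.tendsto 0).comp
      (tendsto_one_div_add_atTop_nhds_zero_nat (𝕜 := ℝ))
    have h2 := (h1.smul_const (1 : Matrix (Fin 2 × Fin 2) (Fin 2 × Fin 2) ℂ)).const_add s
    simpa using h2
  obtain ⟨y, hy, hys⟩ := hcl.mem_of_tendsto hlim (Filter.Eventually.of_forall hseq)
  rw [← hys]
  exact isSeparableOperator_sum_ketBra hy.1

end TwoQubit

/-! ### Amplification of the overlap of a two-qubit state -/

section BellDiagonal

/-- The two-qubit operator with entries `S e` on the diagonal and `D e` between the two basis vectors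
of parity `e`. -/
noncomputable def bellDiagonal (S D : Fin 2 → ℝ) : Matrix (Fin 2 × Fin 2) (Fin 2 × Fin 2) ℂ :=
  Matrix.of fun x y => if x.1 + x.2 = y.1 + y.2 then
    ((if x.1 = y.1 then S (x.1 + x.2) else D (x.1 + x.2) : ℝ) : ℂ) else 0

theorem trace_bellDiagonal (S D : Fin 2 → ℝ) :
    (bellDiagonal S D).trace.re = 2 * (S 0 + S 1) := by
  simp [Matrix.trace, bellDiagonal, Fintype.sum_prod_type, Fin.sum_univ_two]
  ring

theorem maxOverlap_bellDiagonal (S D : Fin 2 → ℝ) :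
    maxOverlap (bellDiagonal S D) = 2 * (S 0 + D 0) := by
  simp [maxOverlap, bellDiagonal, Fin.sum_univ_two]
  ring

/-- Hadamard matrices on both sides exchange bit and phase errors. They make `copyFilter`, which
suppresses bit errors only, usable against phase errors. -/
theorem localFilter_hadamard_bellDiagonal (S D : Fin 2 → ℝ) :
    localFilter !![1, 1; 1, -1] !![1, 1; 1, -1] (bellDiagonal S D) =
      bellDiagonal ![2 * (S 0 + D 0 + S 1 + D 1), 2 * (S 0 - D 0 + S 1 - D 1)]
        ![2 * (S 0 + D 0 - S 1 - D 1), 2 * (S 0 - D 0 - S 1 + D 1)] := by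
  ext ⟨a, b⟩ ⟨c, d⟩
  rw [localFilter_apply]
  fin_cases a <;> fin_cases b <;> fin_cases c <;> fin_cases d <;>
    simp [Fintype.sum_prod_type, Fin.sum_univ_two, bellDiagonal] <;> ring

/-- The isometry adjoint to `|x⟩ ↦ |x ⋯ x⟩`. -/
def copyFilter (C : Type) [DecidableEq C] (m : ℕ) : Matrix C (Fin m → C) ℂ :=
  Matrix.of fun x f => if f = fun _ => x then 1 else 0

theorem localFilter_copyFilter {C D : Type} [Fintype C] [DecidableEq C] [Fintype D] [DecidableEq D]
    (M : Matrix (C × D) (C × D) ℂ) (m : ℕ) :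
    localFilter (copyFilter C m) (copyFilter D m) (tensorPower M m) =
      Matrix.of fun x y => M x y ^ m := by
  ext x y
  rw [localFilter_apply]
  simp [copyFilter, Fintype.sum_prod_type, tensorPower, apply_ite (starRingEnd ℂ)]

theorem bellDiagonal_pow (S D : Fin 2 → ℝ) {m : ℕ} (hm : 0 < m) :
    (Matrix.of fun x y => bellDiagonal S D x y ^ m) =
      bellDiagonal (fun e => S e ^ m) fun e => D e ^ m := by
  ext x y
  simp only [bellDiagonal, Matrix.of_apply]
  split_ifs <;> simp [hm.ne']

/-- Kraus operators 1/√2 and U/√2 are an announced fair coin; Bob applies V when Alice has applied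
U. -/
theorem Converts.half_add_half {A B : Type} [Fintype A] [DecidableEq A] [Fintype B]
    [DecidableEq B] (U : Matrix A A ℂ) (V : Matrix B B ℂ) (hU : U.conjTranspose * U = 1)
    (hV : V.conjTranspose * V = 1) (ρ : Matrix (A × B) (A × B) ℂ) :
    Converts ρ ((1 / 2 : ℂ) • ρ + (1 / 2 : ℂ) • localFilter U V ρ) := by
  have hs : ((Real.sqrt 2⁻¹ : ℝ) : ℂ) * star ((Real.sqrt 2⁻¹ : ℝ) : ℂ) = 1 / 2 := by
    rw [Complex.star_def, Complex.conj_ofReal, ← Complex.ofReal_mul,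
      Real.mul_self_sqrt (by norm_num)]
    norm_num
  have hf : ∀ W : Matrix A A ℂ, localFilter (((Real.sqrt 2⁻¹ : ℝ) : ℂ) • W) (1 : Matrix B B ℂ) ρ =
      (1 / 2 : ℂ) • localFilter W (1 : Matrix B B ℂ) ρ := by
    intro W
    have := localFilter_smul_smul ((Real.sqrt 2⁻¹ : ℝ) : ℂ) 1 W (1 : Matrix B B ℂ) ρ
    rwa [hs, one_smul, star_one, mul_one, mul_one] at this
  refine Converts.alice_two (K := ((Real.sqrt 2⁻¹ : ℝ) : ℂ) • (1 : Matrix A A ℂ))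
    (K' := ((Real.sqrt 2⁻¹ : ℝ) : ℂ) • U) ?_ ?_ ?_
  · simp only [Matrix.conjTranspose_smul, Matrix.smul_mul, Matrix.mul_smul, smul_smul, hU, hs,
      Matrix.conjTranspose_one, Matrix.one_mul, ← add_smul]
    norm_num
  · rw [hf, localFilter_one]
    exact Converts.refl _
  · rw [hf]
    refine Converts.smul ?_ _
    convert Converts.isometry (1 : Matrix A A ℂ) V (by simp) hV
      (localFilter U (1 : Matrix B B ℂ) ρ) using 1
    rw [localFilter_localFilter, Matrix.one_mul, Matrix.mul_one]

/-- Twirling over the Pauli group. -/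
theorem converts_bellDiagonal {ω : Matrix (Fin 2 × Fin 2) (Fin 2 × Fin 2) ℂ}
    (hω : ω.IsHermitian) :
    Converts ω (bellDiagonal
      ![((ω (0, 0) (0, 0)).re + (ω (1, 1) (1, 1)).re) / 2,
        ((ω (0, 1) (0, 1)).re + (ω (1, 0) (1, 0)).re) / 2]
      ![(ω (0, 0) (1, 1)).re, (ω (0, 1) (1, 0)).re]) := by
  let Z : Matrix (Fin 2) (Fin 2) ℂ := !![1, 0; 0, -1]
  let X : Matrix (Fin 2) (Fin 2) ℂ := !![0, 1; 1, 0]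
  have hZ : Z.conjTranspose * Z = 1 := by
    ext i j
    fin_cases i <;> fin_cases j <;> simp [Z, Matrix.mul_apply, Fin.sum_univ_two]
  have hX : X.conjTranspose * X = 1 := by
    ext i j
    fin_cases i <;> fin_cases j <;> simp [X, Matrix.mul_apply, Fin.sum_univ_two]
  -- Averaging over Z ⊗ Z deletes the entries between different parities; averaging over X ⊗ X then
  -- leaves means of diagonal entries and real parts of the others.
  refine (Converts.half_add_half Z Z hZ hZ ω).trans ?_
  set ω' := (1 / 2 : ℂ) • ω + (1 / 2 : ℂ) • localFilter Z Z ω with hω'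
  have key := Converts.half_add_half X X hX hX ω'
  convert key using 1
  have hd : ∀ p, ω p p = ((ω p p).re : ℂ) := fun p => by
    have := hω.apply p p
    rw [Complex.star_def, Complex.conj_eq_iff_real] at this
    obtain ⟨r, hr⟩ := this
    simp [hr]
  have ho : ∀ p q, ((ω p q).re : ℂ) = (ω p q + ω q p) / 2 := fun p q => by
    rw [← hω.apply q p, Complex.star_def, Complex.add_conj]
    simp
  ext ⟨a, b⟩ ⟨c, d⟩
  simp only [Matrix.add_apply, Matrix.smul_apply, smul_eq_mul, localFilter_apply, hω']
  fin_cases a <;> fin_cases b <;> fin_cases c <;> fin_cases d <;>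
    simp [Fintype.sum_prod_type, Fin.sum_univ_two, bellDiagonal, X, Z, ho] <;> ring

end BellDiagonal

/-! ### Suppression of bit errors, then of phase errors. -/

section Amplification

/-- Let s, t, r be the m-th powers of S₀, D₀, S₁. A large m makes the bit errors small even against
t, since S₁ < D₀. Then M ≈ c s / t rounds suppress the phase errors to about e^{-c/2}, while the bit
errors grow at most to 4 M r / s ≤ 4 (c + 1) r / t ≤ δ. -/
theorem exists_amplification_exponents {S₀ D₀ S₁ D₁ δ : ℝ} (hS₁ : 0 ≤ S₁) (h : S₁ < D₀)
    (hD₀ : D₀ ≤ S₀) (hD₁ : |D₁| ≤ S₁) (hδ : 0 < δ) (hδ' : δ ≤ 1) :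
    ∃ m M : ℕ, 0 < m ∧ 0 < M ∧
      2 * (1 - δ) * ((2 * (S₀ ^ m + D₀ ^ m + S₁ ^ m + D₁ ^ m)) ^ M +
          (2 * (S₀ ^ m - D₀ ^ m + S₁ ^ m - D₁ ^ m)) ^ M) <
        (2 * (S₀ ^ m + D₀ ^ m + S₁ ^ m + D₁ ^ m)) ^ M +
          (2 * (S₀ ^ m + D₀ ^ m - S₁ ^ m - D₁ ^ m)) ^ M := by
  have hD : 0 < D₀ := hS₁.trans_lt h
  have hS : 0 < S₀ := hD.trans_le hD₀
  obtain ⟨c, hc0, hc⟩ : ∃ c : ℝ, 0 < c ∧ Real.exp (-(c / 2)) ≤ δ / 2 := by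
    refine ⟨-2 * Real.log (δ / 2), ?_, ?_⟩
    · have := Real.log_neg (by linarith : 0 < δ / 2) (by linarith)
      linarith
    · rw [show -(-2 * Real.log (δ / 2) / 2) = Real.log (δ / 2) by ring, Real.exp_log (by linarith)]
  have hq : S₁ / D₀ < 1 := (div_lt_one hD).mpr h
  obtain ⟨m, hm⟩ : ∃ m : ℕ, 4 * (c + 1) * (S₁ / D₀) ^ (m + 1) < δ := by
    have h1 := ((tendsto_pow_atTop_nhds_zero_of_lt_one (div_nonneg hS₁ hD.le) hq).comp
      (Filter.tendsto_add_atTop_nat 1)).const_mul (4 * (c + 1))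
    rw [mul_zero] at h1
    exact (h1.eventually (gt_mem_nhds hδ)).exists
  set s := S₀ ^ (m + 1) with hs
  set t := D₀ ^ (m + 1) with ht
  set r := S₁ ^ (m + 1) with hr
  set d := D₁ ^ (m + 1) with hd
  have ht0 : 0 < t := pow_pos hD _
  have hs0 : 0 < s := pow_pos hS _
  have hr0 : 0 ≤ r := pow_nonneg hS₁ _
  have hts : t ≤ s := pow_le_pow_left₀ hD.le hD₀ _
  have hdr : |d| ≤ r := by
    rw [hd, abs_pow]
    exact pow_le_pow_left₀ (abs_nonneg _) hD₁ _
  have hd1 := (abs_le.mp hdr).1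
  have hd2 := (abs_le.mp hdr).2
  rw [div_pow, ← hr, ← ht] at hm
  have hm' : 4 * (c + 1) * r < δ * t := by
    rwa [← mul_div_assoc, div_lt_iff₀ ht0] at hm
  have hrt : 4 * r ≤ t := by nlinarith
  set M := ⌈c / (t / s)⌉₊ with hM
  have ha0 : 0 < t / s := div_pos ht0 hs0
  have ha1 : t / s ≤ 1 := (div_le_one hs0).mpr hts
  have hM1 : c ≤ M * (t / s) := by
    rw [← div_le_iff₀ ha0]
    exact Nat.le_ceil _
  have hM2 : M * (t / s) ≤ c + 1 := by
    have := (Nat.ceil_lt_add_one (div_pos hc0 ha0).le).le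
    calc (M : ℝ) * (t / s) ≤ (c / (t / s) + 1) * (t / s) := by gcongr
      _ = c + t / s := by field_simp
      _ ≤ c + 1 := by linarith
  have hM0 : 0 < M := Nat.ceil_pos.mpr (div_pos hc0 ha0)
  refine ⟨m + 1, M, m.succ_pos, hM0, ?_⟩
  set T := 2 * (s + t + r + d) with hT
  have hT0 : 0 < T := by linarith
  have hTM : 0 < T ^ M := pow_pos hT0 _
  have hMr : 4 * (M * (r / s)) ≤ δ := by
    have e : (M : ℝ) * (r / s) = M * (t / s) * (r / t) := by field_simp
    rw [e]
    calc 4 * (M * (t / s) * (r / t)) ≤ 4 * ((c + 1) * (r / t)) := by gcongr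
      _ = 4 * (c + 1) * (r / t) := by ring
      _ ≤ δ := hm.le
  -- Bernoulli's inequality: the relative loss per round is at most 4 r / s.
  have hU : (1 - δ) * T ^ M ≤ (2 * (s + t - r - d)) ^ M := by
    have hU1 : (1 - 4 * (r / s)) * T ≤ 2 * (s + t - r - d) := by
      have e : 4 * (r / s) * s = 4 * r := by field_simp
      have : 0 ≤ 4 * (r / s) := by positivity
      nlinarith
    have hx : 0 ≤ 1 - 4 * (r / s) := by
      have : r / s ≤ 1 / 4 := by
        rw [div_le_div_iff₀ hs0 (by norm_num)]
        linarith
      linarith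
    have hb := one_add_mul_le_pow (a := -(4 * (r / s))) (by linarith) M
    calc (1 - δ) * T ^ M ≤ (1 - 4 * (r / s)) ^ M * T ^ M := by
          refine mul_le_mul_of_nonneg_right (le_trans ?_ hb) hTM.le
          linarith
      _ = ((1 - 4 * (r / s)) * T) ^ M := (mul_pow _ _ _).symm
      _ ≤ _ := pow_le_pow_left₀ (mul_nonneg hx hT0.le) hU1 _
  have hT1 : (2 * (s - t + r - d)) ^ M ≤ δ / 2 * T ^ M := by
    have h1 : 2 * (s - t + r - d) ≤ (1 - t / s / 2) * T := by
      have e : t / s * s = t := by field_simp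
      have e' : t / s * t ≤ t := by nlinarith
      have e2 : t / s * (r + d) ≤ r + d := by nlinarith
      rw [hT]
      nlinarith
    have h0 : 0 ≤ 2 * (s - t + r - d) := by linarith
    calc (2 * (s - t + r - d)) ^ M ≤ ((1 - t / s / 2) * T) ^ M := pow_le_pow_left₀ h0 h1 _
      _ = (1 - t / s / 2) ^ M * T ^ M := mul_pow _ _ _
      _ ≤ δ / 2 * T ^ M := by
        refine mul_le_mul_of_nonneg_right (le_trans ?_ hc) hTM.le
        calc (1 - t / s / 2) ^ M ≤ (Real.exp (-(t / s / 2))) ^ M := by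
              refine pow_le_pow_left₀ (by linarith) ?_ _
              linarith [Real.add_one_le_exp (-(t / s / 2))]
          _ = Real.exp (-(M * (t / s) / 2)) := by
              rw [← Real.exp_nat_mul]
              congr 1
              ring
          _ ≤ Real.exp (-(c / 2)) := Real.exp_le_exp.mpr (by linarith)
  have hT1' : 0 ≤ (2 * (s - t + r - d)) ^ M := pow_nonneg (by linarith) _
  -- In units of T ^ M the left side is at most (2 - 2δ)(1 + δ/2) = 2 - δ - δ² and the right side at
  -- least 2 - δ.
  nlinarith [mul_nonneg (sub_nonneg.mpr hδ') hT1', mul_pos hδ hTM, mul_pos (mul_pos hδ hδ) hTM]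

/-- The quadratic form at e_p + ε e_q, with ε = ±1. -/
theorem Matrix.PosSemidef.re_add_re_nonneg {X : Type} [Fintype X] [DecidableEq X]
    {M : Matrix X X ℂ} (hM : M.PosSemidef) (p q : X) (ε : ℝ) (hε : ε * ε = 1) :
    0 ≤ (M p p).re + (M q q).re + 2 * (ε * (M p q).re) := by
  have h := hM.dotProduct_mulVec_nonneg (Pi.single p 1 + Pi.single q (ε : ℂ))
  have hq : (M q p).re = (M p q).re := by
    rw [← hM.1.apply q p]
    simp
  simp only [star_add, Matrix.mulVec_add, add_dotProduct, dotProduct_add] at h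
  simp only [Matrix.mulVec_single, ← Pi.single_star, single_dotProduct] at h
  have h2 := (Complex.nonneg_iff.mp h).1
  simp [hq] at h2
  have e : ε * ((M q q).re * ε) = (M q q).re := by linear_combination (M q q).re * hε
  rw [e] at h2
  linarith

/-- A two-qubit state of fidelity more than one half can be brought arbitrarily close to a maximally
entangled state. -/
theorem exists_converts_overlap_near_two {ω : Matrix (Fin 2 × Fin 2) (Fin 2 × Fin 2) ℂ}
    (hω : IsDensityMatrix ω) (h : 1 < maxOverlap ω) {δ : ℝ} (hδ : 0 < δ) (hδ' : δ ≤ 1) :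
    ∃ (m : ℕ) (ω' : Matrix (Fin 2 × Fin 2) (Fin 2 × Fin 2) ℂ), 0 < m ∧
      Converts (tensorPower ω m) ω' ∧ 2 * (1 - δ) < maxOverlap ω' := by
  set S₀ := ((ω (0, 0) (0, 0)).re + (ω (1, 1) (1, 1)).re) / 2 with hS₀
  set S₁ := ((ω (0, 1) (0, 1)).re + (ω (1, 0) (1, 0)).re) / 2 with hS₁
  set D₀ := (ω (0, 0) (1, 1)).re with hD₀
  set D₁ := (ω (0, 1) (1, 0)).re with hD₁
  have hconv : Converts ω (bellDiagonal ![S₀, S₁] ![D₀, D₁]) := converts_bellDiagonal hω.1.1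
  set β := bellDiagonal ![S₀, S₁] ![D₀, D₁] with hβ
  have hβd : IsDensityMatrix β := ⟨hconv.posSemidef hω.1, by rw [hconv.trace_eq, hω.2]⟩
  have htr : 2 * (S₀ + S₁) = 1 := by
    have := congrArg Complex.re hω.2
    simp only [Matrix.trace, Matrix.diag_apply, Fintype.sum_prod_type, Fin.sum_univ_two,
      Complex.add_re, Complex.one_re] at this
    rw [hS₀, hS₁]
    linarith
  have hov : maxOverlap ω = 2 * (S₀ + D₀) := by
    have hq : (ω (1, 1) (0, 0)).re = (ω (0, 0) (1, 1)).re := by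
      rw [← hω.1.1.apply (1, 1) (0, 0)]
      simp
    simp only [maxOverlap, Fin.sum_univ_two, Complex.add_re, hq]
    rw [hS₀, hD₀]
    ring
  have i₀ := hω.1.re_add_re_nonneg (0, 0) (1, 1) (-1) (by norm_num)
  have i₁ := hω.1.re_add_re_nonneg (0, 1) (1, 0) (-1) (by norm_num)
  have i₂ := hω.1.re_add_re_nonneg (0, 1) (1, 0) 1 (by norm_num)
  -- Overlap 2(S₀ + D₀) > 1 = 2(S₀ + S₁) is the hypothesis S₁ < D₀; the other bounds come from
  -- positivity.
  obtain ⟨m, M, hm, hM, hlt⟩ := exists_amplification_exponents (S₀ := S₀) (D₀ := D₀) (S₁ := S₁)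
    (D₁ := D₁) (by linarith) (by linarith) (by linarith)
    (abs_le.mpr ⟨by linarith, by linarith⟩) hδ hδ'
  let H : Matrix (Fin 2) (Fin 2) ℂ := !![1, 1; 1, -1]
  set Y := tensorPower (tensorPower β m) M with hY
  have hYd : IsDensityMatrix Y :=
    ⟨(hβd.1.tensorPower m).tensorPower M, by simp [hY, trace_tensorPower, hβd.2]⟩
  have hYc : Converts (tensorPower ω (M * m)) Y := by
    refine (hconv.tensorPower (M * m)).trans ?_
    rw [hY, tensorPower_tensorPower]
    exact Converts.reindex _ _ _
  -- In each of M blocks the bit errors are filtered over m copies; after a Hadamard matrix the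
  -- phase errors are filtered over the blocks.
  let K : Matrix (Fin 2) (Fin M → Fin m → Fin 2) ℂ :=
    copyFilter (Fin 2) M * matPow (H * copyFilter (Fin 2) m) M
  have hK : localFilter K K Y = bellDiagonal
      (fun e => ![2 * (S₀ ^ m + D₀ ^ m + S₁ ^ m + D₁ ^ m),
        2 * (S₀ ^ m - D₀ ^ m + S₁ ^ m - D₁ ^ m)] e ^ M)
      (fun e => ![2 * (S₀ ^ m + D₀ ^ m - S₁ ^ m - D₁ ^ m),
        2 * (S₀ ^ m - D₀ ^ m - S₁ ^ m + D₁ ^ m)] e ^ M) := by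
    have h1 : localFilter (H * copyFilter (Fin 2) m) (H * copyFilter (Fin 2) m) (tensorPower β m) =
        bellDiagonal ![2 * (S₀ ^ m + D₀ ^ m + S₁ ^ m + D₁ ^ m),
          2 * (S₀ ^ m - D₀ ^ m + S₁ ^ m - D₁ ^ m)]
        ![2 * (S₀ ^ m + D₀ ^ m - S₁ ^ m - D₁ ^ m), 2 * (S₀ ^ m - D₀ ^ m - S₁ ^ m + D₁ ^ m)] := by
      rw [← localFilter_localFilter, localFilter_copyFilter, hβ, bellDiagonal_pow _ _ hm,
        localFilter_hadamard_bellDiagonal]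
      simp
    rw [← localFilter_localFilter, localFilter_tensorPower, h1, localFilter_copyFilter,
      bellDiagonal_pow _ _ hM]
  obtain ⟨k, ω', hk, hc, hlt'⟩ := exists_converts_of_lt_maxOverlap_localFilter hYd K K
    (f := 2 * (1 - δ)) (by
      rw [hK, trace_bellDiagonal, maxOverlap_bellDiagonal]
      simp only [Matrix.cons_val_zero, Matrix.cons_val_one]
      linarith)
  exact ⟨k * (M * m), ω', by positivity, (hYc.tensorPower_mul k).trans hc, hlt'⟩

end Amplification

/-! ### Distillation with a CSS code -/

section Pauli

/-- The sign `(-1)^t`. -/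
noncomputable def zsign (t : ZMod 2) : ℂ := if t = 0 then 1 else -1

theorem zsign_zero : zsign 0 = 1 := if_pos rfl

theorem zsign_add (s t : ZMod 2) : zsign (s + t) = zsign s * zsign t := by
  have h : ∀ s t : ZMod 2, (s = 0 ∧ t = 0 ∧ s + t = 0) ∨ (s = 0 ∧ t ≠ 0 ∧ s + t ≠ 0) ∨
      (s ≠ 0 ∧ t = 0 ∧ s + t ≠ 0) ∨ (s ≠ 0 ∧ t ≠ 0 ∧ s + t = 0) := by decide
  rcases h s t with ⟨h1, h2, h3⟩ | ⟨h1, h2, h3⟩ | ⟨h1, h2, h3⟩ | ⟨h1, h2, h3⟩ <;>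
    simp [zsign, h1, h2, h3]

theorem star_zsign (t : ZMod 2) : star (zsign t) = zsign t := by
  rw [zsign]
  split_ifs <;> simp

theorem zsign_of_ne_zero {t : ZMod 2} (h : t ≠ 0) : zsign t = -1 := if_neg h

variable {n : ℕ}

theorem add_self_binary (v : Fin n → ZMod 2) : v + v = 0 := funext fun _ => CharTwo.add_self_eq_zero _

theorem eq_add_iff_binary {u v w : Fin n → ZMod 2} : u = v + w ↔ v = u + w := by
  constructor <;> rintro rfl <;> rw [add_assoc, add_self_binary, add_zero]

/-- Orthogonality of characters: for uᵢ ≠ 0 the shift of a by the i-th unit vector changes the sign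
of every term. -/
theorem sum_zsign_dotProduct (u : Fin n → ZMod 2) :
    ∑ a : Fin n → ZMod 2, zsign (a ⬝ᵥ u) = if u = 0 then (2 : ℂ) ^ n else 0 := by
  split_ifs with h
  · simp [h, zsign_zero]
  · obtain ⟨i, hi⟩ := Function.ne_iff.mp h
    have h1 := Equiv.sum_comp (Equiv.addRight (Pi.single i (1 : ZMod 2)))
      fun a : Fin n → ZMod 2 => zsign (a ⬝ᵥ u)
    simp only [Equiv.coe_addRight, add_dotProduct, single_dotProduct, one_mul, zsign_add,
      zsign_of_ne_zero hi, mul_neg_one, Finset.sum_neg_distrib] at h1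
    exact neg_eq_self.mp h1

/-- The Pauli operator `|v⟩ ↦ (-1)^{a·v} |v + x⟩`. -/
noncomputable def pauli (x a : Fin n → ZMod 2) : Matrix (Fin n → ZMod 2) (Fin n → ZMod 2) ℂ :=
  Matrix.of fun u v => if u = v + x then zsign (a ⬝ᵥ v) else 0

theorem pauli_apply (x a u v : Fin n → ZMod 2) :
    pauli x a u v = if v = u + x then zsign (a ⬝ᵥ v) else 0 := by
  simp only [pauli, Matrix.of_apply, eq_add_iff_binary (u := u)]

theorem conj_pauli_apply (x a : Fin n → ZMod 2) (N : Matrix (Fin n → ZMod 2) (Fin n → ZMod 2) ℂ)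
    (u v : Fin n → ZMod 2) :
    ((pauli x a).conjTranspose * N * pauli x a) u v = zsign (a ⬝ᵥ (u + v)) * N (u + x) (v + x) := by
  have h : ∀ w, (pauli x a).conjTranspose u w = if w = u + x then zsign (a ⬝ᵥ u) else 0 := by
    intro w
    rw [Matrix.conjTranspose_apply, pauli, Matrix.of_apply]
    split_ifs <;> simp [star_zsign]
  simp only [Matrix.mul_apply, h]
  simp only [pauli, Matrix.of_apply, ite_mul, zero_mul, mul_ite, mul_zero, Finset.sum_ite_eq',
    Finset.mem_univ, if_true, dotProduct_add, zsign_add]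
  ring

/-- The unnormalized Bell vector with bit error `e` and phase error `b`. -/
noncomputable def bellVector (e b : Fin n → ZMod 2) : (Fin n → ZMod 2) × (Fin n → ZMod 2) → ℂ :=
  fun p => if p.2 = p.1 + e then zsign (b ⬝ᵥ p.1) else 0

theorem pauli_kronecker_mulVec (x a y a' : Fin n → ZMod 2)
    (φ : (Fin n → ZMod 2) × (Fin n → ZMod 2) → ℂ) (p r : Fin n → ZMod 2) :
    (pauli x a ⊗ₖ pauli y a').mulVec φ (p, r) =
      zsign (a ⬝ᵥ (p + x)) * zsign (a' ⬝ᵥ (r + y)) * φ (p + x, r + y) := by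
  simp only [Matrix.mulVec, dotProduct, Fintype.sum_prod_type, Matrix.kroneckerMap_apply,
    pauli_apply, ite_mul, zero_mul, mul_ite, mul_zero, Finset.sum_ite_eq', Finset.mem_univ, if_true]

/-- Pauli labels of both parties add to the error labels of a Bell vector, so only the sum of
Alice's and Bob's outcomes matters as a syndrome. -/
theorem pauli_mulVec_bellVector (x a y a' e b : Fin n → ZMod 2) :
    ∃ t : ZMod 2, (pauli x a ⊗ₖ pauli y a').mulVec (bellVector e b) =
      zsign t • bellVector (e + (x + y)) (b + (a + a')) := by
  refine ⟨(b + (a + a')) ⬝ᵥ x + a' ⬝ᵥ e, ?_⟩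
  ext ⟨p, r⟩
  rw [pauli_kronecker_mulVec]
  simp only [bellVector, Pi.smul_apply, smul_eq_mul]
  by_cases h : r = p + (e + (x + y))
  · have h' : r + y = p + x + e := by
      rw [h, show p + (e + (x + y)) + y = p + x + e + (y + y) by abel, add_self_binary, add_zero]
    rw [if_pos h', if_pos h, h', ← zsign_add, ← zsign_add, ← zsign_add]
    congr 1
    simp only [dotProduct_add, add_dotProduct]
    ring
  · rw [if_neg h, if_neg, mul_zero, mul_zero]
    intro h'
    apply h
    rw [show p + (e + (x + y)) = p + x + e + y by abel, ← h', add_assoc, add_self_binary, add_zero]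

end Pauli

/-! ### Projection of Bell vectors onto the cosets of a nested pair of codes. -/

section CodeFilter

variable {n d : ℕ} (C D : Submodule (ZMod 2) (Fin n → ZMod 2)) (π : (Fin n → ZMod 2) → Fin d)

open Classical in
/-- The operator `∑_{c ∈ C} |π c⟩⟨c|`. -/
noncomputable def codeFilter : Matrix (Fin d) (Fin n → ZMod 2) ℂ :=
  Matrix.of fun w v => if v ∈ C ∧ π v = w then 1 else 0

/-- The fibres in `C` of `π` are the cosets of `D`. -/
structure IsCosetMap : Prop where
  le : D ≤ C
  eq_iff : ∀ u ∈ C, ∀ v ∈ C, π u = π v ↔ u + v ∈ D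
  surj : ∀ w, ∃ v ∈ C, π v = w

variable {C D π}

open Classical in
theorem codeFilter_conjTranspose_mul_self_apply (h : IsCosetMap C D π) (u v : Fin n → ZMod 2) :
    ((codeFilter C π).conjTranspose * codeFilter C π) u v =
      if u ∈ C ∧ v ∈ C ∧ u + v ∈ D then 1 else 0 := by
  simp only [Matrix.mul_apply, Matrix.conjTranspose_apply, codeFilter, Matrix.of_apply]
  by_cases hu : u ∈ C
  · by_cases hv : v ∈ C
    · simp only [hu, hv, true_and, ← h.eq_iff u hu v hv]
      simp [apply_ite (starRingEnd ℂ), eq_comm]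
    · simp [hv]
  · simp [hu]

/-- Corrections with bit part in C and phase part orthogonal to D do not change the measurement
element, so Bob may insert one depending on the syndrome and still have a complete measurement. -/
theorem conj_pauli_codeFilter (h : IsCosetMap C D π) {f g : Fin n → ZMod 2} (hf : f ∈ C)
    (hg : ∀ v ∈ D, g ⬝ᵥ v = 0) :
    (codeFilter C π * pauli f g).conjTranspose * (codeFilter C π * pauli f g) =
      (codeFilter C π).conjTranspose * codeFilter C π := by
  ext u v
  have e : (codeFilter C π * pauli f g).conjTranspose * (codeFilter C π * pauli f g) =
      (pauli f g).conjTranspose * ((codeFilter C π).conjTranspose * codeFilter C π) * pauli f g := by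
    simp only [Matrix.conjTranspose_mul, Matrix.mul_assoc]
  rw [e, conj_pauli_apply, codeFilter_conjTranspose_mul_self_apply h,
    codeFilter_conjTranspose_mul_self_apply h, C.add_mem_iff_left hf, C.add_mem_iff_left hf,
    show u + f + (v + f) = u + v + (f + f) by abel, add_self_binary, add_zero]
  split_ifs with h'
  · rw [hg _ h'.2.2, zsign_zero, one_mul]
  · rw [mul_zero]

/-- Summing a matrix over all Pauli conjugations gives 2ⁿ times its trace times the identity, and
the trace here is |C|. Suitably scaled, the operators form a complete measurement. -/
theorem sum_conj_pauli (h : IsCosetMap C D π) :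
    ∑ q : (Fin n → ZMod 2) × (Fin n → ZMod 2), (codeFilter C π * pauli q.1 q.2).conjTranspose *
      (codeFilter C π * pauli q.1 q.2) = ((2 : ℂ) ^ n * Nat.card C) • 1 := by
  classical
  ext u v
  have e : ∀ q : (Fin n → ZMod 2) × (Fin n → ZMod 2),
      (codeFilter C π * pauli q.1 q.2).conjTranspose * (codeFilter C π * pauli q.1 q.2) =
      (pauli q.1 q.2).conjTranspose * ((codeFilter C π).conjTranspose * codeFilter C π) *
        pauli q.1 q.2 := by
    intro q
    simp only [Matrix.conjTranspose_mul, Matrix.mul_assoc]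
  simp only [e, Matrix.sum_apply, conj_pauli_apply, Fintype.sum_prod_type, Matrix.smul_apply,
    smul_eq_mul]
  rw [Finset.sum_congr rfl fun x _ => (Finset.sum_mul _ _ _).symm]
  simp only [sum_zsign_dotProduct, codeFilter_conjTranspose_mul_self_apply h]
  have hz : u + v = 0 ↔ u = v := by
    rw [eq_comm, eq_add_iff_binary, zero_add, eq_comm]
  simp only [hz, Matrix.one_apply]
  split_ifs with huv
  · subst huv
    rw [← Finset.mul_sum, mul_one]
    congr 1
    have h1 : ∀ x, (u + x ∈ C ∧ u + x ∈ C ∧ u + x + (u + x) ∈ D) ↔ u + x ∈ C := fun x => by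
      rw [add_self_binary]
      simp
    simp only [h1]
    rw [← Equiv.sum_comp (Equiv.addLeft u), Finset.sum_boole]
    congr 1
    rw [Nat.card_eq_fintype_card, Fintype.card_subtype]
    congr 1
    ext x
    have hx : u + Equiv.addLeft u x = x := by
      rw [Equiv.coe_addLeft, ← add_assoc, add_self_binary, zero_add]
    refine Finset.mem_filter.trans (Iff.trans ?_ Finset.mem_filter.symm)
    rw [hx]
  · simp

theorem codeFilter_kronecker_mulVec_apply (φ : (Fin n → ZMod 2) × (Fin n → ZMod 2) → ℂ)
    (w w' : Fin d) [DecidablePred (· ∈ C)] :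
    (codeFilter C π ⊗ₖ codeFilter C π).mulVec φ (w, w') =
      ∑ v, ∑ v', if (v ∈ C ∧ π v = w) ∧ (v' ∈ C ∧ π v' = w') then φ (v, v') else 0 := by
  simp only [Matrix.mulVec, dotProduct, Fintype.sum_prod_type, Matrix.kroneckerMap_apply,
    codeFilter, Matrix.of_apply]
  refine Finset.sum_congr rfl fun v _ => Finset.sum_congr rfl fun v' _ => ?_
  by_cases h1 : v ∈ C ∧ π v = w <;> by_cases h2 : v' ∈ C ∧ π v' = w' <;> simp [h1, h2]

/-- Two words of C cannot differ by a vector outside C. -/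
theorem codeFilter_mulVec_bellVector_of_notMem {e : Fin n → ZMod 2} (he : e ∉ C)
    (b : Fin n → ZMod 2) : (codeFilter C π ⊗ₖ codeFilter C π).mulVec (bellVector e b) = 0 := by
  classical
  ext ⟨w, w'⟩
  rw [codeFilter_kronecker_mulVec_apply]
  refine Finset.sum_eq_zero fun v _ => Finset.sum_eq_zero fun v' _ => ?_
  split_ifs with h
  · rw [bellVector, if_neg]
    intro h'
    simp only at h'
    rw [h'] at h
    exact he ((C.add_mem_iff_right h.1.1).mp h.2.1)
  · rfl

/-- Translating both words by v₀ ∈ D preserves the fibres of π and reverses the sign of the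
amplitude, so the sum is its own negative. -/
theorem codeFilter_mulVec_bellVector_of_ne (h : IsCosetMap C D π) {e b v₀ : Fin n → ZMod 2}
    (hv₀ : v₀ ∈ D) (hb : b ⬝ᵥ v₀ ≠ 0) :
    (codeFilter C π ⊗ₖ codeFilter C π).mulVec (bellVector e b) = 0 := by
  classical
  ext ⟨w, w'⟩
  rw [codeFilter_kronecker_mulVec_apply]
  have hinv : ∀ v, (v + v₀ ∈ C ∧ π (v + v₀) = w) ↔ (v ∈ C ∧ π v = w) := by
    intro v
    rw [C.add_mem_iff_left (h.le hv₀)]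
    refine and_congr_right fun hv => ?_
    rw [(h.eq_iff (v + v₀) (C.add_mem hv (h.le hv₀)) v hv).mpr]
    rw [show v + v₀ + v = v₀ + (v + v) by abel, add_self_binary, add_zero]
    exact hv₀
  have hinv' : ∀ v, (v + v₀ ∈ C ∧ π (v + v₀) = w') ↔ (v ∈ C ∧ π v = w') := by
    intro v
    rw [C.add_mem_iff_left (h.le hv₀)]
    refine and_congr_right fun hv => ?_
    rw [(h.eq_iff (v + v₀) (C.add_mem hv (h.le hv₀)) v hv).mpr]
    rw [show v + v₀ + v = v₀ + (v + v) by abel, add_self_binary, add_zero]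
    exact hv₀
  have h1 := Equiv.sum_comp (Equiv.addRight v₀) fun v => ∑ v',
    if (v ∈ C ∧ π v = w) ∧ (v' ∈ C ∧ π v' = w') then bellVector e b (v, v') else 0
  have h2 : ∀ v, (∑ v', if (v + v₀ ∈ C ∧ π (v + v₀) = w) ∧ (v' ∈ C ∧ π v' = w') then
      bellVector e b (v + v₀, v') else 0) =
      -∑ v', if (v ∈ C ∧ π v = w) ∧ (v' ∈ C ∧ π v' = w') then bellVector e b (v, v') else 0 := by
    intro v
    have h3 := Equiv.sum_comp (Equiv.addRight v₀) fun v' =>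
      if (v + v₀ ∈ C ∧ π (v + v₀) = w) ∧ (v' ∈ C ∧ π v' = w') then
        bellVector e b (v + v₀, v') else 0
    rw [← h3, ← Finset.sum_neg_distrib]
    refine Finset.sum_congr rfl fun v' _ => ?_
    simp only [Equiv.coe_addRight, hinv, hinv']
    split_ifs
    · simp only [bellVector, show v + v₀ + e = v + e + v₀ by abel, add_left_inj, dotProduct_add,
        zsign_add, zsign_of_ne_zero hb]
      split_ifs <;> simp
    · simp
  refine neg_eq_self.mp (Eq.trans ?_ h1)
  rw [← Finset.sum_neg_distrib]
  exact Finset.sum_congr rfl fun v _ => (h2 v).symm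

/-- Both words coincide and all signs are +1 on C, so each coset contributes its |D| elements to one
diagonal entry. -/
theorem codeFilter_mulVec_bellVector_zero (h : IsCosetMap C D π) {b : Fin n → ZMod 2}
    (hb : ∀ v ∈ C, b ⬝ᵥ v = 0) :
    (codeFilter C π ⊗ₖ codeFilter C π).mulVec (bellVector 0 b) =
      (Nat.card D : ℂ) • fun p => if p.1 = p.2 then 1 else 0 := by
  classical
  ext ⟨w, w'⟩
  rw [codeFilter_kronecker_mulVec_apply]
  simp only [bellVector, add_zero, Pi.smul_apply, smul_eq_mul, mul_ite, mul_one, mul_zero]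
  have h1 : ∀ v, (∑ v', if (v ∈ C ∧ π v = w) ∧ v' ∈ C ∧ π v' = w' then
      if v' = v then zsign (b ⬝ᵥ v) else 0 else 0) =
      if (v ∈ C ∧ π v = w) ∧ w = w' then 1 else 0 := by
    intro v
    rw [Finset.sum_eq_single v]
    · by_cases hv : v ∈ C ∧ π v = w
      · simp [hv, hb v hv.1, zsign_zero]
      · simp [hv]
    · intro v' _ hv'
      simp [hv']
    · simp
  simp only [h1]
  split_ifs with hw
  · simp only [hw, and_true, Finset.sum_boole]
    congr 1
    obtain ⟨v₀, hv₀, hv₀w⟩ := h.surj w'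
    rw [Nat.card_eq_fintype_card, Fintype.card_subtype]
    refine Finset.card_bij (fun v _ => v + v₀) ?_ ?_ ?_
    · intro v hv
      simp only [Finset.mem_filter, Finset.mem_univ, true_and] at hv ⊢
      exact (h.eq_iff v hv.1 v₀ hv₀).mp (hv.2.trans hv₀w.symm)
    · intro v _ v' _ hvv
      exact add_right_cancel hvv
    · intro u hu
      simp only [Finset.mem_filter, Finset.mem_univ, true_and] at hu
      refine ⟨u + v₀, ?_, ?_⟩
      · simp only [Finset.mem_filter, Finset.mem_univ, true_and]
        have hm := C.add_mem (h.le hu) hv₀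
        refine ⟨hm, ?_⟩
        rw [← hv₀w, h.eq_iff _ hm _ hv₀, add_assoc, add_self_binary, add_zero]
        exact hu
      · rw [add_assoc, add_self_binary, add_zero]
  · simp [hw]

end CodeFilter

/-! ### Protocols with one announcement from Alice to Bob. -/

section OneWay

variable {A B A' B' : Type} [Fintype A] [DecidableEq A] [Fintype B] [DecidableEq B]
  [Fintype A'] [DecidableEq A'] [Fintype B'] [DecidableEq B']

theorem LOCCProtocol.exists_oneWay {ι κ : Type*} [Fintype ι] [Fintype κ] (K : ι → Matrix A' A ℂ)
    (hK : ∑ i, (K i).conjTranspose * K i = 1) (J : ι → κ → Matrix B' B ℂ)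
    (hJ : ∀ i, ∑ k, (J i k).conjTranspose * J i k = 1) :
    ∃ L : LOCCProtocol A' B' A B, ∀ ρ, L.run ρ = ∑ i, ∑ k, localFilter (K i) (J i k) ρ := by
  let e := (Fintype.equivFin ι).symm
  let f := (Fintype.equivFin κ).symm
  refine ⟨.alice (fun _ => A') (fun i => K (e i)) ?_ fun i => .bob (fun _ => B')
    (fun k => J (e i) (f k)) ?_ fun _ => .done, fun ρ => ?_⟩
  · rw [← hK]
    exact e.sum_comp fun i => (K i).conjTranspose * K i
  · rw [← hJ (e i)]
    exact f.sum_comp fun k => (J (e i) k).conjTranspose * J (e i) k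
  · simp only [LOCCProtocol.run_alice, LOCCProtocol.run_bob, LOCCProtocol.run_done,
      localFilter_localFilter, Matrix.one_mul, Matrix.mul_one]
    rw [← e.sum_comp]
    exact Finset.sum_congr rfl fun i _ => f.sum_comp fun k => localFilter (K (e i)) (J (e i) k) ρ

end OneWay

/-! ### Decoding Bell vectors with correctable errors. -/

section Decoding

variable {n d : ℕ} {C D : Submodule (ZMod 2) (Fin n → ZMod 2)} {π : (Fin n → ZMod 2) → Fin d}

/-- A CSS code whose bit-error and phase-error parts correct all errors from `G` yields a protocol
that maps all Bell states with errors from `G` to the same maximally entangled state. -/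
theorem exists_decoding_protocol (h : IsCosetMap C D π) (G : Set (Fin n → ZMod 2))
    (hbit : ∀ e ∈ G, ∀ e' ∈ G, e + e' ∈ C → e = e')
    (hphase : ∀ b ∈ G, ∀ b' ∈ G, (∀ v ∈ D, (b + b') ⬝ᵥ v = 0) → ∀ v ∈ C, (b + b') ⬝ᵥ v = 0) :
    ∃ L : LOCCProtocol (Fin d) (Fin d) (Fin n → ZMod 2) (Fin n → ZMod 2),
      ∀ e ∈ G, ∀ b ∈ G, maxOverlap (L.run (ketBra (bellVector e b))) = d * 2 ^ n := by
  classical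
  -- For a syndrome u, some error of G congruent to u modulo C is selected; adding u to it gives a
  -- correction inside C. Without such an error the value 0 is harmless.
  let ehat : (Fin n → ZMod 2) → Fin n → ZMod 2 := fun u =>
    if hu : ∃ e ∈ G, e + u ∈ C then hu.choose + u else 0
  have ehat_mem : ∀ u, ehat u ∈ C := by
    intro u
    simp only [ehat]
    split_ifs with hu
    · exact hu.choose_spec.2
    · exact C.zero_mem
  let bhat : (Fin n → ZMod 2) → Fin n → ZMod 2 := fun u =>
    if hu : ∃ b ∈ G, ∀ v ∈ D, (b + u) ⬝ᵥ v = 0 then hu.choose + u else 0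
  have bhat_perp : ∀ u, ∀ v ∈ D, bhat u ⬝ᵥ v = 0 := by
    intro u
    simp only [bhat]
    split_ifs with hu
    · exact hu.choose_spec.2
    · simp
  set c : ℝ := Real.sqrt ((2 : ℝ) ^ n * Nat.card C)⁻¹ with hc
  have hcc : star (c : ℂ) * (c : ℂ) * ((2 : ℂ) ^ n * Nat.card C) = 1 := by
    rw [Complex.star_def, Complex.conj_ofReal, ← Complex.ofReal_mul, hc,
      Real.mul_self_sqrt (by positivity)]
    have : ((2 : ℂ) ^ n * Nat.card C) = (((2 : ℝ) ^ n * Nat.card C : ℝ) : ℂ) := by push_cast; rfl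
    rw [this, ← Complex.ofReal_mul, inv_mul_cancel₀, Complex.ofReal_one]
    have : 0 < Nat.card C := Nat.card_pos
    positivity
  have hcomp : ∑ q : (Fin n → ZMod 2) × (Fin n → ZMod 2),
      ((c : ℂ) • (codeFilter C π * pauli q.1 q.2)).conjTranspose *
        ((c : ℂ) • (codeFilter C π * pauli q.1 q.2)) = 1 := by
    simp only [Matrix.conjTranspose_smul, Matrix.smul_mul, Matrix.mul_smul, smul_smul]
    rw [← Finset.smul_sum, sum_conj_pauli h, smul_smul, mul_comm (c : ℂ), hcc, one_smul]
  obtain ⟨L, hL⟩ := LOCCProtocol.exists_oneWay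
    (fun q : (Fin n → ZMod 2) × (Fin n → ZMod 2) => (c : ℂ) • (codeFilter C π * pauli q.1 q.2)) hcomp
    (fun q (r : (Fin n → ZMod 2) × (Fin n → ZMod 2)) => (c : ℂ) • (codeFilter C π *
      pauli (ehat (q.1 + r.1)) (bhat (q.2 + r.2)) * pauli r.1 r.2)) (by
      intro q
      rw [← hcomp]
      refine Finset.sum_congr rfl fun r _ => ?_
      have g : ∀ (X : Matrix (Fin d) (Fin n → ZMod 2) ℂ)
          (P : Matrix (Fin n → ZMod 2) (Fin n → ZMod 2) ℂ),
          ((c : ℂ) • (X * P)).conjTranspose * ((c : ℂ) • (X * P)) =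
            (star (c : ℂ) * c) • (P.conjTranspose * (X.conjTranspose * X) * P) := by
        intro X P
        simp only [Matrix.conjTranspose_smul, Matrix.smul_mul, Matrix.mul_smul, smul_smul,
          Matrix.conjTranspose_mul, Matrix.mul_assoc, mul_comm]
      rw [g, g, conj_pauli_codeFilter h (ehat_mem (q.1 + r.1)) (bhat_perp (q.2 + r.2))])
  refine ⟨L, fun e he b hb => ?_⟩
  -- Either the syndrome is incompatible with the actual error and the branch has amplitude zero, or
  -- the correction cancels the bit error and leaves a phase error orthogonal to D, hence to C.
  have hout : ∀ q r : (Fin n → ZMod 2) × (Fin n → ZMod 2), ∃ t : ℂ,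
      localFilter ((c : ℂ) • (codeFilter C π * pauli q.1 q.2)) ((c : ℂ) • (codeFilter C π *
        pauli (ehat (q.1 + r.1)) (bhat (q.2 + r.2)) * pauli r.1 r.2)) (ketBra (bellVector e b)) =
      ketBra (t • fun p => if p.1 = p.2 then (1 : ℂ) else 0) := by
    intro q r
    obtain ⟨t₁, ht₁⟩ := pauli_mulVec_bellVector q.1 q.2 r.1 r.2 e b
    obtain ⟨t₂, ht₂⟩ := pauli_mulVec_bellVector 0 0 (ehat (q.1 + r.1)) (bhat (q.2 + r.2))
      (e + (q.1 + r.1)) (b + (q.2 + r.2))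
    have h0 : (pauli 0 0 : Matrix (Fin n → ZMod 2) (Fin n → ZMod 2) ℂ) = 1 := by
      ext u v
      simp [pauli, Matrix.one_apply, zsign_zero]
    rw [h0, zero_add, zero_add] at ht₂
    obtain ⟨t₃, ht₃⟩ : ∃ t : ℂ, (codeFilter C π ⊗ₖ codeFilter C π).mulVec
        (bellVector (e + (q.1 + r.1) + ehat (q.1 + r.1)) (b + (q.2 + r.2) + bhat (q.2 + r.2))) =
        t • fun p => if p.1 = p.2 then (1 : ℂ) else 0 := by
      by_cases hE : e + (q.1 + r.1) ∈ C
      · by_cases hB : ∀ v ∈ D, (b + (q.2 + r.2)) ⬝ᵥ v = 0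
        · have hE' : ∃ e' ∈ G, e' + (q.1 + r.1) ∈ C := ⟨e, he, hE⟩
          have hB' : ∃ b' ∈ G, ∀ v ∈ D, (b' + (q.2 + r.2)) ⬝ᵥ v = 0 := ⟨b, hb, hB⟩
          have e1 : e = hE'.choose := by
            refine hbit _ he _ hE'.choose_spec.1 ?_
            have := C.add_mem hE hE'.choose_spec.2
            rwa [show e + (q.1 + r.1) + (hE'.choose + (q.1 + r.1)) =
              e + hE'.choose + ((q.1 + r.1) + (q.1 + r.1)) by abel, add_self_binary,
              add_zero] at this
          have e2 : e + (q.1 + r.1) + ehat (q.1 + r.1) = 0 := by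
            simp only [ehat, dif_pos hE', ← e1, add_self_binary]
          have e3 : b + (q.2 + r.2) + bhat (q.2 + r.2) = b + hB'.choose := by
            simp only [bhat, dif_pos hB']
            rw [show b + (q.2 + r.2) + (hB'.choose + (q.2 + r.2)) =
              b + hB'.choose + ((q.2 + r.2) + (q.2 + r.2)) by abel, add_self_binary, add_zero]
          rw [e2, e3]
          refine ⟨_, codeFilter_mulVec_bellVector_zero h (hphase _ hb _ hB'.choose_spec.1 ?_)⟩
          intro v hv
          rw [← e3, add_dotProduct, hB v hv, bhat_perp _ v hv, add_zero]
        · push Not at hB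
          obtain ⟨v, hv, hv'⟩ := hB
          refine ⟨0, ?_⟩
          rw [zero_smul]
          refine codeFilter_mulVec_bellVector_of_ne h hv ?_
          rw [add_dotProduct, bhat_perp _ v hv, add_zero]
          exact hv'
      · refine ⟨0, ?_⟩
        rw [zero_smul]
        refine codeFilter_mulVec_bellVector_of_notMem ?_ _
        rwa [C.add_mem_iff_left (ehat_mem _)]
    refine ⟨(c : ℂ) * c * (zsign t₁ * zsign t₂ * t₃), ?_⟩
    rw [localFilter_ketBra, Matrix.smul_kronecker, Matrix.kronecker_smul, smul_smul,
      Matrix.mul_assoc,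
      show (codeFilter C π * pauli q.1 q.2) ⊗ₖ (codeFilter C π *
        (pauli (ehat (q.1 + r.1)) (bhat (q.2 + r.2)) * pauli r.1 r.2)) =
        (codeFilter C π ⊗ₖ codeFilter C π) * (((1 : Matrix _ _ ℂ) ⊗ₖ
          pauli (ehat (q.1 + r.1)) (bhat (q.2 + r.2))) * (pauli q.1 q.2 ⊗ₖ pauli r.1 r.2)) by
        rw [← Matrix.mul_kronecker_mul, ← Matrix.mul_kronecker_mul, Matrix.one_mul],
      Matrix.smul_mulVec, ← Matrix.mulVec_mulVec, ← Matrix.mulVec_mulVec, ht₁, Matrix.mulVec_smul,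
      ht₂, Matrix.mulVec_smul, Matrix.mulVec_smul, ht₃, smul_smul, smul_smul, smul_smul]
    simp only [mul_assoc]
  choose t ht using hout
  have hrun : L.run (ketBra (bellVector e b)) = ((∑ q, ∑ r, Complex.normSq (t q r) : ℝ) : ℂ) •
      ketBra (fun p : Fin d × Fin d => if p.1 = p.2 then (1 : ℂ) else 0) := by
    rw [hL]
    simp only [ht, ketBra_smul, ← Finset.sum_smul, Complex.star_def, Complex.mul_conj,
      Complex.ofReal_sum]
  -- All branches are multiples of the same vector; trace preservation determines their total weight
  -- without computing the amplitudes.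
  have htr := L.trace_run (ketBra (bellVector e b))
  have hδ : (ketBra (fun p : Fin d × Fin d => if p.1 = p.2 then (1 : ℂ) else 0)).trace = (d : ℂ) := by
    rw [trace_ketBra, Fintype.sum_prod_type]
    simp [apply_ite Complex.normSq]
  have hδ' : (ketBra (bellVector e b)).trace = ((2 ^ n : ℝ) : ℂ) := by
    have hz : ∀ s, Complex.normSq (zsign s) = 1 := by
      intro s
      rw [zsign]
      split_ifs <;> simp
    rw [trace_ketBra, Fintype.sum_prod_type]
    simp [bellVector, apply_ite Complex.normSq, hz]
  rw [hrun, Matrix.trace_smul, hδ, hδ', smul_eq_mul] at htr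
  rw [hrun, maxOverlap_smul, maxOverlap_ketBra]
  have htr' : (∑ q, ∑ r, Complex.normSq (t q r)) * d = 2 ^ n := by exact_mod_cast htr
  simp only [if_true, Finset.sum_const, Finset.card_univ, Fintype.card_fin, nsmul_eq_mul, mul_one,
    Complex.normSq_natCast]
  rw [← htr']
  ring

end Decoding

/-! ### Existence of good CSS codes -/

section GilbertVarshamov

/-- Translation by an element outside the kernel exchanges the kernel and its complement. -/
theorem two_mul_card_filter_eq_zero {G : Type*} [AddCommGroup G] [Fintype G] {F : G →+ ZMod 2}
    (hF : F ≠ 0) : 2 * (Finset.univ.filter fun g => F g = 0).card = Fintype.card G := by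
  obtain ⟨g₀, h₀⟩ := DFunLike.ne_iff.mp hF
  have hdich : ∀ a b : ZMod 2, b ≠ 0 → (a + b = 0 ↔ ¬ a = 0) := by decide
  have h1 : (Finset.univ.filter fun g => F g = 0).card =
      (Finset.univ.filter fun g => ¬ F g = 0).card := by
    refine Finset.card_equiv (Equiv.subRight g₀) fun g => ?_
    have := hdich (F (g - g₀)) (F g₀) h₀
    rw [← map_add, sub_add_cancel] at this
    simpa using this
  have h2 := Finset.card_filter_add_card_filter_not (s := (Finset.univ : Finset G)) fun g => F g = 0
  rw [Finset.card_univ] at h2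
  omega

/-- On average over g, half of the functionals vanish at g. A good g therefore leaves at most half
of them undetected, and s choices exhaust fewer than 2ˢ functionals. -/
theorem exists_forall_exists_map_ne_zero {G T : Type*} [AddCommGroup G] [Fintype G]
    (F : T → G →+ ZMod 2) (s : ℕ) (S : Finset T) (hS : S.card < 2 ^ s) (hF : ∀ t ∈ S, F t ≠ 0) :
    ∃ g : Fin s → G, ∀ t ∈ S, ∃ i, F t (g i) ≠ 0 := by
  classical
  induction s generalizing S with
  | zero =>
    refine ⟨fun _ => 0, fun t ht => ?_⟩
    have : 0 < S.card := Finset.card_pos.mpr ⟨t, ht⟩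
    omega
  | succ s ih =>
    obtain ⟨g₀, h₀⟩ : ∃ g₀, (S.filter fun t => F t g₀ = 0).card < 2 ^ s := by
      by_contra! hcon
      have h1 : ∑ g : G, 2 ^ s ≤ ∑ g : G, (S.filter fun t => F t g = 0).card :=
        Finset.sum_le_sum fun g _ => hcon g
      have h2 : ∑ g : G, (S.filter fun t => F t g = 0).card =
          ∑ t ∈ S, (Finset.univ.filter fun g => F t g = 0).card := by
        simp only [Finset.card_filter]
        exact Finset.sum_comm
      have h3 : 2 * ∑ t ∈ S, (Finset.univ.filter fun g => F t g = 0).card =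
          S.card * Fintype.card G := by
        rw [Finset.mul_sum, Finset.sum_congr rfl fun t ht => two_mul_card_filter_eq_zero (hF t ht),
          Finset.sum_const, smul_eq_mul]
      rw [Finset.sum_const, smul_eq_mul, Finset.card_univ] at h1
      have h4 : 0 < Fintype.card G := Fintype.card_pos
      have h5 : S.card * Fintype.card G < 2 ^ (s + 1) * Fintype.card G :=
        Nat.mul_lt_mul_of_pos_right hS h4
      rw [pow_succ] at h5
      nlinarith
    obtain ⟨g, hg⟩ := ih (S.filter fun t => F t g₀ = 0) h₀ fun t ht => hF t (Finset.mem_filter.mp ht).1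
    refine ⟨Fin.cons g₀ g, fun t ht => ?_⟩
    by_cases h : F t g₀ = 0
    · obtain ⟨i, hi⟩ := hg t (Finset.mem_filter.mpr ⟨ht, h⟩)
      exact ⟨i.succ, by simpa using hi⟩
    · exact ⟨0, by simpa using h⟩

end GilbertVarshamov

/-! ### Counting words of small weight and choosing the nested codes. -/

section Codes

variable {n : ℕ}

theorem sum_prod_binary_eq (f : ZMod 2 → ℝ) :
    ∑ v : Fin n → ZMod 2, ∏ i, f (v i) = (f 0 + f 1) ^ n := by
  rw [← Fintype.piFinset_univ, Finset.sum_prod_piFinset Finset.univ fun _ => f]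
  simp [show (∑ j : ZMod 2, f j) = f 0 + f 1 from Fin.sum_univ_two f]

theorem prod_ite_eq_zero_eq_pow_hammingNorm {β : Type*} [Zero β] [DecidableEq β] (v : Fin n → β)
    (t : ℝ) : ∏ i, (if v i = 0 then 1 else t) = t ^ hammingNorm v := by
  rw [Finset.prod_ite, Finset.prod_const_one, one_mul, Finset.prod_const, hammingNorm]

/-- The weight enumerator at 1/16 equals (17/16)^(64q) < 2^(8q), and every counted word contributes
at least 16^(-2q) = 2^(-8q) to it. -/
theorem card_hammingNorm_le_lt {q : ℕ} (hq : 0 < q) :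
    (Finset.univ.filter fun v : Fin (64 * q) → ZMod 2 => v ≠ 0 ∧ hammingNorm v ≤ 2 * q).card <
      2 ^ (16 * q) := by
  set W := Finset.univ.filter fun v : Fin (64 * q) → ZMod 2 => v ≠ 0 ∧ hammingNorm v ≤ 2 * q with hW
  have h1 : (W.card : ℝ) * (1 / 16) ^ (2 * q) ≤ (17 / 16) ^ (64 * q) := by
    calc (W.card : ℝ) * (1 / 16) ^ (2 * q) = ∑ v ∈ W, (1 / 16 : ℝ) ^ (2 * q) := by
          rw [Finset.sum_const, nsmul_eq_mul]
      _ ≤ ∑ v ∈ W, (1 / 16 : ℝ) ^ hammingNorm v := by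
          refine Finset.sum_le_sum fun v hv => ?_
          exact pow_le_pow_of_le_one (by norm_num) (by norm_num) (Finset.mem_filter.mp hv).2.2
      _ ≤ ∑ v : Fin (64 * q) → ZMod 2, (1 / 16 : ℝ) ^ hammingNorm v :=
          Finset.sum_le_univ_sum_of_nonneg fun v => by positivity
      _ = (17 / 16) ^ (64 * q) := by
          simp only [← prod_ite_eq_zero_eq_pow_hammingNorm]
          rw [sum_prod_binary_eq fun a => if a = 0 then (1 : ℝ) else 1 / 16]
          norm_num
  have h2 : ((17 / 16 : ℝ) ^ 64) < 2 ^ 8 := by norm_num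
  have h3 : (17 / 16 : ℝ) ^ (64 * q) < (2 ^ 8) ^ q := by
    rw [pow_mul]
    exact pow_lt_pow_left₀ h2 (by positivity) hq.ne'
  have h4 : (1 / 16 : ℝ) ^ (2 * q) * (2 ^ 8) ^ q = 1 := by
    rw [pow_mul, ← mul_pow]
    norm_num
  have h5 : (W.card : ℝ) < (2 ^ 16) ^ q := by
    calc (W.card : ℝ) = W.card * (1 / 16) ^ (2 * q) * (2 ^ 8) ^ q := by
          rw [mul_assoc, h4, mul_one]
      _ ≤ (17 / 16) ^ (64 * q) * (2 ^ 8) ^ q := by gcongr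
      _ < (2 ^ 8) ^ q * (2 ^ 8) ^ q := by gcongr
      _ = (2 ^ 16) ^ q := by
          rw [← mul_pow]
          norm_num
  rw [pow_mul]
  exact_mod_cast h5

/-- A pair of nested codes `D ≤ C` with few cosets lost such that no vector of `W` lies in `C` and
every vector of `W` orthogonal to `D` is orthogonal to `C`. -/
theorem exists_nested_codes (s : ℕ) (W : Finset (Fin n → ZMod 2)) (h0 : 0 ∉ W)
    (hW : W.card < 2 ^ s) :
    ∃ C D : Submodule (ZMod 2) (Fin n → ZMod 2), D ≤ C ∧ (∀ v ∈ W, v ∉ C) ∧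
      (∀ b ∈ W, (∀ v ∈ D, b ⬝ᵥ v = 0) → ∀ v ∈ C, b ⬝ᵥ v = 0) ∧
      2 ^ n ≤ Nat.card C * 2 ^ s ∧ Nat.card D ≤ 2 ^ s := by
  classical
  let F : (Fin n → ZMod 2) → (Fin n → ZMod 2) →+ ZMod 2 := fun b =>
    AddMonoidHom.mk' (fun v => b ⬝ᵥ v) fun u v => dotProduct_add b u v
  obtain ⟨g, hg⟩ := exists_forall_exists_map_ne_zero F s W hW (by
    intro v hv hF
    apply h0
    have : v = 0 := by
      ext i
      have := DFunLike.congr_fun hF (Pi.single i 1)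
      simpa [F] using this
    rwa [this] at hv)
  -- C is cut out by s parity checks that detect every vector of W.
  let H : (Fin n → ZMod 2) →ₗ[ZMod 2] (Fin s → ZMod 2) := Matrix.mulVecLin (Matrix.of g)
  let C : Submodule (ZMod 2) (Fin n → ZMod 2) := LinearMap.ker H
  have hC : ∀ v, v ∈ C → ∀ i, v ⬝ᵥ g i = 0 := by
    intro v hv i
    have := congrFun (LinearMap.mem_ker.mp hv) i
    rw [dotProduct_comm]
    exact this
  -- The same selection inside C: D is spanned by s vectors of C on which every b ∈ W that is
  -- nonzero on C is detected.
  let F' : (Fin n → ZMod 2) → C →+ ZMod 2 := fun b => (F b).comp C.subtype.toAddMonoidHom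
  have hF' : ∀ b (v : C), F' b v = b ⬝ᵥ (v : Fin n → ZMod 2) := fun b v => rfl
  obtain ⟨f, hf⟩ := exists_forall_exists_map_ne_zero F' s (W.filter fun b => F' b ≠ 0)
    ((Finset.card_filter_le _ _).trans_lt hW) fun b hb => (Finset.mem_filter.mp hb).2
  let D' : Submodule (ZMod 2) (Fin n → ZMod 2) :=
    Submodule.span (ZMod 2) (Set.range fun i => (f i : Fin n → ZMod 2))
  refine ⟨C, D', ?_, ?_, ?_, ?_, ?_⟩
  · rw [Submodule.span_le]
    rintro _ ⟨i, rfl⟩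
    exact (f i).2
  · intro v hv hvC
    obtain ⟨i, hi⟩ := hg v hv
    exact hi (hC v hvC i)
  · intro b hb hbD v hv
    by_contra hne
    have hb' : F' b ≠ 0 := fun h => hne (by
      rw [← hF' b ⟨v, hv⟩, h]
      rfl)
    obtain ⟨i, hi⟩ := hf b (Finset.mem_filter.mpr ⟨hb, hb'⟩)
    exact hi (hbD _ (Submodule.subset_span ⟨i, rfl⟩))
  · have h1 := H.finrank_range_add_finrank_ker
    have h2 : Module.finrank (ZMod 2) (LinearMap.range H) ≤ s := by
      simpa using Submodule.finrank_le (LinearMap.range H)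
    have h3 : Nat.card C = 2 ^ Module.finrank (ZMod 2) C := by
      simpa using Module.natCard_eq_pow_finrank (K := ZMod 2) (V := C)
    rw [h3, ← pow_add]
    refine Nat.pow_le_pow_right (by norm_num) ?_
    rw [Module.finrank_fin_fun] at h1
    change n ≤ Module.finrank (ZMod 2) (LinearMap.ker H) + s
    omega
  · have h3 : Nat.card D' = 2 ^ Module.finrank (ZMod 2) D' := by
      simpa using Module.natCard_eq_pow_finrank (K := ZMod 2) (V := D')
    rw [h3]
    refine Nat.pow_le_pow_right (by norm_num) ?_
    refine (finrank_range_le_card (R := ZMod 2) fun i => (f i : Fin n → ZMod 2)).trans ?_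
    rw [Fintype.card_fin]

theorem exists_isCosetMap {C D : Submodule (ZMod 2) (Fin n → ZMod 2)} (h : D ≤ C) :
    ∃ (d : ℕ) (π : (Fin n → ZMod 2) → Fin d), IsCosetMap C D π ∧ Nat.card C = d * Nat.card D := by
  classical
  let D' : Submodule (ZMod 2) C := D.comap C.subtype
  have : Finite (C ⧸ D') := inferInstance
  let e : (C ⧸ D') ≃ Fin (Nat.card (C ⧸ D')) := Finite.equivFin _
  -- The map numbers the cosets of D in C; its value outside C is arbitrary.
  refine ⟨_, fun v => if hv : v ∈ C then e (D'.mkQ ⟨v, hv⟩) else e 0, ⟨h, ?_, ?_⟩, ?_⟩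
  · intro u hu v hv
    rw [dif_pos hu, dif_pos hv, e.injective.eq_iff, Submodule.mkQ_apply, Submodule.mkQ_apply,
      Submodule.Quotient.eq]
    have : u - v = u + v := by rw [sub_eq_iff_eq_add, add_assoc, add_self_binary, add_zero]
    rw [← this]
    rfl
  · intro w
    obtain ⟨v, hv⟩ := D'.mkQ_surjective (e.symm w)
    refine ⟨v, v.2, ?_⟩
    rw [dif_pos v.2, Subtype.coe_eta, hv, e.apply_symm_apply]
  · have h1 := D'.card_eq_card_quotient_mul_card
    rw [h1, mul_comm]
    congr 1
    exact Nat.card_congr (Submodule.comapSubtypeEquivOfLe h).toEquiv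

/-- For errors of weight at most `q` on `64 q` qubits there is a decoding protocol with output
dimension at least `2 ^ (32 q)`. -/
theorem exists_decoding_protocol_of_weight {q : ℕ} (hq : 0 < q) :
    ∃ d : ℕ, 2 ^ (32 * q) ≤ d ∧ d ≤ 2 ^ (64 * q) ∧
      ∃ L : LOCCProtocol (Fin d) (Fin d) (Fin (64 * q) → ZMod 2) (Fin (64 * q) → ZMod 2),
        ∀ e b : Fin (64 * q) → ZMod 2, hammingNorm e ≤ q → hammingNorm b ≤ q →
          maxOverlap (L.run (ketBra (bellVector e b))) = d * 2 ^ (64 * q) := by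
  -- Two errors of weight at most q differ by a vector of weight at most 2q, so such vectors must be
  -- detected. Both codes cost 16q dimensions, leaving 64q - 32q = 32q.
  obtain ⟨C, D, hDC, hbit, hphase, hC, hD⟩ := exists_nested_codes (16 * q)
    (Finset.univ.filter fun v : Fin (64 * q) → ZMod 2 => v ≠ 0 ∧ hammingNorm v ≤ 2 * q)
    (by simp) (card_hammingNorm_le_lt hq)
  obtain ⟨d, π, hπ, hcard⟩ := exists_isCosetMap hDC
  have hadd : ∀ e e' : Fin (64 * q) → ZMod 2, hammingNorm e ≤ q → hammingNorm e' ≤ q →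
      hammingNorm (e + e') ≤ 2 * q := by
    intro e e' he he'
    have h1 := hammingDist_triangle (-e) 0 e'
    have h2 : hammingNorm (-e) = hammingNorm e := by
      simp [hammingNorm]
    rw [hammingDist_zero_right, hammingDist_zero_left, h2, hammingDist_eq_hammingNorm,
      neg_neg] at h1
    omega
  obtain ⟨L, hL⟩ := exists_decoding_protocol hπ {e | hammingNorm e ≤ q} (by
      intro e he e' he' h
      by_contra hne
      refine hbit (e + e') (Finset.mem_filter.mpr ⟨Finset.mem_univ _, ?_, hadd e e' he he'⟩) h
      intro h0
      exact hne (by rwa [eq_comm, eq_add_iff_binary, zero_add, eq_comm, eq_comm] at h0)) (by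
      intro b hb b' hb' h
      by_cases h0 : b + b' = 0
      · simp [h0]
      · exact hphase _ (Finset.mem_filter.mpr ⟨Finset.mem_univ _, h0, hadd b b' hb hb'⟩) h)
  refine ⟨d, ?_, ?_, L, fun e b he hb => hL e he b hb⟩
  · have h1 : 2 ^ (64 * q) ≤ d * (2 ^ (16 * q) * 2 ^ (16 * q)) := by
      calc 2 ^ (64 * q) ≤ Nat.card C * 2 ^ (16 * q) := hC
        _ = d * (Nat.card D * 2 ^ (16 * q)) := by rw [hcard, mul_assoc]
        _ ≤ _ := by gcongr
    rw [← pow_add, show 64 * q = 32 * q + (16 * q + 16 * q) by ring, pow_add] at h1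
    exact Nat.le_of_mul_le_mul_right h1 (by positivity)
  · have h1 : Nat.card C ≤ 2 ^ (64 * q) := by
      simpa using Finite.card_subtype_le (fun v : Fin (64 * q) → ZMod 2 => v ∈ C)
    have h2 : 0 < Nat.card D := Nat.card_pos
    nlinarith

end Codes

/-! ### Trace norm estimates -/

section TraceNorm

variable {X : Type} [Fintype X] [DecidableEq X]

theorem sum_eigenvalues_conjTranspose_mul_self (M : Matrix X X ℂ) :
    ∑ i, (Matrix.isHermitian_conjTranspose_mul_self M).eigenvalues i =
      ∑ i, ∑ j, Complex.normSq (M i j) := by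
  have h := (Matrix.isHermitian_conjTranspose_mul_self M).trace_eq_sum_eigenvalues
  have h' : (M.conjTranspose * M).trace = ((∑ i, ∑ j, Complex.normSq (M i j) : ℝ) : ℂ) := by
    rw [Finset.sum_comm]
    simp [Matrix.trace, Matrix.mul_apply, Complex.normSq_eq_conj_mul_self]
  apply Complex.ofReal_injective
  rw [← h', Complex.ofReal_sum]
  exact h.symm

theorem traceNorm_nonneg (M : Matrix X X ℂ) : 0 ≤ traceNorm M :=
  Finset.sum_nonneg fun _ _ => Real.sqrt_nonneg _

/-- The ℓ² norm of the singular values is at most their ℓ¹ norm. -/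
theorem sum_normSq_le_traceNorm_sq (M : Matrix X X ℂ) :
    ∑ i, ∑ j, Complex.normSq (M i j) ≤ traceNorm M ^ 2 := by
  rw [← sum_eigenvalues_conjTranspose_mul_self]
  calc _ = ∑ i, Real.sqrt ((Matrix.isHermitian_conjTranspose_mul_self M).eigenvalues i) ^ 2 :=
        Finset.sum_congr rfl fun i _ => (Real.sq_sqrt
          ((Matrix.posSemidef_conjTranspose_mul_self M).eigenvalues_nonneg i)).symm
    _ ≤ _ := Finset.sum_sq_le_sq_sum_of_nonneg fun i _ => Real.sqrt_nonneg _

/-- Cauchy–Schwarz for the singular values, at the cost of the dimension. -/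
theorem traceNorm_sq_le (M : Matrix X X ℂ) :
    traceNorm M ^ 2 ≤ Fintype.card X * ∑ i, ∑ j, Complex.normSq (M i j) := by
  rw [← sum_eigenvalues_conjTranspose_mul_self]
  calc traceNorm M ^ 2 ≤ Fintype.card X *
        ∑ i, Real.sqrt ((Matrix.isHermitian_conjTranspose_mul_self M).eigenvalues i) ^ 2 := by
        have := sq_sum_le_card_mul_sum_sq (s := (Finset.univ : Finset X))
          (f := fun i => Real.sqrt ((Matrix.isHermitian_conjTranspose_mul_self M).eigenvalues i))
        simpa [traceNorm] using this
    _ = _ := by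
        congr 1
        exact Finset.sum_congr rfl fun i _ => Real.sq_sqrt
          ((Matrix.posSemidef_conjTranspose_mul_self M).eigenvalues_nonneg i)

theorem sum_normSq_mul_le {Y Z : Type} [Fintype Y] [Fintype Z] (M : Matrix X Y ℂ)
    (N : Matrix Y Z ℂ) : ∑ i, ∑ j, Complex.normSq ((M * N) i j) ≤
      (∑ i, ∑ j, Complex.normSq (M i j)) * ∑ i, ∑ j, Complex.normSq (N i j) := by
  calc _ ≤ ∑ i, ∑ j, (∑ k, Complex.normSq (M i k)) * ∑ k, Complex.normSq (N k j) :=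
        Finset.sum_le_sum fun i _ => Finset.sum_le_sum fun j _ => normSq_sum_mul_le _ _ _
    _ = _ := by
        rw [Finset.sum_mul]
        refine Finset.sum_congr rfl fun i _ => ?_
        rw [← Finset.mul_sum, Finset.sum_comm (f := fun j k => Complex.normSq (N k j))]

theorem Matrix.PosSemidef.sum_normSq_le {M : Matrix X X ℂ} (hM : M.PosSemidef) :
    ∑ i, ∑ j, Complex.normSq (M i j) ≤ M.trace.re ^ 2 := by
  obtain ⟨L, rfl⟩ := hM.exists_eq_conjTranspose_mul_self
  have h1 : ∑ i, ∑ j, Complex.normSq (L.conjTranspose i j) = ∑ i, ∑ j, Complex.normSq (L i j) := by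
    rw [Finset.sum_comm]
    simp [Matrix.conjTranspose_apply]
  have h2 : (L.conjTranspose * L).trace.re = ∑ i, ∑ j, Complex.normSq (L i j) := by
    rw [Finset.sum_comm]
    simp [Matrix.trace, Matrix.mul_apply, Complex.normSq_apply]
  rw [h2, sq]
  refine (sum_normSq_mul_le _ _).trans ?_
  rw [h1]

theorem normSq_dotProduct_mulVec_le (M : Matrix X X ℂ) (ψ : X → ℂ)
    (hψ : ∑ x, Complex.normSq (ψ x) = 1) :
    Complex.normSq (∑ x, star (ψ x) * ∑ y, M x y * ψ y) ≤ ∑ i, ∑ j, Complex.normSq (M i j) := by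
  refine (normSq_sum_mul_le _ _ _).trans ?_
  simp only [Complex.star_def, Complex.normSq_conj, hψ, one_mul]
  refine Finset.sum_le_sum fun x _ => ?_
  refine (normSq_sum_mul_le _ _ _).trans ?_
  rw [hψ, mul_one]

/-- A state of fidelity `F` with a pure state is at squared Hilbert-Schmidt distance at most
`2 - 2 F` from it. -/
theorem IsDensityMatrix.sum_normSq_sub_ketBra_le {τ : Matrix X X ℂ} (hτ : IsDensityMatrix τ)
    {ψ : X → ℂ} (hψ : ∑ x, Complex.normSq (ψ x) = 1) :
    ∑ i, ∑ j, Complex.normSq ((τ - ketBra ψ) i j) ≤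
      2 - 2 * (∑ x, ∑ y, star (ψ x) * τ x y * ψ y).re := by
  have h1 := hτ.1.sum_normSq_le
  rw [hτ.2, Complex.one_re, one_pow] at h1
  have h2 : ∑ i, ∑ j, Complex.normSq (ketBra ψ i j) = 1 := by
    simp only [ketBra_apply, Complex.normSq_mul, Complex.star_def, Complex.normSq_conj,
      ← Finset.mul_sum, hψ, mul_one]
  have h3 : ∀ i j, Complex.normSq ((τ - ketBra ψ) i j) = Complex.normSq (τ i j) +
      Complex.normSq (ketBra ψ i j) - 2 * (star (ψ i) * τ i j * ψ j).re := by
    intro i j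
    rw [Matrix.sub_apply, Complex.normSq_sub, ketBra_apply]
    congr 3
    simp only [map_mul, Complex.star_def, Complex.conj_conj]
    ring
  simp only [h3, Finset.sum_sub_distrib, Finset.sum_add_distrib, h2, ← Finset.mul_sum,
    Complex.re_sum]
  linarith

end TraceNorm

/-! ### Hashing of Bell-diagonal states -/

section Hashing

/-- The Bell vector with bit error `t.1` and phase error `t.2`. -/
noncomputable def bellPair (t : ZMod 2 × ZMod 2) : ZMod 2 × ZMod 2 → ℂ :=
  fun p => if p.2 = p.1 + t.1 then zsign (t.2 * p.1) else 0

/-- The mixture of the Bell states with weights `P`. -/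
noncomputable def bellMixture (P : ZMod 2 × ZMod 2 → ℝ) :
    Matrix (ZMod 2 × ZMod 2) (ZMod 2 × ZMod 2) ℂ :=
  ∑ t, ((P t / 2 : ℝ) : ℂ) • ketBra (bellPair t)

variable {n : ℕ}

theorem zsign_sum {ι : Type*} (s : Finset ι) (f : ι → ZMod 2) :
    zsign (∑ i ∈ s, f i) = ∏ i ∈ s, zsign (f i) := by
  classical
  induction s using Finset.induction_on with
  | empty => simp [zsign_zero]
  | insert a s ha ih => rw [Finset.sum_insert ha, Finset.prod_insert ha, zsign_add, ih]

theorem bellVector_eq_prod (E : Fin n → ZMod 2 × ZMod 2) (p) :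
    bellVector (fun i => (E i).1) (fun i => (E i).2) p = ∏ i, bellPair (E i) (p.1 i, p.2 i) := by
  simp only [bellVector, bellPair, Fintype.prod_ite_zero, dotProduct, zsign_sum, funext_iff,
    Pi.add_apply]
  congr

theorem tensorPower_bellMixture (P : ZMod 2 × ZMod 2 → ℝ) (n : ℕ) :
    tensorPower (bellMixture P) n = ∑ E : Fin n → ZMod 2 × ZMod 2,
      (((∏ i, P (E i)) / 2 ^ n : ℝ) : ℂ) •
        ketBra (bellVector (fun i => (E i).1) fun i => (E i).2) := by
  ext x y
  simp only [tensorPower, Matrix.of_apply, bellMixture, Matrix.sum_apply, Matrix.smul_apply,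
    ketBra_apply, Fintype.prod_sum, bellVector_eq_prod, smul_eq_mul, star_prod,
    Finset.prod_mul_distrib]
  refine Finset.sum_congr rfl fun E _ => ?_
  congr 1
  rw [← Complex.ofReal_prod, Finset.prod_div_distrib]
  simp

/-- Exponential Markov inequality with factor δ⁻¹ for each error: more than q errors weigh at least
δ^(-q), and each position contributes P 0 + (1 - P 0)/δ ≤ 2. -/
theorem sum_prod_tail_le {P : ZMod 2 × ZMod 2 → ℝ} (hP : ∀ t, 0 ≤ P t) (hsum : ∑ t, P t = 1)
    {δ : ℝ} (hδ : 0 < δ) (hδ' : δ ≤ 1) (h0 : 1 - P 0 ≤ δ) (n q : ℕ) :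
    ∑ E : Fin n → ZMod 2 × ZMod 2 with ¬ hammingNorm E ≤ q, ∏ i, P (E i) ≤ 2 ^ n * δ ^ q := by
  calc _ ≤ ∑ E : Fin n → ZMod 2 × ZMod 2 with ¬ hammingNorm E ≤ q,
        δ ^ q * ∏ i, (P (E i) * if E i = 0 then 1 else δ⁻¹) := by
        refine Finset.sum_le_sum fun E hE => ?_
        rw [Finset.prod_mul_distrib, prod_ite_eq_zero_eq_pow_hammingNorm]
        have h1 : 1 ≤ δ ^ q * δ⁻¹ ^ hammingNorm E := by
          rw [inv_pow, ← div_eq_mul_inv, one_le_div (by positivity)]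
          exact pow_le_pow_of_le_one hδ.le hδ' (not_le.mp (Finset.mem_filter.mp hE).2).le
        have h2 : 0 ≤ ∏ i, P (E i) := Finset.prod_nonneg fun i _ => hP _
        nlinarith
    _ ≤ ∑ E : Fin n → ZMod 2 × ZMod 2, δ ^ q * ∏ i, (P (E i) * if E i = 0 then 1 else δ⁻¹) := by
        refine Finset.sum_le_univ_sum_of_nonneg fun E => ?_
        refine mul_nonneg (by positivity) (Finset.prod_nonneg fun i _ => mul_nonneg (hP _) ?_)
        split_ifs <;> positivity
    _ = δ ^ q * (∑ t, P t * if t = 0 then 1 else δ⁻¹) ^ n := by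
        rw [← Finset.mul_sum, ← Fintype.prod_sum fun (_ : Fin n) t => P t * if t = 0 then 1 else δ⁻¹]
        simp
    _ ≤ δ ^ q * 2 ^ n := by
        have h1 : ∑ t, P t * (if t = 0 then 1 else δ⁻¹) ≤ 2 := by
          rw [← Finset.add_sum_erase _ _ (Finset.mem_univ (0 : ZMod 2 × ZMod 2))] at hsum ⊢
          have h2 : ∑ t ∈ Finset.univ.erase (0 : ZMod 2 × ZMod 2), P t * (if t = 0 then 1 else δ⁻¹) =
              (∑ t ∈ Finset.univ.erase (0 : ZMod 2 × ZMod 2), P t) * δ⁻¹ := by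
            rw [Finset.sum_mul]
            exact Finset.sum_congr rfl fun t ht => by rw [if_neg (Finset.ne_of_mem_erase ht)]
          have h3 : 0 ≤ ∑ t ∈ Finset.univ.erase (0 : ZMod 2 × ZMod 2), P t :=
            Finset.sum_nonneg fun t _ => hP t
          rw [h2, if_pos rfl, mul_one]
          have h4 : (∑ t ∈ Finset.univ.erase (0 : ZMod 2 × ZMod 2), P t) * δ⁻¹ ≤ 1 := by
            rw [← div_eq_mul_inv, div_le_one hδ]
            linarith
          linarith
        have h2 : 0 ≤ ∑ t, P t * (if t = 0 then 1 else δ⁻¹) :=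
          Finset.sum_nonneg fun t _ => mul_nonneg (hP t) (by split_ifs <;> positivity)
        gcongr
    _ = _ := mul_comm _ _

/-- Error strings of weight at most q are decoded perfectly; the others contribute a nonnegative
overlap. -/
theorem exists_protocol_bellMixture {P : ZMod 2 × ZMod 2 → ℝ} (hP : ∀ t, 0 ≤ P t)
    (hsum : ∑ t, P t = 1) {δ : ℝ} (hδ : 0 < δ) (hδ' : δ ≤ 1) (h0 : 1 - P 0 ≤ δ) {q : ℕ}
    (hq : 0 < q) : ∃ d : ℕ, 2 ^ (32 * q) ≤ d ∧ d ≤ 2 ^ (64 * q) ∧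
      ∃ L : LOCCProtocol (Fin d) (Fin d) (Fin (64 * q) → ZMod 2) (Fin (64 * q) → ZMod 2),
        d * (1 - 2 ^ (64 * q) * δ ^ q) ≤ maxOverlap (L.run (tensorPower (bellMixture P) (64 * q))) := by
  obtain ⟨d, hd, hd', L, hL⟩ := exists_decoding_protocol_of_weight hq
  refine ⟨d, hd, hd', L, ?_⟩
  rw [tensorPower_bellMixture, L.run_sum, maxOverlap_sum]
  simp only [L.run_smul, maxOverlap_smul]
  have hnn : ∀ E : Fin (64 * q) → ZMod 2 × ZMod 2, 0 ≤ ∏ i, P (E i) :=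
    fun E => Finset.prod_nonneg fun i _ => hP _
  have htot : ∑ E : Fin (64 * q) → ZMod 2 × ZMod 2, ∏ i, P (E i) = 1 := by
    rw [← Fintype.prod_sum fun (_ : Fin (64 * q)) t => P t]
    simp [hsum]
  have htail := sum_prod_tail_le hP hsum hδ hδ' h0 (64 * q) q
  have hsplit := Finset.sum_filter_add_sum_filter_not (Finset.univ)
    (fun E : Fin (64 * q) → ZMod 2 × ZMod 2 => hammingNorm E ≤ q) fun E => ∏ i, P (E i)
  have hweight : ∀ E : Fin (64 * q) → ZMod 2 × ZMod 2, hammingNorm E ≤ q →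
      hammingNorm (fun i => (E i).1) ≤ q ∧ hammingNorm (fun i => (E i).2) ≤ q := by
    intro E hE
    constructor
    all_goals
      refine le_trans (Finset.card_le_card fun i hi => ?_) hE
      rw [Finset.mem_filter] at hi ⊢
      refine ⟨hi.1, fun h => hi.2 ?_⟩
      simp [h]
  calc (d : ℝ) * (1 - 2 ^ (64 * q) * δ ^ q)
      ≤ d * ∑ E : Fin (64 * q) → ZMod 2 × ZMod 2 with hammingNorm E ≤ q, ∏ i, P (E i) := by
        gcongr
        linarith
    _ = ∑ E : Fin (64 * q) → ZMod 2 × ZMod 2 with hammingNorm E ≤ q,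
        (∏ i, P (E i)) / 2 ^ (64 * q) *
          maxOverlap (L.run (ketBra (bellVector (fun i => (E i).1) fun i => (E i).2))) := by
        rw [Finset.mul_sum]
        refine Finset.sum_congr rfl fun E hE => ?_
        obtain ⟨h1, h2⟩ := hweight E (Finset.mem_filter.mp hE).2
        rw [hL _ _ h1 h2]
        field_simp
    _ ≤ _ := Finset.sum_le_univ_sum_of_nonneg fun E => mul_nonneg (div_nonneg (hnn E) (by positivity))
        ((ketBra_posSemidef _).run L).maxOverlap_nonneg

/-- Both sides are the same operator, with `Fin 2` read as `ZMod 2`: the Bell vectors of bit error e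
have the weights S e ± D e. -/
theorem converts_bellMixture (S D : Fin 2 → ℝ) :
    Converts (bellDiagonal S D) (bellMixture fun t => if t.2 = 0 then S t.1 + D t.1 else S t.1 - D t.1) := by
  have key : bellMixture (fun t => if t.2 = 0 then S t.1 + D t.1 else S t.1 - D t.1) =
      (bellDiagonal S D).submatrix (Prod.map (Equiv.refl (ZMod 2)) (Equiv.refl (ZMod 2)))
        (Prod.map (Equiv.refl (ZMod 2)) (Equiv.refl (ZMod 2))) := by
    have hor : ∀ e : ZMod 2, e = 0 ∨ e = 1 := by decide
    have hsum : ∀ f : ZMod 2 → ℂ, ∑ e, f e = f 0 + f 1 := Fin.sum_univ_two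
    have h2 : (1 : ZMod 2) + 1 = 0 := rfl
    ext ⟨a, b⟩ ⟨c, d⟩
    have hB : (bellDiagonal S D).submatrix (Prod.map (Equiv.refl (ZMod 2)) (Equiv.refl (ZMod 2)))
        (Prod.map (Equiv.refl (ZMod 2)) (Equiv.refl (ZMod 2))) (a, b) (c, d) =
        if a + b = c + d then ((if a = c then S (a + b) else D (a + b) : ℝ) : ℂ) else 0 := rfl
    rw [hB]
    simp only [bellMixture, Matrix.sum_apply, Matrix.smul_apply, ketBra_apply, bellPair,
      Fintype.sum_prod_type, hsum]
    rcases hor a with rfl | rfl <;> rcases hor b with rfl | rfl <;> rcases hor c with rfl | rfl <;>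
      rcases hor d with rfl | rfl <;> simp [zsign, h2] <;> ring
  rw [key]
  exact Converts.reindex _ _ _

end Hashing

/-! ### Distillation at a positive rate -/

section MaximallyEntangled

/-- The standard maximally entangled vector. -/
noncomputable def maximallyEntangledVector (d : ℕ) : Fin d × Fin d → ℂ :=
  fun p => if p.1 = p.2 then (((Real.sqrt d)⁻¹ : ℝ) : ℂ) else 0

variable {d : ℕ}

theorem ofReal_inv_sqrt_mul_self (d : ℕ) :
    (((Real.sqrt d)⁻¹ : ℝ) : ℂ) * (((Real.sqrt d)⁻¹ : ℝ) : ℂ) = (d : ℂ)⁻¹ := by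
  rw [← Complex.ofReal_mul, ← mul_inv, Real.mul_self_sqrt (Nat.cast_nonneg d)]
  simp

theorem isMaximallyEntangled_maximallyEntangledVector (d : ℕ) :
    IsMaximallyEntangled (maximallyEntangledVector d) := by
  constructor
  · ext x x'
    simp only [reducedA, Matrix.of_apply, ketBra_apply, maximallyEntangledVector, Matrix.smul_apply,
      Matrix.one_apply, smul_eq_mul, ← ofReal_inv_sqrt_mul_self]
    simp [apply_ite (starRingEnd ℂ)]
  · ext x x'
    simp only [reducedB, Matrix.of_apply, ketBra_apply, maximallyEntangledVector, Matrix.smul_apply,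
      Matrix.one_apply, smul_eq_mul, ← ofReal_inv_sqrt_mul_self]
    simp [apply_ite (starRingEnd ℂ), eq_comm]

theorem sum_normSq_maximallyEntangledVector (hd : 0 < d) :
    ∑ p, Complex.normSq (maximallyEntangledVector d p) = 1 := by
  have h : (d : ℝ) ≠ 0 := by positivity
  simp only [maximallyEntangledVector, Fintype.sum_prod_type, apply_ite Complex.normSq,
    Complex.normSq_ofReal, ← mul_inv, Real.mul_self_sqrt (Nat.cast_nonneg d), map_zero,
    Finset.sum_ite_eq, Finset.mem_univ, if_true, Finset.sum_const, Finset.card_univ,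
    Fintype.card_fin, nsmul_eq_mul]
  exact mul_inv_cancel₀ h

theorem sum_maximallyEntangledVector_mul (τ : Matrix (Fin d × Fin d) (Fin d × Fin d) ℂ) :
    (∑ x, ∑ y, star (maximallyEntangledVector d x) * τ x y * maximallyEntangledVector d y).re =
      maxOverlap τ / d := by
  have h : ∑ x, ∑ y, star (maximallyEntangledVector d x) * τ x y * maximallyEntangledVector d y =
      (((d : ℝ)⁻¹ : ℝ) : ℂ) * ∑ i, ∑ j, τ (i, i) (j, j) := by
    have e : (((d : ℝ)⁻¹ : ℝ) : ℂ) = (d : ℂ)⁻¹ := by simp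
    rw [e, ← ofReal_inv_sqrt_mul_self]
    simp only [maximallyEntangledVector, Fintype.sum_prod_type, Complex.star_def,
      apply_ite (starRingEnd ℂ), map_zero, Complex.conj_ofReal, ite_mul, zero_mul, mul_ite, mul_zero,
      Finset.sum_ite_eq, Finset.mem_univ, if_true, Finset.mul_sum]
    have e2 : ∀ (i j : Fin d) (f : Fin d → ℂ), (∑ k : Fin d, if i = j then f k else 0) =
        if i = j then ∑ k, f k else 0 := by
      intro i j f
      split_ifs <;> simp
    simp only [e2, Finset.sum_ite_eq, Finset.mem_univ, if_true]
    refine Finset.sum_congr rfl fun i _ => Finset.sum_congr rfl fun j _ => ?_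
    ring
  rw [h, Complex.re_ofReal_mul, maxOverlap, div_eq_inv_mul]

theorem traceNorm_sub_maximallyEntangled_sq_le {τ : Matrix (Fin d × Fin d) (Fin d × Fin d) ℂ}
    (hd : 0 < d) (hτ : IsDensityMatrix τ) :
    traceNorm (τ - ketBra (maximallyEntangledVector d)) ^ 2 ≤
      (d : ℝ) ^ 2 * (2 - 2 * (maxOverlap τ / d)) := by
  have h := hτ.sum_normSq_sub_ketBra_le (sum_normSq_maximallyEntangledVector hd)
  rw [sum_maximallyEntangledVector_mul] at h
  refine (traceNorm_sq_le _).trans ?_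
  rw [Fintype.card_prod, Fintype.card_fin, Nat.cast_mul, ← sq]
  gcongr

end MaximallyEntangled

/-! ### Rate and error of the complete distillation protocol. -/

section Distillation

variable {A B : Type} [Fintype A] [DecidableEq A] [Fintype B] [DecidableEq B]

theorem tensorPower_isDensityMatrix {ρ : Matrix (A × B) (A × B) ℂ} (hρ : IsDensityMatrix ρ) (n : ℕ) :
    IsDensityMatrix (tensorPower ρ n) :=
  ⟨hρ.1.tensorPower n, by rw [trace_tensorPower, hρ.2, one_pow]⟩

theorem Converts.isDensityMatrix {A' B' : Type} [Fintype A'] [DecidableEq A'] [Fintype B']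
    [DecidableEq B'] {ρ : Matrix (A × B) (A × B) ℂ} {σ : Matrix (A' × B') (A' × B') ℂ}
    (h : Converts ρ σ) (hρ : IsDensityMatrix ρ) : IsDensityMatrix σ :=
  ⟨h.posSemidef hρ.1, by rw [h.trace_eq, hρ.2]⟩

/-- Two-qubit states of fidelity close to one can be converted into mixtures of Bell states with a
dominating weight. -/
theorem exists_converts_bellMixture {ω : Matrix (Fin 2 × Fin 2) (Fin 2 × Fin 2) ℂ}
    (hω : IsDensityMatrix ω) : ∃ P : ZMod 2 × ZMod 2 → ℝ, (∀ t, 0 ≤ P t) ∧ ∑ t, P t = 1 ∧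
      P 0 = maxOverlap ω / 2 ∧ Converts ω (bellMixture P) := by
  refine ⟨_, ?_, ?_, ?_, (converts_bellDiagonal hω.1.1).trans (converts_bellMixture _ _)⟩
  · have i₀ := hω.1.re_add_re_nonneg (0, 0) (1, 1) (-1) (by norm_num)
    have i₁ := hω.1.re_add_re_nonneg (0, 1) (1, 0) (-1) (by norm_num)
    have i₂ := hω.1.re_add_re_nonneg (0, 1) (1, 0) 1 (by norm_num)
    have i₃ := hω.1.re_add_re_nonneg (0, 0) (1, 1) 1 (by norm_num)
    have hor : ∀ e : ZMod 2, e = 0 ∨ e = 1 := by decide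
    have h10 : (1 : ZMod 2) ≠ 0 := by decide
    rintro ⟨e, b⟩
    rcases hor e with rfl | rfl <;> rcases hor b with rfl | rfl
    · rw [if_pos rfl]
      change 0 ≤ ((ω (0, 0) (0, 0)).re + (ω (1, 1) (1, 1)).re) / 2 + (ω (0, 0) (1, 1)).re
      linarith
    · rw [if_neg h10]
      change 0 ≤ ((ω (0, 0) (0, 0)).re + (ω (1, 1) (1, 1)).re) / 2 - (ω (0, 0) (1, 1)).re
      linarith
    · rw [if_pos rfl]
      change 0 ≤ ((ω (0, 1) (0, 1)).re + (ω (1, 0) (1, 0)).re) / 2 + (ω (0, 1) (1, 0)).re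
      linarith
    · rw [if_neg h10]
      change 0 ≤ ((ω (0, 1) (0, 1)).re + (ω (1, 0) (1, 0)).re) / 2 - (ω (0, 1) (1, 0)).re
      linarith
  · have hsum : ∀ f : ZMod 2 → ℝ, ∑ e, f e = f 0 + f 1 := Fin.sum_univ_two
    have h10 : (1 : ZMod 2) ≠ 0 := by decide
    have htr := congrArg Complex.re hω.2
    simp only [Matrix.trace, Matrix.diag_apply, Fintype.sum_prod_type, Fin.sum_univ_two,
      Complex.add_re, Complex.one_re] at htr
    rw [Fintype.sum_prod_type, hsum, hsum, hsum, if_pos rfl, if_neg h10, if_pos rfl, if_neg h10]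
    change ((ω (0, 0) (0, 0)).re + (ω (1, 1) (1, 1)).re) / 2 + (ω (0, 0) (1, 1)).re +
      (((ω (0, 0) (0, 0)).re + (ω (1, 1) (1, 1)).re) / 2 - (ω (0, 0) (1, 1)).re) +
      (((ω (0, 1) (0, 1)).re + (ω (1, 0) (1, 0)).re) / 2 + (ω (0, 1) (1, 0)).re +
      (((ω (0, 1) (0, 1)).re + (ω (1, 0) (1, 0)).re) / 2 - (ω (0, 1) (1, 0)).re)) = 1
    linarith
  · have hq : (ω (1, 1) (0, 0)).re = (ω (0, 0) (1, 1)).re := by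
      rw [← hω.1.1.apply (1, 1) (0, 0)]
      simp
    refine (if_pos rfl).trans ?_
    simp only [maxOverlap, Fin.sum_univ_two, Complex.add_re, hq]
    change ((ω (0, 0) (0, 0)).re + (ω (1, 1) (1, 1)).re) / 2 + (ω (0, 0) (1, 1)).re = _
    ring

/-- The code acts on 64q copies of ω, hence 64qN copies of ρ, and outputs dimension at least
2^(32q): the rate is at least 1/(2N) for every q, while the error tends to zero as q grows. -/
theorem hasDistillableEntanglement_of_converts {ρ : Matrix (A × B) (A × B) ℂ}
    (hρ : IsDensityMatrix ρ) {N : ℕ} (hN : 0 < N) {ω : Matrix (Fin 2 × Fin 2) (Fin 2 × Fin 2) ℂ}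
    (hc : Converts (tensorPower ρ N) ω) (h : 2 * (1 - (1 / 2) ^ 200) < maxOverlap ω) :
    HasDistillableEntanglement ρ := by
  obtain ⟨P, hP, hsum, hP0, hcP⟩ :=
    exists_converts_bellMixture (hc.isDensityMatrix (tensorPower_isDensityMatrix hρ N))
  refine ⟨1 / (2 * N), by positivity, fun ε hε => ?_⟩
  obtain ⟨q, hq0, hqε⟩ : ∃ q : ℕ, 0 < q ∧ (1 / 2 : ℝ) ^ q ≤ ε := by
    obtain ⟨q, hq⟩ := exists_pow_lt_of_lt_one hε (by norm_num : (1 / 2 : ℝ) < 1)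
    exact ⟨q + 1, Nat.succ_pos q,
      (pow_le_pow_of_le_one (by norm_num) (by norm_num) (Nat.le_succ q)).trans hq.le⟩
  -- The exponent 200 leaves infidelity 2^(64q) · 2^(-200q) = 2^(-136q), small enough to beat the
  -- factor d² ≤ 2^(128q) lost in passing to the trace norm.
  obtain ⟨d, hd, hd', L, hL⟩ := exists_protocol_bellMixture hP hsum (δ := (1 / 2) ^ 200)
    (by positivity) (by norm_num) (by rw [hP0]; linarith) hq0
  obtain ⟨L', hL'⟩ := ((hc.trans hcP).tensorPower_mul (64 * q)).trans ⟨L, rfl⟩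
  set τ := L.run (tensorPower (bellMixture P) (64 * q)) with hτ
  have hτd : IsDensityMatrix τ := hL' ▸ Converts.isDensityMatrix ⟨L', rfl⟩
    (tensorPower_isDensityMatrix hρ _)
  have hd0 : 0 < d := lt_of_lt_of_le (by positivity) hd
  have hd0' : (0 : ℝ) < d := by exact_mod_cast hd0
  have hn : 0 < 64 * q * N := Nat.mul_pos (Nat.mul_pos (by norm_num) hq0) hN
  refine ⟨64 * q * N, d, hn, hd0, L', maximallyEntangledVector d,
    isMaximallyEntangled_maximallyEntangledVector d, ?_, ?_⟩
  · rw [hL', traceDistance]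
    have h1 := traceNorm_sub_maximallyEntangled_sq_le hd0 hτd
    have h2 : 1 - 2 ^ (64 * q) * ((1 / 2 : ℝ) ^ 200) ^ q ≤ maxOverlap τ / d := by
      rw [le_div_iff₀ hd0', mul_comm]
      exact hL
    have h3 : (d : ℝ) ^ 2 ≤ (2 ^ 128) ^ q := by
      have : (d : ℝ) ≤ 2 ^ (64 * q) := by exact_mod_cast hd'
      calc (d : ℝ) ^ 2 ≤ (2 ^ (64 * q)) ^ 2 := by gcongr
        _ = (2 ^ 128) ^ q := by
          rw [← pow_mul, ← pow_mul]
          congr 1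
          ring
    have h4 : (2 : ℝ) ^ (64 * q) * ((1 / 2 : ℝ) ^ 200) ^ q = ((1 / 2) ^ 136) ^ q := by
      rw [pow_mul, ← mul_pow]
      norm_num
    have h5 : traceNorm (τ - ketBra (maximallyEntangledVector d)) ^ 2 ≤ (2 * (1 / 2) ^ q) ^ 2 := by
      calc _ ≤ (d : ℝ) ^ 2 * (2 - 2 * (maxOverlap τ / d)) := h1
        _ ≤ (d : ℝ) ^ 2 * (2 * ((1 / 2) ^ 136) ^ q) := by
          gcongr
          linarith
        _ ≤ (2 ^ 128) ^ q * (2 * ((1 / 2) ^ 136) ^ q) := by gcongr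
        _ = 2 * ((1 / 2) ^ 8) ^ q := by
          rw [mul_left_comm, ← mul_pow]
          norm_num
        _ ≤ 4 * ((1 / 2) ^ 2) ^ q := by
          exact mul_le_mul (by norm_num) (pow_le_pow_left₀ (by norm_num) (by norm_num) q)
            (by positivity) (by norm_num)
        _ = (2 * (1 / 2) ^ q) ^ 2 := by
          rw [mul_pow, ← pow_mul, ← pow_mul, mul_comm 2 q]
          norm_num
    have h6 := pow_le_pow_iff_left₀ (traceNorm_nonneg _) (by positivity) two_ne_zero |>.mp h5
    linarith
  · have h1 : (32 * q : ℝ) ≤ Real.logb 2 d := by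
      rw [Real.le_logb_iff_rpow_le (by norm_num) hd0']
      have : ((2 : ℝ) ^ (32 * q) : ℝ) ≤ d := by exact_mod_cast hd
      rw [← Real.rpow_natCast] at this
      exact_mod_cast this
    have h2 : (1 : ℝ) / (2 * N) ≤ Real.logb 2 d / (64 * q * N : ℕ) := by
      rw [div_le_div_iff₀ (by positivity) (by positivity)]
      push_cast
      have : (0 : ℝ) ≤ N := by positivity
      nlinarith
    linarith

/-- A state is distillable as soon as some local filter on finitely many copies yields a two-qubit
operator of fidelity more than one half. -/
theorem hasDistillableEntanglement_of_lt_maxOverlap {ρ : Matrix (A × B) (A × B) ℂ}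
    (hρ : IsDensityMatrix ρ) {k : ℕ} (hk : 0 < k) (K : Matrix (Fin 2) (Fin k → A) ℂ)
    (L : Matrix (Fin 2) (Fin k → B) ℂ) (h : (localFilter K L (tensorPower ρ k)).trace.re <
      maxOverlap (localFilter K L (tensorPower ρ k))) : HasDistillableEntanglement ρ := by
  obtain ⟨m, ω, hm, hc, hω⟩ := exists_converts_of_lt_maxOverlap_localFilter
    (tensorPower_isDensityMatrix hρ k) K L (f := 1) (by rwa [one_mul])
  have hc' : Converts (tensorPower ρ (m * k)) ω :=
    ((Converts.refl (tensorPower ρ k)).tensorPower_mul m).trans hc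
  obtain ⟨m', ω', hm', hc'', hω'⟩ := exists_converts_overlap_near_two
    (hc'.isDensityMatrix (tensorPower_isDensityMatrix hρ _)) hω (δ := (1 / 2) ^ 200)
    (by positivity) (by norm_num)
  exact hasDistillableEntanglement_of_converts hρ (by positivity)
    ((hc'.tensorPower_mul m').trans hc'') hω'

end Distillation

/-! ### Projections of rank two -/

section RowFilter

variable {A B X : Type} [Fintype A] [DecidableEq A] [Fintype B] [DecidableEq B] [Fintype X]
  [DecidableEq X]

/-- The filter `∑ₛ |s⟩⟨αₛ|`. -/
def rowFilter (α : Fin 2 → X → ℂ) : Matrix (Fin 2) X ℂ := Matrix.of fun s x => star (α s x)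

theorem conjTranspose_mul_rowFilter (α : Fin 2 → X → ℂ) :
    (rowFilter α).conjTranspose * rowFilter α = ketBra (α 0) + ketBra (α 1) := by
  ext x y
  simp [Matrix.mul_apply, rowFilter, ketBra_apply, Fin.sum_univ_two]

theorem rowFilter_mul_conjTranspose {α : Fin 2 → EuclideanSpace ℂ X} (hα : Orthonormal ℂ α) :
    rowFilter (fun s => α s) * (rowFilter fun s => α s).conjTranspose = 1 := by
  ext s t
  have h := orthonormal_iff_ite.mp hα s t
  rw [PiLp.inner_apply] at h
  rw [Matrix.one_apply, ← h]
  simp [Matrix.mul_apply, rowFilter, mul_comm]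

theorem projected_eq_localFilter (α : Fin 2 → A → ℂ) (β : Fin 2 → B → ℂ)
    (M : Matrix (A × B) (A × B) ℂ) :
    ((ketBra (α 0) + ketBra (α 1)) ⊗ₖ (ketBra (β 0) + ketBra (β 1))) * M *
        ((ketBra (α 0) + ketBra (α 1)) ⊗ₖ (ketBra (β 0) + ketBra (β 1))) =
      localFilter ((rowFilter α).conjTranspose * rowFilter α)
        ((rowFilter β).conjTranspose * rowFilter β) M := by
  rw [localFilter, Matrix.conjTranspose_kronecker, Matrix.conjTranspose_mul,
    Matrix.conjTranspose_mul, Matrix.conjTranspose_conjTranspose, Matrix.conjTranspose_conjTranspose,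
    conjTranspose_mul_rowFilter, conjTranspose_mul_rowFilter]

/-- With P_A = F†F, the projected operator is the image under F† of a two-qubit operator. If ρ were
not distillable, no filter would raise the overlap of the latter above its trace, so it would be
separable, and so would its image. -/
theorem hasDistillableEntanglement_of_isEntangled {ρ : Matrix (A × B) (A × B) ℂ}
    (hρ : IsDensityMatrix ρ) {k : ℕ} (hk : 0 < k) (α : Fin 2 → (Fin k → A) → ℂ)
    (β : Fin 2 → (Fin k → B) → ℂ)
    (h : IsEntangled (((ketBra (α 0) + ketBra (α 1)) ⊗ₖ (ketBra (β 0) + ketBra (β 1))) *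
      tensorPower ρ k * ((ketBra (α 0) + ketBra (α 1)) ⊗ₖ (ketBra (β 0) + ketBra (β 1))))) :
    HasDistillableEntanglement ρ := by
  by_contra hcon
  refine h.2 ?_
  rw [projected_eq_localFilter, ← localFilter_localFilter]
  refine IsSeparableOperator.localFilter ?_ _ _
  refine isSeparableOperator_of_forall_maxOverlap_le ((hρ.1.tensorPower k).localFilter _ _) ?_
  intro K L
  rw [localFilter_localFilter]
  by_contra! hlt
  exact hcon (hasDistillableEntanglement_of_lt_maxOverlap hρ hk _ _ hlt)

/-- Zero copies span a one-dimensional space, so orthonormality of α₀, α₁ forces at least one copy.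
-/
theorem not_orthonormal_of_power_zero {α : Fin 2 → EuclideanSpace ℂ (Fin 0 → A)} :
    ¬ Orthonormal ℂ α := by
  intro h
  have := h.linearIndependent.fintype_card_le_finrank
  simp at this

/-- The filter does not see the projection, since F F† = 1 gives (K F)(F†F) = K F; a separable
projected operator would have too small an overlap after it. -/
theorem isEntangled_of_lt_maxOverlap {M : Matrix (A × B) (A × B) ℂ} (hM : M.PosSemidef)
    {α : Fin 2 → EuclideanSpace ℂ A} {β : Fin 2 → EuclideanSpace ℂ B} (hα : Orthonormal ℂ α)
    (hβ : Orthonormal ℂ β) (K L : Matrix (Fin 2) (Fin 2) ℂ)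
    (h : (localFilter (K * rowFilter fun s => α s) (L * rowFilter fun s => β s) M).trace.re <
      maxOverlap (localFilter (K * rowFilter fun s => α s) (L * rowFilter fun s => β s) M)) :
    IsEntangled (((ketBra (α 0) + ketBra (α 1)) ⊗ₖ (ketBra (β 0) + ketBra (β 1))) * M *
      ((ketBra (α 0) + ketBra (α 1)) ⊗ₖ (ketBra (β 0) + ketBra (β 1)))) := by
  have e := projected_eq_localFilter (fun s => α s) (fun s => β s) M
  rw [IsEntangled, e]
  refine ⟨hM.localFilter _ _, fun hsep => h.not_ge ?_⟩
  have h2 := (hsep.localFilter (K * rowFilter fun s => α s) (L * rowFilter fun s => β s)).maxOverlap_le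
  rwa [localFilter_localFilter, Matrix.mul_assoc K, Matrix.mul_assoc L,
    ← Matrix.mul_assoc (rowFilter fun s => α s), ← Matrix.mul_assoc (rowFilter fun s => β s),
    rowFilter_mul_conjTranspose hα, rowFilter_mul_conjTranspose hβ, Matrix.one_mul,
    Matrix.one_mul] at h2

end RowFilter

/-! ### Product bases and disjoint supports -/

section ProductBasis

variable {X : Type} [Fintype X] [DecidableEq X] (b : OrthonormalBasis X ℂ (EuclideanSpace ℂ X))

/-- The unitary matrix whose columns are the basis vectors. -/
noncomputable def basisMatrix : Matrix X X ℂ := Matrix.of fun t x => b x t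

theorem basisMatrix_conjTranspose_mul_self : (basisMatrix b).conjTranspose * basisMatrix b = 1 := by
  ext x y
  have h := orthonormal_iff_ite.mp b.orthonormal x y
  rw [PiLp.inner_apply] at h
  rw [Matrix.one_apply, ← h]
  simp [Matrix.mul_apply, basisMatrix, mul_comm]

theorem basisMatrix_mul_conjTranspose : basisMatrix b * (basisMatrix b).conjTranspose = 1 :=
  mul_eq_one_comm.mp (basisMatrix_conjTranspose_mul_self b)

theorem matPow_one (k : ℕ) : matPow (1 : Matrix X X ℂ) k = 1 := by
  ext x y
  simp [matPow_apply, Matrix.one_apply, Fintype.prod_ite_zero, funext_iff]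

theorem star_dotProduct_productBasis (k : ℕ) (x y : Fin k → X) :
    star (productBasis b k x) ⬝ᵥ productBasis b k y = if x = y then 1 else 0 := by
  have h : (matPow (basisMatrix b) k).conjTranspose * matPow (basisMatrix b) k = 1 := by
    rw [← matPow_conjTranspose, ← matPow_mul, basisMatrix_conjTranspose_mul_self, matPow_one]
  have h' := congrFun (congrFun h x) y
  rw [Matrix.one_apply] at h'
  rw [← h']
  rfl

/-- The two rows have disjoint supports in the basis `𝓑^{⊗k}`. -/
def HasDisjointSupports {k : ℕ} (U : Matrix (Fin 2) (Fin k → X) ℂ) : Prop :=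
  ∀ x, U.mulVec (productBasis b k x) 0 = 0 ∨ U.mulVec (productBasis b k x) 1 = 0

variable {b} {k : ℕ}

/-- The product basis is orthonormal, so row inner products may be computed in its coordinates,
where no term survives. -/
theorem HasDisjointSupports.mul_conjTranspose {U : Matrix (Fin 2) (Fin k → X) ℂ}
    (h : HasDisjointSupports b U) {s t : Fin 2} (hst : s ≠ t) : (U * U.conjTranspose) s t = 0 := by
  set E := matPow (basisMatrix b) k with hE
  have hE1 : E * E.conjTranspose = 1 := by
    rw [hE, ← matPow_conjTranspose, ← matPow_mul, basisMatrix_mul_conjTranspose, matPow_one]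
  have e : U * U.conjTranspose = (U * E) * (U * E).conjTranspose := by
    rw [Matrix.conjTranspose_mul, Matrix.mul_assoc U, ← Matrix.mul_assoc E, hE1, Matrix.one_mul]
  have h' : ∀ x, (U * E) s x = 0 ∨ (U * E) t x = 0 := by
    intro x
    have := h x
    fin_cases s <;> fin_cases t
    · exact absurd rfl hst
    · exact this
    · exact this.symm
    · exact absurd rfl hst
  rw [e, Matrix.mul_apply]
  refine Finset.sum_eq_zero fun x _ => ?_
  rw [Matrix.conjTranspose_apply]
  rcases h' x with h1 | h1 <;> simp [h1]

theorem dephase_ketBra (v : (Fin k → X) → ℂ) : dephase b k (ketBra v) =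
    ∑ x, (star (productBasis b k x) ⬝ᵥ v * (star v ⬝ᵥ productBasis b k x)) •
      ketBra (productBasis b k x) := by
  refine Finset.sum_congr rfl fun x _ => ?_
  simp only [ketBra, Matrix.vecMulVec_mul_vecMulVec, Matrix.vecMulVec_smul, Matrix.smul_mul,
    smul_smul]

/-- Terms with different basis vectors vanish by orthogonality, terms with equal ones by
disjointness. -/
theorem trace_dephase_mul_dephase_eq_zero {v w : (Fin k → X) → ℂ}
    (h : ∀ x, star (productBasis b k x) ⬝ᵥ v = 0 ∨ star (productBasis b k x) ⬝ᵥ w = 0) :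
    (dephase b k (ketBra v) * dephase b k (ketBra w)).trace = 0 := by
  rw [dephase_ketBra, dephase_ketBra, Finset.sum_mul_sum]
  have h0 : ∀ x y, (star (productBasis b k x) ⬝ᵥ v * (star v ⬝ᵥ productBasis b k x)) •
      ketBra (productBasis b k x) * (star (productBasis b k y) ⬝ᵥ w *
        (star w ⬝ᵥ productBasis b k y)) • ketBra (productBasis b k y) = 0 := by
    intro x y
    by_cases hxy : x = y
    · subst hxy
      rcases h x with h | h <;> simp [h]
    · rw [Matrix.smul_mul, Matrix.mul_smul, ketBra, ketBra, Matrix.vecMulVec_mul_vecMulVec,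
        star_dotProduct_productBasis, if_neg hxy]
      simp
  simp [h0]

end ProductBasis

/-! ### Filters with disjoint supports -/

section Swap

variable {A B A' B' : Type} [Fintype A] [Fintype B] [Fintype A'] [Fintype B']

theorem localFilter_swap (K : Matrix A' A ℂ) (L : Matrix B' B ℂ) (M : Matrix (A × B) (A × B) ℂ) :
    localFilter L K (M.submatrix Prod.swap Prod.swap) =
      (localFilter K L M).submatrix Prod.swap Prod.swap := by
  ext x y
  rw [Matrix.submatrix_apply, localFilter_apply, localFilter_apply,
    ← Equiv.sum_comp (Equiv.prodComm A B)]
  refine Finset.sum_congr rfl fun q _ => ?_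
  rw [← Equiv.sum_comp (Equiv.prodComm A B)]
  simp [mul_comm]

theorem tensorPower_swap (M : Matrix (A × B) (A × B) ℂ) (n : ℕ) :
    tensorPower (M.submatrix Prod.swap Prod.swap) n =
      (tensorPower M n).submatrix Prod.swap Prod.swap := rfl

theorem IsSeparableOperator.swap {M : Matrix (A × B) (A × B) ℂ} (h : IsSeparableOperator M) :
    IsSeparableOperator (M.submatrix Prod.swap Prod.swap) := by
  obtain ⟨s, a, b, ha, hb, rfl⟩ := h
  refine ⟨s, b, a, hb, ha, ?_⟩
  ext x y
  simp [Matrix.sum_apply, mul_comm]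

end Swap

/-! ### Compressions by a vector of Bob, and their coherences in Alice's basis. -/

section Compression

variable {A B : Type} [Fintype A] [DecidableEq A] [Fintype B] [DecidableEq B]

/-- The compression `⟨v| M |v⟩` of a bipartite operator by a vector of Bob. -/
def compression (M : Matrix (A × B) (A × B) ℂ) (v : B → ℂ) : Matrix A A ℂ :=
  Matrix.of fun x x' => ∑ y', ∑ y, star (v y) * M (x, y) (x', y') * v y'

/-- When all rows of Bob's filter equal ⟨v|, the output does not depend on his indices; extra copies
can thus serve Alice alone. -/
theorem localFilter_compression {A' C : Type} [Fintype A'] [Fintype C] (K : Matrix A' A ℂ)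
    (M : Matrix (A × B) (A × B) ℂ) (v : B → ℂ) (s s' : A') (t t' : C) :
    localFilter K (Matrix.of fun (_ : C) y => star (v y)) M (s, t) (s', t') =
      (K * compression M v * K.conjTranspose) s s' := by
  rw [localFilter_apply, Matrix.mul_apply, Fintype.sum_prod_type]
  refine Finset.sum_congr rfl fun x' _ => ?_
  simp only [Matrix.mul_apply, compression, Matrix.of_apply, Fintype.sum_prod_type, Finset.sum_mul,
    Finset.mul_sum, Matrix.conjTranspose_apply, star_mul', star_star]
  rw [Finset.sum_comm]
  refine Finset.sum_congr rfl fun x _ => Finset.sum_congr rfl fun y' _ =>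
    Finset.sum_congr rfl fun y _ => ?_
  ring

theorem Matrix.PosSemidef.compression {M : Matrix (A × B) (A × B) ℂ} (hM : M.PosSemidef)
    (v : B → ℂ) : (compression M v).PosSemidef := by
  have h : _root_.compression M v = (_root_.localFilter (1 : Matrix A A ℂ)
      (Matrix.of fun (_ : Unit) y => star (v y)) M).submatrix (fun x => (x, ())) fun x => (x, ()) := by
    ext x x'
    rw [Matrix.submatrix_apply, localFilter_compression]
    simp
  rw [h]
  exact (hM.localFilter _ _).submatrix _

theorem matPow_compression (M : Matrix (A × B) (A × B) ℂ) (v : B → ℂ) (m : ℕ) :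
    matPow (compression M v) m = compression (tensorPower M m) fun y => ∏ i, v (y i) := by
  ext x x'
  simp only [matPow_apply, compression, Matrix.of_apply, tensorPower, Fintype.prod_sum,
    Finset.prod_mul_distrib, star_prod]

/-- A matrix whose quadratic form vanishes is zero. -/
theorem eq_zero_of_forall_quadratic_eq_zero {R : Matrix B B ℂ}
    (h : ∀ v : B → ℂ, ∑ y', ∑ y, star (v y) * R y y' * v y' = 0) : R = 0 := by
  have h0 : ∀ v : B → ℂ, star v ⬝ᵥ R.mulVec v = 0 := by
    intro v
    rw [← h v, Finset.sum_comm]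
    simp only [dotProduct, Matrix.mulVec, Pi.star_apply, Finset.mul_sum, mul_assoc]
  have hd : ∀ y, R y y = 0 := by
    intro y
    have := h0 (Pi.single y 1)
    simpa [← Pi.single_star] using this
  ext y y'
  have h1 := h0 (Pi.single y 1 + Pi.single y' 1)
  have h2 := h0 (Pi.single y 1 + Pi.single y' Complex.I)
  simp only [star_add, Matrix.mulVec_add, add_dotProduct, dotProduct_add, Matrix.mulVec_single,
    ← Pi.single_star, single_dotProduct] at h1 h2
  simp [hd] at h1 h2
  have h3 : R y y' * Complex.I - R y' y * Complex.I = 0 := by linear_combination h2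
  have h4 : (R y y' - R y' y) * Complex.I = 0 := by linear_combination h3
  have h5 : R y y' - R y' y = 0 := (mul_eq_zero.mp h4).resolve_right Complex.I_ne_zero
  have h6 : 2 * R y y' = 0 := by linear_combination h1 + h5
  simpa using h6

/-- An entangled operator has a compression that is not diagonal in a given basis of Alice. -/
theorem exists_compression_ne_zero {M : Matrix (A × B) (A × B) ℂ} (hM : M.PosSemidef)
    (hsep : ¬ IsSeparableOperator M) {U : Matrix A A ℂ} (hU : U * U.conjTranspose = 1) :
    ∃ (v : B → ℂ) (x x' : A), x ≠ x' ∧ (U.conjTranspose * compression M v * U) x x' ≠ 0 := by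
  by_contra! hcon
  apply hsep
  set N := localFilter U.conjTranspose (1 : Matrix B B ℂ) M with hN
  have hNp : N.PosSemidef := hM.localFilter _ _
  have hMN : M = localFilter U (1 : Matrix B B ℂ) N := by
    rw [hN, localFilter_localFilter, hU, Matrix.one_mul, localFilter_one]
  have hcomp : ∀ v, compression N v = U.conjTranspose * compression M v * U := by
    intro v
    ext x x'
    have h1 := localFilter_compression (1 : Matrix A A ℂ) N v x x' () ()
    rw [Matrix.one_mul, Matrix.conjTranspose_one, Matrix.mul_one] at h1
    rw [← h1, hN, localFilter_localFilter, Matrix.one_mul, Matrix.mul_one, localFilter_compression,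
      Matrix.conjTranspose_conjTranspose]
  -- If all compressions are diagonal, polarization in v makes the off-diagonal blocks vanish; a
  -- block diagonal operator is separable.
  have hoff : ∀ x x', x ≠ x' → ∀ y y', N (x, y) (x', y') = 0 := by
    intro x x' hx y y'
    have := eq_zero_of_forall_quadratic_eq_zero (R := Matrix.of fun y y' => N (x, y) (x', y'))
      fun v => by
        have := hcon v x x' hx
        rwa [← hcomp v] at this
    exact congrFun (congrFun this y) y'
  rw [hMN]
  refine IsSeparableOperator.localFilter ?_ _ _
  have hsum : N = ∑ x, Matrix.single x x (1 : ℂ) ⊗ₖ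
      (Matrix.of fun y y' => N (x, y) (x, y') : Matrix B B ℂ) := by
    ext ⟨x, y⟩ ⟨x', y'⟩
    rw [Matrix.sum_apply, Finset.sum_eq_single x]
    · by_cases hx : x = x'
      · subst hx
        simp
      · simp [hx, hoff x x' hx]
    · intro z _ hz
      simp [hz]
    · simp
  rw [hsum]
  refine isSeparableOperator_sum (fun x => ?_) fun x => hNp.submatrix fun y => (x, y)
  have : Matrix.single x x (1 : ℂ) = ketBra (Pi.single x 1) := by
    rw [ketBra, ← Pi.single_star, star_one, Matrix.single_eq_single_vecMulVec_single]
  rw [this]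
  exact ketBra_posSemidef _

end Compression

/-! ### Rows with disjoint supports from a coherent state. -/

section DisjointRows

variable {X : Type} [Fintype X] [DecidableEq X]

/-- The filter `|0⟩(⟨0⋯0| + ⟨1⋯1|) + |1⟩(⟨0⋯0| - ⟨1⋯1|)`. -/
def parityFilter (m : ℕ) : Matrix (Fin 2) (Fin m → Fin 2) ℂ :=
  Matrix.of fun s f => (if f = fun _ => 0 then 1 else 0) + ![1, -1] s * if f = fun _ => 1 then 1 else 0

theorem parityFilter_mul_apply {Y : Type} (m : ℕ) (N : Matrix (Fin m → Fin 2) Y ℂ) (s : Fin 2) (y : Y) :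
    (parityFilter m * N) s y = N (fun _ => 0) y + ![1, -1] s * N (fun _ => 1) y := by
  simp [Matrix.mul_apply, parityFilter, add_mul, Finset.sum_add_distrib]

theorem mul_parityFilter_conjTranspose_apply {Y : Type} (m : ℕ) (N : Matrix Y (Fin m → Fin 2) ℂ)
    (s : Fin 2) (y : Y) : (N * (parityFilter m).conjTranspose) y s =
      N y (fun _ => 0) + ![1, -1] s * N y (fun _ => 1) := by
  have h := congrArg star (parityFilter_mul_apply m N.conjTranspose s y)
  rw [← Matrix.conjTranspose_apply, Matrix.conjTranspose_mul, Matrix.conjTranspose_conjTranspose] at h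
  rw [h]
  fin_cases s <;> simp

/-- The rows `⟨x| + w⟨x'|` and `⟨x| - w⟨x'|`. -/
def pairFilter (x x' : X) (w : ℂ) : Matrix (Fin 2) X ℂ :=
  Matrix.of fun s z => (if z = x then 1 else 0) + ![1, -1] s * (w * if z = x' then 1 else 0)

theorem pairFilter_conj_apply (x x' : X) (w : ℂ) (N : Matrix X X ℂ) (s s' : Fin 2) :
    (pairFilter x x' w * N * (pairFilter x x' w).conjTranspose) s s' =
      N x x + ![1, -1] s' * (star w * N x x') + ![1, -1] s * (w * N x' x) +
        ![1, -1] s * ![1, -1] s' * (w * star w * N x' x') := by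
  have h1 : ∀ y, (pairFilter x x' w * N) s y = N x y + ![1, -1] s * (w * N x' y) := by
    intro y
    simp [Matrix.mul_apply, pairFilter, add_mul, Finset.sum_add_distrib, mul_assoc]
  have h2 : ∀ y, star (pairFilter x x' w s' y) = (if y = x then 1 else 0) +
      ![1, -1] s' * (star w * if y = x' then 1 else 0) := by
    intro y
    rw [pairFilter, Matrix.of_apply]
    fin_cases s' <;> simp [apply_ite (starRingEnd ℂ)]
  simp only [Matrix.mul_apply (M := pairFilter x x' w * N), Matrix.conjTranspose_apply, h1, h2]
  simp only [mul_add, Finset.sum_add_distrib, mul_ite, mul_one, mul_zero, Finset.sum_ite_eq',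
    Finset.mem_univ, if_true]
  ring

/-- The two rows differ only by a sign at x', so at every basis string either the sum or the
difference of their tensor powers vanishes. -/
theorem prod_pairFilter {x x' : X} (h : x ≠ x') (w : ℂ) {m : ℕ} (z : Fin m → X) :
    ∏ i, pairFilter x x' w 1 (z i) = ∏ i, pairFilter x x' w 0 (z i) ∨
      ∏ i, pairFilter x x' w 1 (z i) = -∏ i, pairFilter x x' w 0 (z i) := by
  have h1 : ∀ y, pairFilter x x' w 1 y = (if y = x' then -1 else 1) * pairFilter x x' w 0 y := by
    intro y
    by_cases hy : y = x'
    · subst hy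
      simp [pairFilter, h.symm]
    · simp [pairFilter, hy]
  have h2 : (∏ i, if z i = x' then (-1 : ℂ) else 1) * ∏ i, (if z i = x' then (-1 : ℂ) else 1) = 1 := by
    rw [← Finset.prod_mul_distrib]
    exact Finset.prod_eq_one fun i _ => by split_ifs <;> norm_num
  simp only [h1, Finset.prod_mul_distrib]
  rcases mul_self_eq_one_iff.mp h2 with h3 | h3 <;> simp [h3]

/-- With φ± = ⟨x| ± w⟨x'|, the rows are φ₊^{⊗m} + φ₋^{⊗m} and φ₊^{⊗m} - φ₋^{⊗m}. The nonzero
coherence makes φ₊τφ₊† strictly larger than the other entries of the 2 × 2 matrix T, so its m-th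
power dominates all four entries of the output. -/
theorem exists_disjoint_rows (b : OrthonormalBasis X ℂ (EuclideanSpace ℂ X)) {τ : Matrix X X ℂ}
    (hτ : τ.PosSemidef) {x x' : X} (hne : x ≠ x')
    (h : ((basisMatrix b).conjTranspose * τ * basisMatrix b) x x' ≠ 0) :
    ∃ (p : ℝ) (Γ : ∀ m, Matrix (Fin 2) (Fin m → X) ℂ), 0 < p ∧
      (∀ m, HasDisjointSupports b (Γ m)) ∧ ∀ s s', Filter.Tendsto (fun m => ((p ^ m)⁻¹ : ℂ) *
        (Γ m * matPow τ m * (Γ m).conjTranspose) s s') Filter.atTop (nhds 1) := by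
  set N := (basisMatrix b).conjTranspose * τ * basisMatrix b with hN
  have hNp : N.PosSemidef := hτ.conjTranspose_mul_mul_same _
  set r := ‖N x x'‖ with hr
  have hr0 : 0 < r := norm_pos_iff.mpr h
  have hrc : (r : ℂ) ≠ 0 := by exact_mod_cast hr0.ne'
  -- This phase makes the coherence between ⟨x| and w⟨x'| equal to r > 0.
  set w : ℂ := N x x' / r with hw
  have hsq : N x x' * star (N x x') = (r : ℂ) * r := by
    rw [Complex.star_def, Complex.mul_conj, Complex.normSq_eq_norm_sq, ← hr]
    push_cast
    ring
  have hw1 : star w * N x x' = r := by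
    have hrs : star (r : ℂ) = r := Complex.conj_ofReal r
    rw [hw, star_div₀, hrs, div_mul_eq_mul_div,
      div_eq_iff hrc, mul_comm, hsq]
  have hw2 : w * N x' x = r := by
    rw [← hNp.1.apply x' x, hw, div_mul_eq_mul_div, div_eq_iff hrc, hsq]
  have hw3 : w * star w = 1 := by
    have : star w = r / N x x' := by rw [eq_div_iff h, hw1]
    rw [this, hw]
    field_simp
  obtain ⟨a, ha⟩ : ∃ a : ℝ, N x x = a := ⟨(N x x).re, (hNp.1.coe_re_apply_self x).symm⟩
  obtain ⟨c, hc⟩ : ∃ c : ℝ, N x' x' = c := ⟨(N x' x').re, (hNp.1.coe_re_apply_self x').symm⟩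
  have ha0 : 0 ≤ a := by
    have := hNp.diag_nonneg (i := x)
    rw [ha] at this
    exact_mod_cast this
  have hc0 : 0 ≤ c := by
    have := hNp.diag_nonneg (i := x')
    rw [hc] at this
    exact_mod_cast this
  set T := pairFilter x x' w * N * (pairFilter x x' w).conjTranspose with hT
  have hTp : T.PosSemidef := hNp.mul_mul_conjTranspose_same _
  have hT' : ∀ s s', T s s' = a + ![1, -1] s' * r + ![1, -1] s * r + ![1, -1] s * ![1, -1] s' * c := by
    intro s s'
    rw [hT, pairFilter_conj_apply, hw1, hw2, hw3, ha, hc, one_mul]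
  have h00 : T 0 0 = ((a + c + 2 * r : ℝ) : ℂ) := by
    rw [hT']
    push_cast
    simp
    ring
  have h01 : T 0 1 = ((a - c : ℝ) : ℂ) := by
    rw [hT']
    push_cast
    simp
    ring
  have h10 : T 1 0 = ((a - c : ℝ) : ℂ) := by
    rw [hT']
    push_cast
    simp
    ring
  have h11 : T 1 1 = ((a + c - 2 * r : ℝ) : ℂ) := by
    rw [hT']
    push_cast
    simp
    ring
  have h11n : 0 ≤ a + c - 2 * r := by
    have := hTp.diag_nonneg (i := (1 : Fin 2))
    rw [h11] at this
    exact_mod_cast this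
  set p : ℝ := a + c + 2 * r with hp
  have hp0 : 0 < p := by linarith
  set Φ := pairFilter x x' w * (basisMatrix b).conjTranspose with hΦ
  have hΦT : Φ * τ * Φ.conjTranspose = T := by
    rw [hΦ, hT, hN, Matrix.conjTranspose_mul, Matrix.conjTranspose_conjTranspose]
    simp only [Matrix.mul_assoc]
  refine ⟨p, fun m => parityFilter m * matPow Φ m, hp0, fun m z => ?_, fun s s' => ?_⟩
  · have h1 : ∀ s, (parityFilter m * matPow Φ m).mulVec (productBasis b m z) s =
        ∏ i, pairFilter x x' w 0 (z i) + ![1, -1] s * ∏ i, pairFilter x x' w 1 (z i) := by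
      intro s
      have e : (parityFilter m * matPow Φ m).mulVec (productBasis b m z) s =
          (parityFilter m * matPow Φ m * matPow (basisMatrix b) m) s z := rfl
      rw [e, Matrix.mul_assoc, ← matPow_mul, hΦ, Matrix.mul_assoc,
        basisMatrix_conjTranspose_mul_self, Matrix.mul_one, parityFilter_mul_apply]
      rfl
    rw [h1, h1]
    rcases prod_pairFilter hne w z with h2 | h2
    · right
      simp [h2]
    · left
      simp [h2]
  · have h1 : ∀ m, (parityFilter m * matPow Φ m * matPow τ m *
        (parityFilter m * matPow Φ m).conjTranspose) s s' =
        T 0 0 ^ m + ![1, -1] s' * T 0 1 ^ m + ![1, -1] s * T 1 0 ^ m +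
          ![1, -1] s * ![1, -1] s' * T 1 1 ^ m := by
      intro m
      have e : parityFilter m * matPow Φ m * matPow τ m *
          (parityFilter m * matPow Φ m).conjTranspose =
          parityFilter m * matPow T m * (parityFilter m).conjTranspose := by
        have e' : matPow T m = matPow Φ m * matPow τ m * (matPow Φ m).conjTranspose := by
          rw [← matPow_conjTranspose, ← matPow_mul, ← matPow_mul, hΦT]
        rw [e', Matrix.conjTranspose_mul]
        simp only [Matrix.mul_assoc]
      rw [e, mul_parityFilter_conjTranspose_apply, parityFilter_mul_apply, parityFilter_mul_apply]
      simp only [matPow_apply, Finset.prod_const, Finset.card_univ, Fintype.card_fin]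
      ring
    have hlim : ∀ t : ℝ, |t| < p → Filter.Tendsto (fun m : ℕ => ((t : ℂ) / p) ^ m) Filter.atTop
        (nhds 0) := by
      intro t ht
      refine tendsto_pow_atTop_nhds_zero_of_norm_lt_one ?_
      rw [← Complex.ofReal_div, Complex.norm_real, Real.norm_eq_abs, abs_div, abs_of_pos hp0,
        div_lt_one hp0]
      exact ht
    have l1 := hlim (a - c) (abs_lt.mpr ⟨by linarith, by linarith⟩)
    have l2 := hlim (a + c - 2 * r) (abs_lt.mpr ⟨by linarith, by linarith⟩)
    have l3 := (((tendsto_const_nhds (x := (1 : ℂ))).add (l1.const_mul (![1, -1] s' : ℂ))).add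
      (l1.const_mul (![1, -1] s : ℂ))).add (l2.const_mul (![1, -1] s * ![1, -1] s' : ℂ))
    simp only [mul_zero, add_zero] at l3
    refine l3.congr fun m => ?_
    rw [h1, h00, h01, h10, h11]
    have hpc : (p : ℂ) ≠ 0 := by exact_mod_cast hp0.ne'
    simp only [div_pow]
    field_simp

end DisjointRows

/-! ### Adding copies without losing the entangling property. -/

section RowProduct

variable {X A B : Type} [Fintype X] [DecidableEq X] [Fintype A] [DecidableEq A] [Fintype B]
  [DecidableEq B] {n m : ℕ}

/-- The filter whose rows are the tensor products of the corresponding rows of `U` and `Γ`. -/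
def rowProduct (U : Matrix (Fin 2) (Fin n → X) ℂ) (Γ : Matrix (Fin 2) (Fin m → X) ℂ) :
    Matrix (Fin 2) (Fin (n + m) → X) ℂ :=
  Matrix.of fun s x => U s (fun i => x (Fin.castAdd m i)) * Γ s fun i => x (Fin.natAdd n i)

theorem rowProduct_append (U : Matrix (Fin 2) (Fin n → X) ℂ) (Γ : Matrix (Fin 2) (Fin m → X) ℂ)
    (s : Fin 2) (x : Fin n → X) (y : Fin m → X) :
    rowProduct U Γ s (Fin.append x y) = U s x * Γ s y := by
  simp [rowProduct]

theorem tensorPower_append (ρ : Matrix (A × B) (A × B) ℂ) (x x' : Fin n → A) (y y' : Fin m → A)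
    (z z' : Fin n → B) (w w' : Fin m → B) :
    tensorPower ρ (n + m) (Fin.append x y, Fin.append z w) (Fin.append x' y', Fin.append z' w') =
      tensorPower ρ n (x, z) (x', z') * tensorPower ρ m (y, w) (y', w') := by
  simp [tensorPower, Fin.prod_univ_add]

/-- Tensoring rows with equal labels multiplies the outputs entrywise, with the all-ones matrix as
neutral element. -/
theorem localFilter_rowProduct (ρ : Matrix (A × B) (A × B) ℂ) (U : Matrix (Fin 2) (Fin n → A) ℂ)
    (V : Matrix (Fin 2) (Fin n → B) ℂ) (Γ : Matrix (Fin 2) (Fin m → A) ℂ)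
    (Δ : Matrix (Fin 2) (Fin m → B) ℂ) (p q : Fin 2 × Fin 2) :
    localFilter (rowProduct U Γ) (rowProduct V Δ) (tensorPower ρ (n + m)) p q =
      localFilter U V (tensorPower ρ n) p q * localFilter Γ Δ (tensorPower ρ m) p q := by
  let e : ((Fin n → A) × (Fin n → B)) × ((Fin m → A) × (Fin m → B)) ≃
      (Fin (n + m) → A) × (Fin (n + m) → B) :=
    (Equiv.prodProdProdComm _ _ _ _).trans
      (Equiv.prodCongr (Fin.appendEquiv n m) (Fin.appendEquiv n m))
  have he : ∀ x, e x = (Fin.append x.1.1 x.2.1, Fin.append x.1.2 x.2.2) := fun _ => rfl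
  rw [localFilter_apply, localFilter_apply, localFilter_apply, Finset.sum_mul_sum,
    ← Equiv.sum_comp e, Fintype.sum_prod_type]
  refine Finset.sum_congr rfl fun a _ => Finset.sum_congr rfl fun c _ => ?_
  rw [← Equiv.sum_comp e, Fintype.sum_prod_type]
  simp only [he, rowProduct_append, tensorPower_append, star_mul']
  rw [show ∀ S T u v w z : ℂ, S * (u * v) * (T * (w * z)) = S * T * (u * w * (v * z)) by
    intros; ring]
  congr 1
  rw [Finset.sum_mul_sum]
  refine Finset.sum_congr rfl fun a' _ => Finset.sum_congr rfl fun c' _ => ?_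
  ring

variable {b : OrthonormalBasis X ℂ (EuclideanSpace ℂ X)}

theorem rowProduct_mulVec_productBasis (U : Matrix (Fin 2) (Fin n → X) ℂ)
    (Γ : Matrix (Fin 2) (Fin m → X) ℂ) (s : Fin 2) (x : Fin (n + m) → X) :
    (rowProduct U Γ).mulVec (productBasis b (n + m) x) s =
      U.mulVec (productBasis b n fun i => x (Fin.castAdd m i)) s *
        Γ.mulVec (productBasis b m fun i => x (Fin.natAdd n i)) s := by
  simp only [Matrix.mulVec, dotProduct]
  rw [Finset.sum_mul_sum, ← Equiv.sum_comp (Fin.appendEquiv n m), Fintype.sum_prod_type]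
  refine Finset.sum_congr rfl fun t _ => Finset.sum_congr rfl fun u _ => ?_
  have h1 : productBasis b (n + m) x (Fin.append t u) =
      productBasis b n (fun i => x (Fin.castAdd m i)) t *
        productBasis b m (fun i => x (Fin.natAdd n i)) u := by
    simp [productBasis, Fin.prod_univ_add]
  change rowProduct U Γ s (Fin.append t u) * productBasis b (n + m) x (Fin.append t u) = _
  rw [h1, rowProduct_append]
  ring

theorem HasDisjointSupports.rowProduct_left {U : Matrix (Fin 2) (Fin n → X) ℂ}
    (h : HasDisjointSupports b U) (Γ : Matrix (Fin 2) (Fin m → X) ℂ) :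
    HasDisjointSupports b (rowProduct U Γ) := by
  intro x
  simp only [rowProduct_mulVec_productBasis]
  exact (h _).imp (fun h => by rw [h, zero_mul]) fun h => by rw [h, zero_mul]

theorem HasDisjointSupports.rowProduct_right {Γ : Matrix (Fin 2) (Fin m → X) ℂ}
    (h : HasDisjointSupports b Γ) (U : Matrix (Fin 2) (Fin n → X) ℂ) :
    HasDisjointSupports b (rowProduct U Γ) := by
  intro x
  simp only [rowProduct_mulVec_productBasis]
  exact (h _).imp (fun h => by rw [h, mul_zero]) fun h => by rw [h, mul_zero]

/-- A pair of filters onto two qubits whose output has fidelity more than one half. -/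
def IsEntanglingFilter (ρ : Matrix (A × B) (A × B) ℂ) (U : Matrix (Fin 2) (Fin n → A) ℂ)
    (V : Matrix (Fin 2) (Fin n → B) ℂ) : Prop :=
  (localFilter U V (tensorPower ρ n)).trace.re < maxOverlap (localFilter U V (tensorPower ρ n))

/-- The rescaled outputs converge entrywise to the old output, and a strict inequality is an open
condition. -/
theorem IsEntanglingFilter.exists_rowProduct {ρ : Matrix (A × B) (A × B) ℂ}
    {U : Matrix (Fin 2) (Fin n → A) ℂ} {V : Matrix (Fin 2) (Fin n → B) ℂ}
    (h : IsEntanglingFilter ρ U V) (Γ : ∀ m, Matrix (Fin 2) (Fin m → A) ℂ)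
    (Δ : ∀ m, Matrix (Fin 2) (Fin m → B) ℂ) {p : ℝ} (hp : 0 < p)
    (hlim : ∀ x y, Filter.Tendsto (fun m => ((p ^ m)⁻¹ : ℂ) *
      localFilter (Γ m) (Δ m) (tensorPower ρ m) x y) Filter.atTop (nhds 1)) :
    ∃ m, IsEntanglingFilter ρ (rowProduct U (Γ m)) (rowProduct V (Δ m)) := by
  set Z := localFilter U V (tensorPower ρ n) with hZ
  let W : ∀ m, Matrix (Fin 2 × Fin 2) (Fin 2 × Fin 2) ℂ := fun m =>
    localFilter (rowProduct U (Γ m)) (rowProduct V (Δ m)) (tensorPower ρ (n + m))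
  have hW : ∀ x y, Filter.Tendsto (fun m => ((((p ^ m)⁻¹ : ℝ) : ℂ) • W m) x y) Filter.atTop
      (nhds (Z x y)) := by
    intro x y
    have := (hlim x y).const_mul (Z x y)
    rw [mul_one] at this
    refine this.congr fun m => ?_
    change _ = (((p ^ m)⁻¹ : ℝ) : ℂ) *
      localFilter (rowProduct U (Γ m)) (rowProduct V (Δ m)) (tensorPower ρ (n + m)) x y
    rw [localFilter_rowProduct, hZ]
    push_cast
    ring
  have h1 : Filter.Tendsto (fun m => maxOverlap ((((p ^ m)⁻¹ : ℝ) : ℂ) • W m)) Filter.atTop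
      (nhds (maxOverlap Z)) :=
    (Complex.continuous_re.tendsto _).comp
      (tendsto_finsetSum _ fun i _ => tendsto_finsetSum _ fun j _ => hW _ _)
  have h2 : Filter.Tendsto (fun m => ((((p ^ m)⁻¹ : ℝ) : ℂ) • W m).trace.re) Filter.atTop
      (nhds Z.trace.re) :=
    (Complex.continuous_re.tendsto _).comp (tendsto_finsetSum _ fun i _ => hW _ _)
  obtain ⟨m, hm⟩ := (h2.eventually_lt h1 h).exists
  refine ⟨m, ?_⟩
  rw [maxOverlap_smul, Matrix.trace_smul, smul_eq_mul, Complex.re_ofReal_mul] at hm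
  exact lt_of_mul_lt_mul_left hm (by positivity)

/-- Extra copies of an entangled state are used to make the rows of Alice disjoint. -/
theorem IsEntanglingFilter.exists_disjoint_left {ρ : Matrix (A × B) (A × B) ℂ} (hρ : ρ.PosSemidef)
    (hsep : ¬ IsSeparableOperator ρ) (b : OrthonormalBasis A ℂ (EuclideanSpace ℂ A))
    {U : Matrix (Fin 2) (Fin n → A) ℂ} {V : Matrix (Fin 2) (Fin n → B) ℂ}
    (h : IsEntanglingFilter ρ U V) : ∃ (m : ℕ) (Γ : Matrix (Fin 2) (Fin m → A) ℂ)
      (Δ : Matrix (Fin 2) (Fin m → B) ℂ), HasDisjointSupports b Γ ∧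
      IsEntanglingFilter ρ (rowProduct U Γ) (rowProduct V Δ) := by
  obtain ⟨v, x, x', hne, hx⟩ := exists_compression_ne_zero hρ hsep (basisMatrix_mul_conjTranspose b)
  obtain ⟨p, Γ, hp, hΓ, hlim⟩ := exists_disjoint_rows b (hρ.compression v) hne hx
  obtain ⟨m, hm⟩ := h.exists_rowProduct Γ
    (fun m => Matrix.of fun _ y => star (∏ i, v (y i))) hp (by
      rintro ⟨s, t⟩ ⟨s', t'⟩
      refine (hlim s s').congr fun m => ?_
      rw [matPow_compression, ← localFilter_compression (Γ m) _ _ s s' t t'])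
  exact ⟨m, _, _, hΓ m, hm⟩

theorem IsEntanglingFilter.swap {ρ : Matrix (A × B) (A × B) ℂ} {U : Matrix (Fin 2) (Fin n → A) ℂ}
    {V : Matrix (Fin 2) (Fin n → B) ℂ} (h : IsEntanglingFilter ρ U V) :
    IsEntanglingFilter (ρ.submatrix Prod.swap Prod.swap) V U := by
  have h1 : (localFilter V U (tensorPower (ρ.submatrix Prod.swap Prod.swap) n)).trace =
      (localFilter U V (tensorPower ρ n)).trace := by
    rw [tensorPower_swap, localFilter_swap]
    exact Equiv.sum_comp (Equiv.prodComm _ _) fun x => localFilter U V (tensorPower ρ n) x x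
  rw [IsEntanglingFilter, h1, tensorPower_swap, localFilter_swap]
  exact h

theorem IsEntanglingFilter.exists_disjoint {ρ : Matrix (A × B) (A × B) ℂ} (hρ : ρ.PosSemidef)
    (hsep : ¬ IsSeparableOperator ρ) (bA : OrthonormalBasis A ℂ (EuclideanSpace ℂ A))
    (bB : OrthonormalBasis B ℂ (EuclideanSpace ℂ B))
    {U : Matrix (Fin 2) (Fin n → A) ℂ} {V : Matrix (Fin 2) (Fin n → B) ℂ}
    (h : IsEntanglingFilter ρ U V) : ∃ (k : ℕ) (U' : Matrix (Fin 2) (Fin k → A) ℂ)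
      (V' : Matrix (Fin 2) (Fin k → B) ℂ), HasDisjointSupports bA U' ∧ HasDisjointSupports bB V' ∧
      IsEntanglingFilter ρ U' V' := by
  obtain ⟨m, Γ, Δ, hΓ, h1⟩ := h.exists_disjoint_left hρ hsep bA
  obtain ⟨m', Δ', Γ', hΔ', h2⟩ := h1.swap.exists_disjoint_left
    (hρ.submatrix Prod.swap) (fun hs => hsep hs.swap) bB
  -- The rows added for Bob keep Alice's disjoint, since one factor with disjoint supports suffices.
  exact ⟨n + m + m', _, _, (hΓ.rowProduct_right U).rowProduct_left Γ', hΔ'.rowProduct_right _, h2.swap⟩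

end RowProduct

/-! ### Necessity -/

section Necessity

variable {X A B : Type} [Fintype X] [DecidableEq X] [Fintype A] [DecidableEq A] [Fintype B]
  [DecidableEq B] {k d : ℕ}

theorem exists_orthonormal_rows {b : OrthonormalBasis X ℂ (EuclideanSpace ℂ X)}
    {U : Matrix (Fin 2) (Fin k → X) ℂ} (hU : HasDisjointSupports b U) (hne : ∀ s, U s ≠ 0) :
    ∃ (α : Fin 2 → EuclideanSpace ℂ (Fin k → X)) (K : Matrix (Fin 2) (Fin 2) ℂ),
      Orthonormal ℂ α ∧ (K * rowFilter fun s => α s) = U ∧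
        (dephase b k (ketBra (α 0)) * dephase b k (ketBra (α 1))).trace = 0 := by
  -- Conjugates, because `rowFilter` conjugates its vectors; the norms removed from the rows are
  -- restored by the diagonal matrix K.
  let u : Fin 2 → EuclideanSpace ℂ (Fin k → X) := fun s => WithLp.toLp 2 fun x => star (U s x)
  have hu : ∀ s x, u s x = star (U s x) := fun _ _ => rfl
  have hu0 : ∀ s, u s ≠ 0 := by
    intro s hs
    apply hne s
    ext x
    have : u s x = 0 := by rw [hs]; rfl
    rw [hu, star_eq_zero] at this
    exact this
  let α : Fin 2 → EuclideanSpace ℂ (Fin k → X) := fun s => ((‖u s‖ : ℂ)⁻¹) • u s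
  have hα : ∀ s x, α s x = (‖u s‖ : ℂ)⁻¹ * star (U s x) := fun _ _ => rfl
  have hnorm : ∀ s, (‖u s‖ : ℂ) ≠ 0 := by
    intro s
    exact_mod_cast norm_ne_zero_iff.mpr (hu0 s)
  refine ⟨α, Matrix.diagonal fun s => (‖u s‖ : ℂ), ⟨fun s => ?_, fun s t hst => ?_⟩, ?_, ?_⟩
  · exact norm_smul_inv_norm (hu0 s)
  · have h := hU.mul_conjTranspose hst
    change inner ℂ (((‖u s‖ : ℂ)⁻¹) • u s) (((‖u t‖ : ℂ)⁻¹) • u t) = 0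
    rw [inner_smul_left, inner_smul_right, PiLp.inner_apply]
    have e : ∑ x, inner ℂ (u s x) (u t x) = (U * U.conjTranspose) s t := by
      rw [Matrix.mul_apply]
      refine Finset.sum_congr rfl fun x _ => ?_
      rw [hu, hu, Matrix.conjTranspose_apply]
      simp [mul_comm]
    rw [e, h, mul_zero, mul_zero]
  · ext s x
    rw [Matrix.diagonal_mul, rowFilter, Matrix.of_apply, hα, star_mul', star_star, star_inv₀,
      Complex.star_def, Complex.conj_ofReal, mul_inv_cancel_left₀ (hnorm s)]
  · refine trace_dephase_mul_dephase_eq_zero fun x => ?_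
    have h1 : ∀ s, star (productBasis b k x) ⬝ᵥ (α s) =
        (‖u s‖ : ℂ)⁻¹ * star (U.mulVec (productBasis b k x) s) := by
      intro s
      simp only [dotProduct, Matrix.mulVec, star_sum, Finset.mul_sum, hα, Pi.star_apply, star_mul']
      exact Finset.sum_congr rfl fun _ _ => by ring
    rw [h1, h1]
    exact (hU x).imp (fun h => by rw [h, star_zero, mul_zero]) fun h => by rw [h, star_zero, mul_zero]

/-- If one row vanishes, the overlap reduces to a single diagonal entry, which is at most the trace.
-/
theorem IsEntanglingFilter.row_ne_zero_left {ρ : Matrix (A × B) (A × B) ℂ} (hρ : ρ.PosSemidef)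
    {U : Matrix (Fin 2) (Fin k → A) ℂ} {V : Matrix (Fin 2) (Fin k → B) ℂ}
    (h : IsEntanglingFilter ρ U V) (s : Fin 2) : U s ≠ 0 := by
  intro hs
  set Z := localFilter U V (tensorPower ρ k) with hZ
  have h' : Z.trace.re < maxOverlap Z := h
  have hZp : Z.PosSemidef := (hρ.tensorPower k).localFilter _ _
  have hd : ∀ x, 0 ≤ (Z x x).re := fun x => (Complex.nonneg_iff.mp (hZp.diag_nonneg (i := x))).1
  have hs' : ∀ x, U s x = 0 := fun x => congrFun hs x
  have h1 : ∀ t y, Z (s, t) y = 0 := by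
    intro t y
    rw [hZ, localFilter_apply]
    simp [hs']
  have h2 : ∀ t y, Z y (s, t) = 0 := by
    intro t y
    rw [← hZp.1.apply, h1, star_zero]
  simp only [Matrix.trace, Matrix.diag_apply, maxOverlap, Fintype.sum_prod_type, Fin.sum_univ_two,
    Complex.add_re] at h'
  have d00 := hd (0, 0)
  have d01 := hd (0, 1)
  have d10 := hd (1, 0)
  have d11 := hd (1, 1)
  fin_cases s
  · simp only [Fin.zero_eta] at h1 h2
    simp only [h1, h2, Complex.zero_re] at h'
    linarith
  · simp only [Fin.mk_one] at h1 h2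
    simp only [h1, h2, Complex.zero_re] at h'
    linarith

theorem not_isSeparableOperator_of_isEntanglingFilter {ρ : Matrix (A × B) (A × B) ℂ}
    {U : Matrix (Fin 2) (Fin k → A) ℂ} {V : Matrix (Fin 2) (Fin k → B) ℂ}
    (h : IsEntanglingFilter ρ U V) : ¬ IsSeparableOperator ρ :=
  fun hs => h.not_ge ((hs.tensorPower k).localFilter U V).maxOverlap_le

/-- An operator whose overlap exceeds its trace has a two-qubit block with the same property. -/
theorem exists_filter_fin_two {C : Type} [Fintype C] [DecidableEq C]
    {Y : Matrix (C × C) (C × C) ℂ} (hY : Y.IsHermitian) (h : Y.trace.re < maxOverlap Y) :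
    ∃ R : Matrix (Fin 2) C ℂ, (localFilter R R Y).trace.re < maxOverlap (localFilter R R Y) := by
  by_contra! hcon
  refine h.not_ge ?_
  -- This is the reversed inequality for the block spanned by i and j; summed over all pairs it
  -- gives twice the reversed inequality for Y.
  have h1 : ∀ i j, 2 * (Y (i, i) (j, j)).re ≤ (Y (i, j) (i, j)).re + (Y (j, i) (j, i)).re := by
    intro i j
    have hsub : localFilter (Matrix.of fun s x => if x = ![i, j] s then (1 : ℂ) else 0)
        (Matrix.of fun s x => if x = ![i, j] s then (1 : ℂ) else 0) Y =
        Y.submatrix (Prod.map ![i, j] ![i, j]) (Prod.map ![i, j] ![i, j]) := by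
      ext p q
      rw [localFilter_apply]
      simp [Fintype.sum_prod_type, apply_ite (starRingEnd ℂ), Prod.map]
    have h2 := hcon (Matrix.of fun s x => if x = ![i, j] s then (1 : ℂ) else 0)
    have h3 : (Y (j, j) (i, i)).re = (Y (i, i) (j, j)).re := by
      rw [← hY.apply (j, j) (i, i)]
      simp
    rw [hsub] at h2
    simp [Matrix.trace, maxOverlap, Fintype.sum_prod_type, Fin.sum_univ_two, h3] at h2
    linarith
  have h2 : ∑ i, ∑ j, 2 * (Y (i, i) (j, j)).re ≤
      ∑ i, ∑ j, ((Y (i, j) (i, j)).re + (Y (j, i) (j, i)).re) :=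
    Finset.sum_le_sum fun i _ => Finset.sum_le_sum fun j _ => h1 i j
  have h3 : ∑ i, ∑ j, 2 * (Y (i, i) (j, j)).re = 2 * maxOverlap Y := by
    simp only [maxOverlap, Complex.re_sum, Finset.mul_sum]
  have h4 : ∑ i, ∑ j, ((Y (i, j) (i, j)).re + (Y (j, i) (j, i)).re) = 2 * Y.trace.re := by
    simp only [Finset.sum_add_distrib]
    rw [Finset.sum_comm (f := fun i j => (Y (j, i) (j, i)).re)]
    simp only [Matrix.trace, Matrix.diag_apply, Fintype.sum_prod_type, Complex.re_sum]
    ring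
  linarith

theorem IsMaximallyEntangled.sum_normSq {ψ : Fin d × Fin d → ℂ} (hψ : IsMaximallyEntangled ψ)
    (hd : 0 < d) : ∑ p, Complex.normSq (ψ p) = 1 := by
  have h : ∀ i, ∑ j, (Complex.normSq (ψ (i, j)) : ℂ) = (d : ℂ)⁻¹ := by
    intro i
    have := congrFun (congrFun hψ.1 i) i
    simp only [reducedA, Matrix.of_apply, ketBra_apply, Matrix.smul_apply, Matrix.one_apply_eq,
      smul_eq_mul, mul_one, Complex.star_def, Complex.mul_conj] at this
    exact this
  have hdc : (d : ℂ) ≠ 0 := by exact_mod_cast hd.ne'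
  apply Complex.ofReal_injective
  rw [Fintype.sum_prod_type]
  push_cast
  simp [h, hdc]

/-- A maximally entangled vector is rotated to the standard one by a unitary of Bob. -/
theorem IsMaximallyEntangled.exists_unitary {ψ : Fin d × Fin d → ℂ} (hψ : IsMaximallyEntangled ψ)
    (hd : 0 < d) : ∃ W : Matrix (Fin d) (Fin d) ℂ, W.conjTranspose * W = 1 ∧
      ∀ M : Matrix (Fin d × Fin d) (Fin d × Fin d) ℂ, maxOverlap (localFilter 1 W M) =
        d * (∑ x, star (ψ x) * ∑ y, M x y * ψ y).re := by
  have hdc : (d : ℂ) ≠ 0 := by exact_mod_cast hd.ne'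
  set c : ℝ := Real.sqrt d with hc
  have hcc : (c : ℂ) * c = d := by
    rw [← Complex.ofReal_mul, hc, Real.mul_self_sqrt (Nat.cast_nonneg d), Complex.ofReal_natCast]
  -- √d times the conjugate coefficient matrix of ψ is unitary because Bob's reduced state is 𝟙/d.
  refine ⟨Matrix.of fun i j => c * star (ψ (i, j)), ?_, fun M => ?_⟩
  · ext j j'
    have h := congrFun (congrFun hψ.2 j) j'
    simp only [reducedB, Matrix.of_apply, ketBra_apply, Matrix.smul_apply, smul_eq_mul] at h
    have e : ∑ i, star (c * star (ψ (i, j))) * (c * star (ψ (i, j'))) =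
        (d : ℂ) * ∑ i, ψ (i, j) * star (ψ (i, j')) := by
      rw [Finset.mul_sum, ← hcc]
      refine Finset.sum_congr rfl fun i _ => ?_
      rw [star_mul', star_star, Complex.star_def, Complex.conj_ofReal]
      ring
    simp only [Matrix.mul_apply, Matrix.conjTranspose_apply, Matrix.of_apply]
    rw [e, h, mul_inv_cancel_left₀ hdc]
  · have h1 : ∀ i j, localFilter (1 : Matrix (Fin d) (Fin d) ℂ)
        (Matrix.of fun i j => c * star (ψ (i, j))) M (i, i) (j, j) =
        d * ∑ l, ∑ m, star (ψ (i, l)) * (M (i, l) (j, m) * ψ (j, m)) := by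
      intro i j
      rw [localFilter_apply, ← hcc]
      simp only [Fintype.sum_prod_type, Matrix.one_apply, Matrix.of_apply, ite_mul, one_mul,
        zero_mul, star_mul', apply_ite star, star_zero, star_star, mul_ite, mul_zero]
      have e2 : ∀ (a b : Fin d) (f : Fin d → ℂ), (∑ k : Fin d, if a = b then f k else 0) =
          if a = b then ∑ k, f k else 0 := by
        intro i j f
        split_ifs <;> simp
      simp only [e2, Finset.sum_ite_eq, Finset.mem_univ, if_true]
      rw [Finset.sum_comm, Finset.mul_sum]
      simp only [Finset.sum_mul, Finset.mul_sum]
      refine Finset.sum_congr rfl fun l _ => Finset.sum_congr rfl fun m _ => ?_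
      have hs : star (c : ℂ) = c := Complex.conj_ofReal c
      rw [hs]
      ring
    have h2 : ∑ i, ∑ j, localFilter (1 : Matrix (Fin d) (Fin d) ℂ)
        (Matrix.of fun i j => c * star (ψ (i, j))) M (i, i) (j, j) =
        ((d : ℝ) : ℂ) * ∑ x, star (ψ x) * ∑ y, M x y * ψ y := by
      simp only [h1, Fintype.sum_prod_type, Finset.mul_sum, Complex.ofReal_natCast]
      exact Finset.sum_congr rfl fun i _ => Finset.sum_comm
    rw [maxOverlap, h2, Complex.re_ofReal_mul]

/-- After Bob's rotation the distilled state has overlap at least 3d/4 > 1, its trace. Both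
quantities are sums over Kraus branches, so one branch has overlap above its trace, and so does one
of its two-qubit blocks. -/
theorem HasDistillableEntanglement.exists_isEntanglingFilter {ρ : Matrix (A × B) (A × B) ℂ}
    (hρ : IsDensityMatrix ρ) (h : HasDistillableEntanglement ρ) :
    ∃ (n : ℕ) (U : Matrix (Fin 2) (Fin n → A) ℂ) (V : Matrix (Fin 2) (Fin n → B) ℂ),
      IsEntanglingFilter ρ U V := by
  obtain ⟨R, hR, hach⟩ := h
  -- R/2 keeps the rate positive, which excludes d = 1; 1/8 bounds the trace norm by 1/4 and hence
  -- the fidelity from below by 3/4.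
  obtain ⟨n, d, hn, hd, L, ψ, hψ, hdist, hrate⟩ := hach (min (R / 2) (1 / 8)) (by positivity)
  have hd2 : 2 ≤ d := by
    by_contra! hlt
    have : d = 1 := by omega
    rw [this, Nat.cast_one, Real.logb_one, zero_div] at hrate
    have := min_le_left (R / 2) (1 / 8)
    linarith
  have hnorm := hψ.sum_normSq hd
  obtain ⟨W, hW, hWov⟩ := hψ.exists_unitary hd
  set ω := L.run (tensorPower ρ n) with hω
  have hfid : 3 / 4 ≤ (∑ x, star (ψ x) * ∑ y, ω x y * ψ y).re := by
    have h1 := (normSq_dotProduct_mulVec_le (ω - ketBra ψ) ψ hnorm).trans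
      (sum_normSq_le_traceNorm_sq _)
    have h2 : traceNorm (ω - ketBra ψ) ≤ 1 / 4 := by
      have := hdist.trans (min_le_right _ _)
      rw [traceDistance] at this
      linarith
    have h3 : ∑ x, star (ψ x) * ∑ y, (ω - ketBra ψ) x y * ψ y =
        (∑ x, star (ψ x) * ∑ y, ω x y * ψ y) - 1 := by
      have e : ∑ x, star (ψ x) * ∑ y, ketBra ψ x y * ψ y = 1 := by
        have e1 : ∑ y, star (ψ y) * ψ y = 1 := by
          have := congrArg Complex.ofReal hnorm
          simpa [Complex.normSq_eq_conj_mul_self] using this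
        simp only [ketBra_apply, mul_assoc, ← Finset.mul_sum, e1, mul_one]
      rw [← e, ← Finset.sum_sub_distrib]
      refine Finset.sum_congr rfl fun x _ => ?_
      rw [← mul_sub, ← Finset.sum_sub_distrib]
      simp only [Matrix.sub_apply, sub_mul]
    rw [h3, Complex.normSq_apply, Complex.sub_re, Complex.one_re] at h1
    have h4 := traceNorm_nonneg (ω - ketBra ψ)
    nlinarith [mul_self_nonneg (∑ x, star (ψ x) * ∑ y, ω x y * ψ y - 1).im]
  obtain ⟨ι, _, K, J, hKJ⟩ := L.exists_kraus
  have hωd : ω.trace = 1 := by rw [hω, L.trace_run, trace_tensorPower, hρ.2, one_pow]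
  have htr : (localFilter (1 : Matrix (Fin d) (Fin d) ℂ) W ω).trace = 1 := by
    rw [(Converts.isometry 1 W (by simp) hW ω).trace_eq, hωd]
  have hov : 1 < maxOverlap (localFilter (1 : Matrix (Fin d) (Fin d) ℂ) W ω) := by
    rw [hWov]
    have : (2 : ℝ) ≤ d := by exact_mod_cast hd2
    nlinarith
  have hsum : localFilter (1 : Matrix (Fin d) (Fin d) ℂ) W ω = ∑ i, localFilter (K i) (W * J i) (tensorPower ρ n) := by
    rw [hω, hKJ, localFilter_sum]
    simp only [localFilter_localFilter, Matrix.one_mul]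
  rw [hsum, Matrix.trace_sum] at htr
  rw [hsum, maxOverlap_sum] at hov
  have htr' := congrArg Complex.re htr
  rw [Complex.re_sum, Complex.one_re] at htr'
  obtain ⟨i, _, hi⟩ := Finset.exists_lt_of_sum_lt (htr'.trans_lt hov)
  obtain ⟨Q, hQ⟩ := exists_filter_fin_two ((hρ.1.tensorPower n).localFilter _ _).1 hi
  rw [localFilter_localFilter] at hQ
  exact ⟨n, _, _, hQ⟩

end Necessity

theorem corollary8 {A B : Type} [Fintype A] [DecidableEq A] [Fintype B] [DecidableEq B]
    (ρ : Matrix (A × B) (A × B) ℂ) (hρ : IsDensityMatrix ρ) :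
    HasDistillableEntanglement ρ ↔
      ∀ (bA : OrthonormalBasis A ℂ (EuclideanSpace ℂ A))
        (bB : OrthonormalBasis B ℂ (EuclideanSpace ℂ B)),
        ∃ (k : ℕ) (α : Fin 2 → EuclideanSpace ℂ (Fin k → A))
          (β : Fin 2 → EuclideanSpace ℂ (Fin k → B)),
          Orthonormal ℂ α ∧ Orthonormal ℂ β ∧
          IsEntangled
            (((ketBra (α 0) + ketBra (α 1)) ⊗ₖ (ketBra (β 0) + ketBra (β 1)))
              * tensorPower ρ k
              * ((ketBra (α 0) + ketBra (α 1)) ⊗ₖ (ketBra (β 0) + ketBra (β 1)))) ∧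
          (dephase bA k (ketBra (α 0)) * dephase bA k (ketBra (α 1))).trace = 0 ∧
          (dephase bB k (ketBra (β 0)) * dephase bB k (ketBra (β 1))).trace = 0 := by
  constructor
  · intro h bA bB
    obtain ⟨n, U, V, hUV⟩ := h.exists_isEntanglingFilter hρ
    obtain ⟨k, U', V', hU, hV, hent⟩ := hUV.exists_disjoint hρ.1
      (not_isSeparableOperator_of_isEntanglingFilter hUV) bA bB
    obtain ⟨α, K, hα, hKα, hαd⟩ := exists_orthonormal_rows hU (hent.row_ne_zero_left hρ.1)
    obtain ⟨β, J, hβ, hJβ, hβd⟩ := exists_orthonormal_rows hV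
      (hent.swap.row_ne_zero_left (hρ.1.submatrix Prod.swap))
    refine ⟨k, α, β, hα, hβ, ?_, hαd, hβd⟩
    refine isEntangled_of_lt_maxOverlap (hρ.1.tensorPower k) hα hβ K J ?_
    rw [hKα, hJβ]
    exact hent
  · intro h
    -- Any pair of bases would do here; only the entanglement of the projected operator matters.
    obtain ⟨k, α, β, hα, -, hent, -, -⟩ :=
      h (EuclideanSpace.basisFun A ℂ) (EuclideanSpace.basisFun B ℂ)
    have hk : 0 < k := by
      rcases Nat.eq_zero_or_pos k with rfl | hk
      · exact absurd hα not_orthonormal_of_power_zero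
      · exact hk
    exact hasDistillableEntanglement_of_isEntangled hρ hk (fun s => α s) (fun s => β s) hent
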